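/- Let $n\ge 3$, $m>0$, $r_0=(m/2)^{1/(n-2)}$, and let $(M^n,g)$ be the Schwarzschild space: $M=\{x\in\mathbb{R}^n:|x|\ge r_0\}$ with metric $g_{ij}(x)=\left(1+\frac m2|x|^{2-n}\right)^{\frac4{n-2}}\delta_{ij}$, whose boundary $\partial M=\{|x|=r_0\}$ is called the horizon. Equivalently $g=\frac{ds^2}{1-2ms^{2-n}}+s^2g_{\mathbb{S}^{n-1}}$ with $s=|x|\left(1+\frac m2|x|^{2-n}\right)^{\frac2{n-2}}$. Put $f=\sqrt{1-2ms^{2-n}}$ and let $\omega_{n-1}$ be the area of the unit sphere $\mathbb{S}^{n-1}\subset\mathbb{R}^n$. A closed embedded smooth hypersurface $\Sigma$ contained in the interior of $M$ is called null-homologous if $\Sigma=\partial\Omega$ for a bounded domain $\Omega$ with closure in the interior of $M$, and homologous to the horizon if $\partial\Omega=\Sigma\sqcup\partial M$ for a bounded domain $\Omega$ of $M$. Let $x:S\times[0,T)\to M$, with $S$ a closed smooth $(n-1)$-manifold, be a smooth solution of the inverse mean curvature flow $$\frac{\partial x}{\partial t}=\frac1H\,\nu ,$$ where every $x(\cdot,t)$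 is an embedding whose image $\Sigma_t=x(S,t)$ is null-homologous or homologous to the horizon, bounding the domain $\Omega_t$ (together with $\partial M$ in the second case), $\nu$ is the unit normal of $\Sigma_t$ pointing out of $\Omega_t$, and $H>0$ is the mean curvature of $\Sigma_t$ with respect to $\nu$. Let $|\Sigma_t|$ and $d\mu_t$ be the area and the area form of $\Sigma_t$ induced by $g$, and define $$Q(t)=|\Sigma_t|^{-\frac{n-2}{n-1}}\left(\int_{\Sigma_t}fH\,d\mu_t+2(n-1)m\,\omega_{n-1}\right),\qquad \tilde Q(t)=|\Sigma_t|^{-\frac{n-2}{n-1}}\int_{\Sigma_t}fH\,d\mu_t .$$ Let $0<t_1<t_2<T$. 1. If $\Sigma_t$ is homologous to the horizon for all $t\in[t_1,t_2]$, then $Q(t_2)\le Q(t_1)$, with equality if and only if $\Sigma_t$ is totally umbilic for every $t\in[t_1,t_2]$. 2. If $\Sigma_t$ is null-homologous for all $t\in[t_1,t_2]$, then $\tilde Q(t_2)\le\tilde Q(t_1)$, with equality if and only if $\Sigma_t$ is totally umbilic for every $t\in[t_1,t_2]$; moreover $Q(t)$ is strictly decreasing in $t\in[t_1,t_2]$.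 -/

import Mathlib

open Set Metric MeasureTheory
open scoped Manifold ContDiff

noncomputable section

namespace Schwarzschild

/-- Euclidean space of dimension `n`, carrying the isotropic coordinates. -/
abbrev E (n : ℕ) : Type := EuclideanSpace ℝ (Fin n)

/-! ### The Schwarzschild space of dimension `n` and mass `m`

The space is `M = {x ∈ ℝⁿ : r₀ ≤ |x|}` with boundary the horizon `{|x| = r₀}`. -/

/-- The horizon radius `r₀ = (m / 2) ^ (1 / (n - 2))` in isotropic coordinates. -/
def horizonRadius (n : ℕ) (m : ℝ) : ℝ := (m / 2) ^ (1 / ((n : ℝ) - 2))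

/-- The horizon `∂M`. -/
def horizon (n : ℕ) (m : ℝ) : Set (E n) := sphere 0 (horizonRadius n m)

/-- The interior of the manifold with boundary `M`. -/
def interiorM (n : ℕ) (m : ℝ) : Set (E n) := {x | horizonRadius n m < ‖x‖}

/-- The function `1 + (m / 2) |x| ^ (2 - n)`. -/
def potentialU {n : ℕ} (m : ℝ) (x : E n) : ℝ := 1 + m / 2 * ‖x‖ ^ (2 - (n : ℝ))

/-- The Schwarzschild metric `g_x(v, w) = (1 + (m / 2) |x| ^ (2 - n)) ^ (4 / (n - 2)) ⟨v, w⟩`. -/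
def metric {n : ℕ} (m : ℝ) (x v w : E n) : ℝ :=
  potentialU m x ^ (4 / ((n : ℝ) - 2)) * inner ℝ v w

/-- The area radius `s(x)`, that is `s = |x| (1 + (m / 2) |x| ^ (2 - n)) ^ (2 / (n - 2))`, for which
`g = ds² / (1 - 2 m s ^ (2 - n)) + s² g_{S^{n-1}}`. -/
def areaRadius {n : ℕ} (m : ℝ) (x : E n) : ℝ :=
  ‖x‖ * potentialU m x ^ (2 / ((n : ℝ) - 2))

/-- The potential function `f = √(1 - 2 m s ^ (2 - n))`. -/
def potential {n : ℕ} (m : ℝ) (x : E n) : ℝ :=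
  √(1 - 2 * m * areaRadius m x ^ (2 - (n : ℝ)))

/-- The Christoffel symbols of the first kind of `g`: for constant vector fields `a`, `b`, `c`,
`g(∇_a b, c) = (a g(b, c) + b g(a, c) - c g(a, b)) / 2`, where `∇` is the Levi-Civita connection. -/
def christoffel {n : ℕ} (m : ℝ) (x a b c : E n) : ℝ :=
  (fderiv ℝ (fun y => metric m y b c) x a + fderiv ℝ (fun y => metric m y a c) x b
    - fderiv ℝ (fun y => metric m y a b) x c) / 2

/-- The area `ω_{n-1}` of the Euclidean unit sphere in `ℝⁿ`. -/
def sphereArea (n : ℕ) : ℝ := (volume : Measure (E n)).toSphere.real univ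

/-! ### Domains and their boundary hypersurfaces

A domain is given by its interior, an open connected subset `Ω` of the interior of `M`. -/

/-- `Ω` is a bounded domain whose only boundary is `Σ`. -/
structure NullHomologous {n : ℕ} (m : ℝ) (Sig Ω : Set (E n)) : Prop where
  isOpen : IsOpen Ω
  isConnected : IsConnected Ω
  isBounded : Bornology.IsBounded Ω
  closure_subset : closure Ω ⊆ interiorM n m
  frontier_eq : frontier Ω = Sig

/-- `Ω` is a bounded domain whose boundary is the disjoint union of `Σ` and the horizon. -/
structure HomologousToHorizon {n : ℕ} (m : ℝ) (Sig Ω : Set (E n)) : Prop where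
  isOpen : IsOpen Ω
  isConnected : IsConnected Ω
  isBounded : Bornology.IsBounded Ω
  subset : Ω ⊆ interiorM n m
  boundary_subset : Sig ⊆ interiorM n m
  frontier_eq : frontier Ω = Sig ∪ horizon n m

/-! ### Geometry of an immersed hypersurface `x : S → M` with unit normal `ν : S → ℝⁿ` -/

section Hypersurface

variable {n : ℕ} {S : Type*} [TopologicalSpace S] [ChartedSpace (E (n - 1)) S]

/-- The differential `dx_p : T_p S → ℝⁿ`. -/
def differential (x : S → E n) (p : S) (v : TangentSpace (𝓡 (n - 1)) p) : E n :=
  mfderiv (𝓡 (n - 1)) 𝓘(ℝ, E n) x p v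

/-- The induced metric `(x^* g)_p (v, w)`. -/
def inducedMetric (m : ℝ) (x : S → E n) (p : S) (v w : TangentSpace (𝓡 (n - 1)) p) : ℝ :=
  metric m (x p) (differential x p v) (differential x p w)

/-- The second fundamental form `h_p(v, w) = g(∇_v ν, dx w)` with respect to the Schwarzschild
metric. -/
def secondFundamentalForm (m : ℝ) (x ν : S → E n) (p : S)
    (v w : TangentSpace (𝓡 (n - 1)) p) : ℝ :=
  metric m (x p) (differential ν p v) (differential x p w)
    + christoffel m (x p) (differential x p v) (ν p) (differential x p w)

/-- The `a`-th vector of the standard basis of `T_p S`, which Mathlib models on `ℝ^{n-1}`. -/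
def tangentBasis (p : S) (a : Fin (n - 1)) : TangentSpace (𝓡 (n - 1)) p :=
  (EuclideanSpace.single a 1 : E (n - 1))

/-- The mean curvature `H`, the trace of the second fundamental form with respect to the induced
metric. -/
def meanCurvature (m : ℝ) (x ν : S → E n) (p : S) : ℝ :=
  Matrix.trace
    ((Matrix.of fun a b => inducedMetric m x p (tangentBasis p a) (tangentBasis p b))⁻¹ *
      (Matrix.of fun a b => secondFundamentalForm m x ν p (tangentBasis p a) (tangentBasis p b)))

/-- The hypersurface is totally umbilic: at every point the second fundamental form is a multiple of
the induced metric. -/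
def TotallyUmbilic (m : ℝ) (x ν : S → E n) : Prop :=
  ∀ p : S, ∃ c : ℝ, ∀ v w : TangentSpace (𝓡 (n - 1)) p,
    secondFundamentalForm m x ν p v w = c * inducedMetric m x p v w

/-- The density `√(det g_ab)` of the area form `dμ` of the induced metric in the chart at `q`,
at the point `z` of the target of the chart. -/
def areaDensity (m : ℝ) (x : S → E n) (q : S) (z : E (n - 1)) : ℝ :=
  let X : E (n - 1) → E n := fun y => x ((chartAt (E (n - 1)) q).symm y)
  √(Matrix.det (Matrix.of fun a b : Fin (n - 1) =>
    metric m (X z) (fderiv ℝ X z (EuclideanSpace.single a 1))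
      (fderiv ℝ X z (EuclideanSpace.single b 1))))

variable [T2Space S] [CompactSpace S] [IsManifold (𝓡 (n - 1)) ∞ S]

variable (n S) in
/-- A smooth partition of unity subordinate to the charts of `S`. -/
def partition : SmoothPartitionOfUnity S (𝓡 (n - 1)) S univ :=
  (SmoothPartitionOfUnity.exists_isSubordinate_chartAt_source (𝓡 (n - 1)) S).choose

/-- The integral `∫_S F dμ` with respect to the area form of the induced metric, computed in charts
with a smooth partition of unity (for continuous `F` it does not depend on the choices). -/
def surfaceIntegral (m : ℝ) (x : S → E n) (F : S → ℝ) : ℝ :=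
  ∑ᶠ q : S, ∫ z in (chartAt (E (n - 1)) q).target,
    partition n S q ((chartAt (E (n - 1)) q).symm z) * F ((chartAt (E (n - 1)) q).symm z) *
      areaDensity m x q z

/-- The area `|Σ|` of the hypersurface with respect to the Schwarzschild metric. -/
def area (m : ℝ) (x : S → E n) : ℝ := surfaceIntegral m x fun _ => 1

/-- The total weighted mean curvature `∫_Σ f H dμ`. -/
def weightedMeanCurvature (m : ℝ) (x ν : S → E n) : ℝ :=
  surfaceIntegral m x fun p => potential m (x p) * meanCurvature m x ν p

/-- `Q = |Σ| ^ (-(n-2)/(n-1)) (∫_Σ f H dμ + 2 (n - 1) m ω_{n-1})`. -/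
def Q (m : ℝ) (x ν : S → E n) : ℝ :=
  area m x ^ (-(((n : ℝ) - 2) / ((n : ℝ) - 1))) *
    (weightedMeanCurvature m x ν + 2 * ((n : ℝ) - 1) * m * sphereArea n)

/-- `Q̃ = |Σ| ^ (-(n-2)/(n-1)) ∫_Σ f H dμ`. -/
def Qtilde (m : ℝ) (x ν : S → E n) : ℝ :=
  area m x ^ (-(((n : ℝ) - 2) / ((n : ℝ) - 1))) * weightedMeanCurvature m x ν

end Hypersurface

/-! ### Smooth inverse mean curvature flow -/

/-- A smooth solution on `[0, T)` of the inverse mean curvature flow `∂x/∂t = ν / H` in the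
Schwarzschild space: `Σ_t` is the image of `x t`, it is the boundary (apart from the horizon) of the
bounded domain `Ω t`, and `ν t` is its unit normal pointing out of `Ω t`. -/
structure IsSmoothIMCF {n : ℕ} {S : Type*} [TopologicalSpace S] [ChartedSpace (E (n - 1)) S]
    (m T : ℝ) (x ν : ℝ → S → E n) (Ω : ℝ → Set (E n)) : Prop where
  smooth : ContMDiffOn ((𝓡 (n - 1)).prod 𝓘(ℝ, ℝ)) 𝓘(ℝ, E n) ∞
    (fun q : S × ℝ => x q.2 q.1) (univ ×ˢ Ico 0 T)
  smooth_normal : ContMDiffOn ((𝓡 (n - 1)).prod 𝓘(ℝ, ℝ)) 𝓘(ℝ, E n) ∞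
    (fun q : S × ℝ => ν q.2 q.1) (univ ×ˢ Ico 0 T)
  injective : ∀ t ∈ Ico 0 T, Function.Injective (x t)
  immersion : ∀ t ∈ Ico 0 T, ∀ p, Function.Injective (differential (x t) p)
  bounds : ∀ t ∈ Ico 0 T,
    NullHomologous m (range (x t)) (Ω t) ∨ HomologousToHorizon m (range (x t)) (Ω t)
  normal_unit : ∀ t ∈ Ico 0 T, ∀ p, metric m (x t p) (ν t p) (ν t p) = 1
  normal_orthogonal : ∀ t ∈ Ico 0 T, ∀ p, ∀ v : TangentSpace (𝓡 (n - 1)) p,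
    metric m (x t p) (ν t p) (differential (x t) p v) = 0
  normal_outward : ∀ t ∈ Ico 0 T, ∀ p, ∃ ε > 0, ∀ s ∈ Ioo (0 : ℝ) ε,
    x t p - s • ν t p ∈ Ω t ∧ x t p + s • ν t p ∉ closure (Ω t)
  meanCurvature_pos : ∀ t ∈ Ico 0 T, ∀ p, 0 < meanCurvature m (x t) (ν t) p
  flow : ∀ t ∈ Ico 0 T, ∀ p,
    HasDerivWithinAt (fun τ => x τ p) ((meanCurvature m (x t) (ν t) p)⁻¹ • ν t p) (Ico 0 T) t

end Schwarzschild

end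

open Set Metric MeasureTheory
open scoped Manifold ContDiff

noncomputable section

namespace Schwarzschild

/-! The Schwarzschild metric is conformally flat, `g = c² δ` with `c = u ^ (2 / (n - 2))` and `u = 1
+ (m / 2)|x| ^ (2 - n)` harmonic, so everything is computed with Euclidean quantities. With `N = c
ν`, Euclidean shape operator `A` and `k = n - 1`, one has `c H = tr A + k ∂_N log c` (`confMean`),
`f = (2 - u) / u` and `c ^ k = c u²`. Hence `f H dμ` has Euclidean density `(2 - u) u (c H)`, and
the flow has Euclidean normal speed `φ = 1 / (c H)`.

The pointwise core is `LocalFlow.tD_weightDens`. The time derivative of this density is `-4 ⟨N, ∇u⟩`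
times the Euclidean area density, plus `(n - 2)/(n - 1)` times the density itself, minus a
nonnegative multiple of `|Å|²`, plus a surface divergence. It combines the variation formula for a
weighted mean curvature (`LocalFlow.mean_evolution`), that for the flux of an ambient field
(`LocalFlow.flux_evolution`), harmonicity of `u`, and an identity for `Hess u (N, N)`
(`static_identity`) that plays the role of the static equation. Newton's inequality
`Adapted.sq_tr_le` gives the sign of the defect and identifies its vanishing with umbilicity.

Integrating over the closed hypersurface removes the divergence
(`IsSmoothIMCF.chartIntegral_zdiv_eq_zero`). Since `|Σ|' = |Σ|`, the power of `|Σ|` in `Q` absorbs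
the growth term, leaving `|Σ| ^ (-(n-2)/(n-1)) (-4 ∫ ⟨N, ∇u⟩ - (n-2)/(n-1) C - D)` as the derivative
of `|Σ| ^ (-(n-2)/(n-1)) (∫ f H + C)`, where `D ≥ 0` vanishes exactly on umbilic hypersurfaces
(`IsSmoothIMCF.hasDerivAt_scaled`).

The flux of `∇u` is topological: it is `0` in the null-homologous case and `(m/2)(2 - n) ω` when the
hypersurface encloses the horizon. In the latter case `C = 2(n-1)mω` exactly cancels it; in the
former `C = 0` suffices, and `C > 0` makes the decrease strict. The flux is evaluated by a
divergence theorem for the enclosed region (`IsSmoothIMCF.flux_eq_integral`), whose boundary collar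
is supplied by the flow itself: as `φ > 0`, space-time maps diffeomorphically onto a neighbourhood
of each point of `Σ_t`. -/

/-! ### Linear algebra of a hyperplane with unit normal -/

/-- The trace as a continuous linear functional on the endomorphisms of a space. -/
def tr (V : Type*) [NormedAddCommGroup V] [NormedSpace ℝ V] [FiniteDimensional ℝ V] :
    (V →L[ℝ] V) →L[ℝ] ℝ :=
  LinearMap.toContinuousLinearMap ((LinearMap.trace ℝ V) ∘ₗ ContinuousLinearMap.coeLM ℝ)

section Trace

variable {V W : Type*} [NormedAddCommGroup V] [NormedSpace ℝ V] [FiniteDimensional ℝ V]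
  [NormedAddCommGroup W] [NormedSpace ℝ W] [FiniteDimensional ℝ W]

theorem tr_apply (A : V →L[ℝ] V) : tr V A = LinearMap.trace ℝ V (A : V →ₗ[ℝ] V) := rfl

theorem tr_comp_comm (A : V →L[ℝ] W) (B : W →L[ℝ] V) : tr W (A ∘L B) = tr V (B ∘L A) := by
  simp only [tr_apply, ContinuousLinearMap.toLinearMap_comp]
  exact LinearMap.trace_comp_comm' _ _

theorem tr_smulRight (f : V →L[ℝ] ℝ) (x : V) : tr V (f.smulRight x) = f x := by
  simp only [tr_apply]
  exact LinearMap.trace_smulRight (f : V →ₗ[ℝ] ℝ) x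

theorem tr_id : tr V (ContinuousLinearMap.id ℝ V) = Module.finrank ℝ V := by
  simp [tr_apply]

end Trace

theorem tr_euclidean {k : ℕ} (A : E k →L[ℝ] E k) :
    tr (E k) A = ∑ a, A (EuclideanSpace.single a 1) a := by
  rw [tr_apply, LinearMap.trace_eq_sum_inner _ (EuclideanSpace.basisFun (Fin k) ℝ)]
  simp [EuclideanSpace.inner_single_left]

/-- A linear immersion `L` with unit normal `N`, and the left inverse `P` of `L` with kernel `N`. -/
structure Adapted {k n : ℕ} (L : E k →L[ℝ] E n) (N : E n) (P : E n →L[ℝ] E k) : Prop where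
  norm_normal : inner ℝ N N = (1 : ℝ)
  orthogonal : ∀ η, inner ℝ N (L η) = (0 : ℝ)
  left_inv : ∀ η, P (L η) = η
  ker : P N = 0
  decomp : ∀ y, L (P y) + (inner ℝ N y : ℝ) • N = y

/-- The left inverse of `L` that vanishes on `N`. -/
def leftInv {k n : ℕ} (L : E k →L[ℝ] E n) (N : E n) : E n →L[ℝ] E k :=
  (ContinuousLinearMap.fst ℝ (E k) ℝ) ∘L
    (L.coprod (ContinuousLinearMap.toSpanSingleton ℝ N)).inverse

/-- Pairing with `N` isolates the scalar component, injectivity of `L` handles the rest, and `n = k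
+ 1` upgrades injectivity to invertibility. -/
theorem isInvertible_coprod {k n : ℕ} (hn : n = k + 1) {L : E k →L[ℝ] E n} {N : E n}
    (h1 : inner ℝ N N = (1 : ℝ)) (h2 : ∀ η, inner ℝ N (L η) = (0 : ℝ))
    (hL : Function.Injective L) :
    (L.coprod (ContinuousLinearMap.toSpanSingleton ℝ N)).IsInvertible := by
  have hinj : Function.Injective (L.coprod (ContinuousLinearMap.toSpanSingleton ℝ N)) := by
    rw [injective_iff_map_eq_zero]
    rintro ⟨η, s⟩ h
    simp only [ContinuousLinearMap.coprod_apply, ContinuousLinearMap.toSpanSingleton_apply] at h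
    have hs : s = 0 := by
      have := congrArg (fun y => inner ℝ N y) h
      simpa [inner_add_right, inner_smul_right, h1, h2, -inner_self_eq_norm_sq_to_K] using this
    subst hs
    have : L η = L 0 := by simpa using h
    rw [hL this]; rfl
  have hdim : Module.finrank ℝ (E k × ℝ) = Module.finrank ℝ (E n) := by simp [hn]
  let e := (LinearEquiv.ofInjectiveOfFinrankEq
    (L.coprod (ContinuousLinearMap.toSpanSingleton ℝ N)).toLinearMap hinj hdim)
  exact ⟨e.toContinuousLinearEquiv, by ext x <;> rfl⟩

theorem adapted_leftInv {k n : ℕ} (hn : n = k + 1) {L : E k →L[ℝ] E n} {N : E n}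
    (h1 : inner ℝ N N = (1 : ℝ)) (h2 : ∀ η, inner ℝ N (L η) = (0 : ℝ))
    (hL : Function.Injective L) : Adapted L N (leftInv L N) := by
  obtain ⟨e, he⟩ := isInvertible_coprod hn h1 h2 hL
  have hP : ∀ y, leftInv L N y = (e.symm y).1 := by
    intro y; simp [leftInv, ← he]
  have he' : ∀ η s, e (η, s) = L η + s • N := by
    intro η s
    rw [← ContinuousLinearEquiv.coe_coe, he]; simp
  refine ⟨h1, h2, fun η => ?_, ?_, fun y => ?_⟩
  · rw [hP, show L η = e (η, 0) by simp [he']]; simp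
  · rw [hP, show N = e (0, 1) by simp [he']]; simp
  · obtain ⟨⟨η, s⟩, rfl⟩ := e.surjective y
    rw [hP, ContinuousLinearEquiv.symm_apply_apply]
    simp only [he', inner_add_right, h2, inner_smul_right, h1, mul_one, zero_add]

namespace Adapted

variable {k n : ℕ} {L : E k →L[ℝ] E n} {N : E n} {P : E n →L[ℝ] E k}

/-- The range of `L` and `N` span the space. This allows tangential projections computed in
different charts to be compared. -/
theorem unique (h : Adapted L N P) {P' : E n →L[ℝ] E k} (h1 : ∀ η, P' (L η) = η) (h2 : P' N = 0) :
    P' = P := by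
  ext1 y
  conv_lhs => rw [← h.decomp y]
  simp [h1, h2]

theorem decomp' (h : Adapted L N P) (y : E n) : L (P y) = y - (inner ℝ N y : ℝ) • N :=
  eq_sub_of_add_eq (h.decomp y)

theorem injective (h : Adapted L N P) : Function.Injective L :=
  Function.LeftInverse.injective h.left_inv

theorem inner_tangential (h : Adapted L N P) (y : E n) (η : E k) :
    inner ℝ (L (P y)) (L η) = (inner ℝ y (L η) : ℝ) := by
  rw [h.decomp', inner_sub_left, inner_smul_left, h.orthogonal]; simp

theorem comp_equiv (h : Adapted L N P) (A : E k ≃L[ℝ] E k) :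
    Adapted (L ∘L (A : E k →L[ℝ] E k)) N ((A.symm : E k →L[ℝ] E k) ∘L P) := by
  refine ⟨h.norm_normal, fun η => ?_, fun η => ?_, ?_, fun y => ?_⟩
  · simp [h.orthogonal]
  · simp [h.left_inv]
  · simp [h.ker]
  · simp [h.decomp]

/-- The trace of `P B L` for an ambient endomorphism `B`. -/
theorem tr_conj (h : Adapted L N P) (B : E n →L[ℝ] E n) :
    tr (E k) (P ∘L B ∘L L) = tr (E n) B - inner ℝ N (B N) := by
  have h1 : tr (E k) (P ∘L B ∘L L) = tr (E n) (B ∘L L ∘L P) := by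
    rw [tr_comp_comm, ContinuousLinearMap.comp_assoc]
  have h2 : B ∘L L ∘L P = B - ((innerSL ℝ N).smulRight (B N)) := by
    ext1 y
    simp only [ContinuousLinearMap.comp_apply, h.decomp', _root_.sub_apply,
      ContinuousLinearMap.smulRight_apply, innerSL_apply_apply, map_sub, map_smul]
  rw [h1, h2, map_sub, tr_smulRight, innerSL_apply_apply]

end Adapted

/-! ### Gram determinants -/

/-- The Gram matrix of the images of the standard basis under `L`. -/
def gram {k n : ℕ} (L : E k →L[ℝ] E n) : Matrix (Fin k) (Fin k) ℝ :=
  Matrix.of fun a b => inner ℝ (L (EuclideanSpace.single a 1)) (L (EuclideanSpace.single b 1))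

/-- The volume of the parallelepiped spanned by the images of the standard basis under `L`. -/
def gramVol {k n : ℕ} (L : E k →L[ℝ] E n) : ℝ := √(gram L).det

/-- The matrix of an endomorphism of `ℝᵏ`. -/
def mat {k : ℕ} (A : E k →L[ℝ] E k) : Matrix (Fin k) (Fin k) ℝ :=
  Matrix.of fun a b => A (EuclideanSpace.single b 1) a

theorem mat_eq {k : ℕ} (A : E k →L[ℝ] E k) :
    mat A = LinearMap.toMatrix (EuclideanSpace.basisFun (Fin k) ℝ).toBasis
      (EuclideanSpace.basisFun (Fin k) ℝ).toBasis (A : E k →ₗ[ℝ] E k) := by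
  ext a b
  simp [mat, LinearMap.toMatrix_apply]

theorem det_mat {k : ℕ} (A : E k →L[ℝ] E k) : (mat A).det = A.det := by
  rw [mat_eq, LinearMap.det_toMatrix]

theorem trace_mat {k : ℕ} (A : E k →L[ℝ] E k) : (mat A).trace = tr (E k) A := by
  rw [tr_euclidean]; rfl

theorem single_sum {k : ℕ} (y : E k) : ∑ a, y a • EuclideanSpace.single a (1 : ℝ) = y := by
  ext b; simp [Finset.sum_apply, Pi.single_apply]

/-- Pairing with `L` in terms of the Gram matrix. -/
theorem pairing_eq_mat_mul_gram {k n : ℕ} (L : E k →L[ℝ] E n) (A : E k →L[ℝ] E k) :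
    (Matrix.of fun a b => inner ℝ (L (A (EuclideanSpace.single a 1)))
      (L (EuclideanSpace.single b 1))) = (mat A).transpose * gram L := by
  ext a b
  simp only [Matrix.of_apply, Matrix.mul_apply, Matrix.transpose_apply, mat, gram]
  conv_lhs => rw [← single_sum (A (EuclideanSpace.single a 1))]
  simp [sum_inner, inner_smul_left, map_sum]

theorem gram_comp {k n : ℕ} (L : E k →L[ℝ] E n) (A : E k →L[ℝ] E k) :
    gram (L ∘L A) = (mat A).transpose * gram L * mat A := by
  rw [← pairing_eq_mat_mul_gram]
  ext a b
  simp only [gram, Matrix.of_apply, Matrix.mul_apply, mat, ContinuousLinearMap.comp_apply]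
  conv_lhs => rw [← single_sum (A (EuclideanSpace.single b 1))]
  simp [inner_sum, inner_smul_right, map_sum, mul_comm]

theorem gramVol_comp {k n : ℕ} (L : E k →L[ℝ] E n) (A : E k →L[ℝ] E k) :
    gramVol (L ∘L A) = |A.det| * gramVol L := by
  rw [gramVol, gram_comp, Matrix.det_mul, Matrix.det_mul, Matrix.det_transpose, det_mat,
    show A.det * (gram L).det * A.det = A.det ^ 2 * (gram L).det by ring,
    Real.sqrt_mul (sq_nonneg _), Real.sqrt_sq_eq_abs, gramVol]

theorem det_gram_pos {k n : ℕ} {L : E k →L[ℝ] E n} (hL : Function.Injective L) :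
    0 < (gram L).det := by
  have : (gram L).PosDef := by
    have hli : LinearIndependent ℝ fun a : Fin k => L (EuclideanSpace.single a 1) := by
      have := (EuclideanSpace.basisFun (Fin k) ℝ).toBasis.linearIndependent.map'
        (L : E k →ₗ[ℝ] E n) (LinearMap.ker_eq_bot.mpr hL)
      have he : (fun a : Fin k => L (EuclideanSpace.single a 1)) =
          (L : E k →ₗ[ℝ] E n) ∘ (EuclideanSpace.basisFun (Fin k) ℝ).toBasis := by
        ext a; simp
      rw [he]; exact this
    exact Matrix.posDef_gram_of_linearIndependent hli
  exact this.det_pos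

theorem gramVol_pos {k n : ℕ} {L : E k →L[ℝ] E n} (hL : Function.Injective L) :
    0 < gramVol L := Real.sqrt_pos.mpr (det_gram_pos hL)

/-- The trace with respect to the Gram matrix of a pairing with `L`. -/
theorem Adapted.trace_gram_inv {k n : ℕ} {L : E k →L[ℝ] E n} {N : E n} {P : E n →L[ℝ] E k}
    (h : Adapted L N P) (M : E k →L[ℝ] E n) :
    Matrix.trace ((gram L)⁻¹ * Matrix.of fun a b => inner ℝ (M (EuclideanSpace.single a 1))
      (L (EuclideanSpace.single b 1))) = tr (E k) (P ∘L M) := by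
  have h1 : (Matrix.of fun a b => inner ℝ (M (EuclideanSpace.single a 1))
      (L (EuclideanSpace.single b 1))) = (mat (P ∘L M)).transpose * gram L := by
    rw [← pairing_eq_mat_mul_gram]
    ext a b
    simp [h.inner_tangential]
  have hu : IsUnit (gram L).det := (det_gram_pos h.injective).ne'.isUnit
  rw [h1, Matrix.trace_mul_comm, Matrix.mul_assoc, Matrix.mul_nonsing_inv _ hu, Matrix.mul_one,
    Matrix.trace_transpose, trace_mat]

/-- Jacobi's formula: the determinant is multilinear in the rows, and Cramer's rule turns each row
replacement into entries of the adjugate. -/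
theorem hasFDerivAt_det {ι : Type*} [Fintype ι] [DecidableEq ι] {W : Type*} [NormedAddCommGroup W]
    [NormedSpace ℝ W] {M : W → Matrix ι ι ℝ} {M' : ι → ι → W →L[ℝ] ℝ} {w : W}
    (hM : ∀ i j, HasFDerivAt (fun x => M x i j) (M' i j) w) :
    HasFDerivAt (fun x => (M x).det)
      (∑ i, ∑ j, (M w).adjugate j i • M' i j) w := by
  have hc : Continuous fun A : ι → ι → ℝ => Matrix.det (Matrix.of A) :=
    Continuous.matrix_det continuous_id
  let D : ContinuousMultilinearMap ℝ (fun _ : ι => ι → ℝ) ℝ :=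
    { (Matrix.detRowAlternating (R := ℝ) (n := ι)).toMultilinearMap with cont := hc }
  have hD := D.hasFDerivAt (fun i j => M w i j)
  have hM2 : HasFDerivAt (fun x => (fun i j => M x i j : ι → ι → ℝ))
      (ContinuousLinearMap.pi fun i => ContinuousLinearMap.pi fun j => M' i j) w := by
    rw [hasFDerivAt_pi]; intro i; rw [hasFDerivAt_pi]; intro j; exact hM i j
  refine (hD.comp w hM2).congr_fderiv ?_
  ext ξ
  simp only [ContinuousLinearMap.comp_apply, ContinuousMultilinearMap.linearDeriv_apply,
    _root_.sum_apply, _root_.smul_apply, smul_eq_mul]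
  refine Finset.sum_congr rfl fun i _ => ?_
  have h1 : D (Function.update (fun i j => M w i j) i fun j => M' i j ξ)
      = ((M w).updateRow i fun j => M' i j ξ).det := rfl
  refine h1.trans ?_
  rw [← Matrix.cramer_transpose_apply, Matrix.cramer_eq_adjugate_mulVec, ← Matrix.adjugate_transpose]
  rfl

/-- The derivative of the Gram matrix is `B + Bᵀ` with `B` the pairing of `L'` with `L`. By Jacobi's
formula both halves contribute `det · tr (P L')`, and the resulting factor `2` is cancelled by the
square root. -/
theorem hasFDerivAt_gramVol {k n : ℕ} {W : Type*} [NormedAddCommGroup W]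
    [NormedSpace ℝ W] {L : W → E k →L[ℝ] E n} {L' : W →L[ℝ] E k →L[ℝ] E n} {w : W}
    {N : E n} {P : E n →L[ℝ] E k} (h : Adapted (L w) N P) (hL : HasFDerivAt L L' w) :
    HasFDerivAt (fun x => gramVol (L x))
      (gramVol (L w) • (tr (E k) ∘L ContinuousLinearMap.compL ℝ (E k) (E n) (E k) P ∘L L')) w := by
  have he : ∀ a, HasFDerivAt (fun x => L x (EuclideanSpace.single a (1 : ℝ)))
      (L'.flip (EuclideanSpace.single a (1 : ℝ))) w := fun a => by
    simpa using hL.clm_apply (hasFDerivAt_const (EuclideanSpace.single a (1 : ℝ)) w)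
  have hd := hasFDerivAt_det (M := fun x => gram (L x)) fun i j => (he i).inner ℝ (he j)
  have hpos := det_gram_pos h.injective
  refine (hd.sqrt hpos.ne').congr_fderiv ?_
  ext ξ
  let B : Matrix (Fin k) (Fin k) ℝ := (mat (P ∘L L' ξ)).transpose * gram (L w)
  have hB : ∀ i j, inner ℝ (L' ξ (EuclideanSpace.single i 1)) (L w (EuclideanSpace.single j 1))
      = B i j := by
    intro i j
    simp only [B, ← pairing_eq_mat_mul_gram, Matrix.of_apply, ContinuousLinearMap.comp_apply,
      h.inner_tangential]
  have hsymm : (gram (L w)).transpose = gram (L w) := by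
    ext i j; simp [gram, real_inner_comm]
  have hadj : (gram (L w)).adjugate.transpose = (gram (L w)).adjugate := by
    rw [Matrix.adjugate_transpose, hsymm]
  have htr : Matrix.trace ((gram (L w)).adjugate * B) = (gram (L w)).det * tr (E k) (P ∘L L' ξ) := by
    rw [Matrix.trace_mul_comm, Matrix.mul_assoc, Matrix.mul_adjugate, Matrix.mul_smul,
      Matrix.mul_one, Matrix.trace_smul, Matrix.trace_transpose, trace_mat, smul_eq_mul]
  have htr2 : Matrix.trace ((gram (L w)).adjugate * B.transpose) =
      (gram (L w)).det * tr (E k) (P ∘L L' ξ) := by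
    rw [← htr, ← Matrix.trace_transpose, Matrix.transpose_mul, Matrix.transpose_transpose, hadj,
      Matrix.trace_mul_comm]
  have hsum : ∑ i, ∑ j, (gram (L w)).adjugate j i * (B i j + B j i) =
      2 * ((gram (L w)).det * tr (E k) (P ∘L L' ξ)) := by
    rw [two_mul]
    nth_rewrite 1 [← htr]
    rw [← htr2]
    simp only [Matrix.trace, Matrix.diag_apply, Matrix.mul_apply, Matrix.transpose_apply]
    rw [Finset.sum_comm, ← Finset.sum_add_distrib]
    refine Finset.sum_congr rfl fun i _ => ?_
    rw [← Finset.sum_add_distrib]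
    exact Finset.sum_congr rfl fun j _ => by ring
  have hlhs : (∑ i, ∑ j, (gram (L w)).adjugate j i • ((fderivInnerCLM ℝ
      (L w (EuclideanSpace.single i 1), L w (EuclideanSpace.single j 1))).comp
      ((L'.flip (EuclideanSpace.single i 1)).prod (L'.flip (EuclideanSpace.single j 1))))) ξ =
      2 * ((gram (L w)).det * tr (E k) (P ∘L L' ξ)) := by
    rw [← hsum]
    simp only [_root_.sum_apply, _root_.smul_apply, smul_eq_mul, ContinuousLinearMap.comp_apply,
      ContinuousLinearMap.prod_apply, fderivInnerCLM_apply, ContinuousLinearMap.flip_apply]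
    refine Finset.sum_congr rfl fun i _ => Finset.sum_congr rfl fun j _ => ?_
    rw [hB, real_inner_comm, hB, add_comm]
  rw [_root_.smul_apply, hlhs]
  have hs : 0 < √(gram (L w)).det := Real.sqrt_pos.mpr hpos
  simp only [gramVol, _root_.smul_apply, ContinuousLinearMap.comp_apply,
    ContinuousLinearMap.compL_apply, smul_eq_mul]
  field_simp
  rw [Real.sq_sqrt hpos.le]

/-- The trace of the square of an operator that is symmetric for the induced inner product. -/
theorem Adapted.tr_sq_nonneg {k n : ℕ} {L : E k →L[ℝ] E n} {N : E n} {P : E n →L[ℝ] E k}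
    (h : Adapted L N P) {B : E k →L[ℝ] E k}
    (hB : ∀ η ζ, inner ℝ (L (B η)) (L ζ) = (inner ℝ (L η) (L (B ζ)) : ℝ)) :
    0 ≤ tr (E k) (B ∘L B) ∧ (tr (E k) (B ∘L B) = 0 → B = 0) := by
  -- Transporting `B` to the ambient space makes it symmetric for the standard inner product, so the
  -- trace of its square becomes a sum of squared norms.
  let T : E n →L[ℝ] E n := L ∘L B ∘L P
  have hT : ∀ y z, inner ℝ (T y) z = (inner ℝ y (T z) : ℝ) := by
    intro y z
    simp only [T, ContinuousLinearMap.comp_apply]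
    rw [real_inner_comm, ← h.inner_tangential z, real_inner_comm, hB, h.inner_tangential]
  have htr : tr (E k) (B ∘L B) = ∑ i, ‖T (EuclideanSpace.single i 1)‖ ^ 2 := by
    have h1 : tr (E k) (B ∘L B) = tr (E n) (T ∘L T) := by
      have : T ∘L T = L ∘L (B ∘L B ∘L P) := by
        ext1 y; simp [T, h.left_inv]
      have h2 : (B ∘L B ∘L P) ∘L L = B ∘L B := by
        ext1 η; simp [h.left_inv]
      rw [this, tr_comp_comm L, h2]
    rw [h1, tr_apply, LinearMap.trace_eq_sum_inner _ (EuclideanSpace.basisFun (Fin n) ℝ)]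
    refine Finset.sum_congr rfl fun i _ => ?_
    rw [← real_inner_self_eq_norm_sq, EuclideanSpace.basisFun_apply]
    exact (hT _ _).symm
  rw [htr]
  refine ⟨Finset.sum_nonneg fun i _ => sq_nonneg _, fun h0 => ?_⟩
  have hz : ∀ i, T (EuclideanSpace.single i 1) = 0 := fun i => by
    have := (Finset.sum_eq_zero_iff_of_nonneg fun i _ => sq_nonneg _).mp h0 i (Finset.mem_univ i)
    simpa using this
  have hT0 : ∀ y, T y = 0 := fun y => by
    rw [← single_sum y, map_sum]; simp [hz]
  ext1 η
  apply h.injective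
  have := hT0 (L η)
  simp only [T, ContinuousLinearMap.comp_apply, h.left_inv] at this
  simp [this]

/-- Newton's inequality `(tr B)² ≤ k tr B²` for a symmetric operator, with its equality case. -/
theorem Adapted.sq_tr_le {k n : ℕ} (hk : 0 < k) {L : E k →L[ℝ] E n} {N : E n} {P : E n →L[ℝ] E k}
    (h : Adapted L N P) {B : E k →L[ℝ] E k}
    (hB : ∀ η ζ, inner ℝ (L (B η)) (L ζ) = (inner ℝ (L η) (L (B ζ)) : ℝ)) :
    0 ≤ tr (E k) (B ∘L B) - (tr (E k) B) ^ 2 / k ∧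
    (tr (E k) (B ∘L B) - (tr (E k) B) ^ 2 / k = 0 ↔
      ∃ c : ℝ, B = c • ContinuousLinearMap.id ℝ (E k)) := by
  have hk' : (k : ℝ) ≠ 0 := by positivity
  have hid : tr (E k) (ContinuousLinearMap.id ℝ (E k)) = k := by rw [tr_id]; simp
  have hexp : ∀ c : ℝ, tr (E k) ((B - c • ContinuousLinearMap.id ℝ (E k)) ∘L
      (B - c • ContinuousLinearMap.id ℝ (E k))) =
      tr (E k) (B ∘L B) - 2 * c * tr (E k) B + c ^ 2 * k := by
    intro c
    have : (B - c • ContinuousLinearMap.id ℝ (E k)) ∘L (B - c • ContinuousLinearMap.id ℝ (E k)) =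
        B ∘L B - (2 * c) • B + c ^ 2 • ContinuousLinearMap.id ℝ (E k) := by
      ext1 η
      simp only [ContinuousLinearMap.comp_apply, _root_.sub_apply, _root_.add_apply,
        _root_.smul_apply, ContinuousLinearMap.id_apply, map_sub, map_smul]
      module
    rw [this, map_add, map_sub, map_smul, map_smul, hid, smul_eq_mul, smul_eq_mul]
  -- The mean eigenvalue: subtracting it leaves the trace-free part, whose square has trace equal to
  -- the defect.
  set c₀ := tr (E k) B / k with hc₀
  have hsq : tr (E k) (B ∘L B) - (tr (E k) B) ^ 2 / k =
      tr (E k) ((B - c₀ • ContinuousLinearMap.id ℝ (E k)) ∘L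
        (B - c₀ • ContinuousLinearMap.id ℝ (E k))) := by
    rw [hexp, hc₀]; field_simp; ring
  obtain ⟨h1, h2⟩ := h.tr_sq_nonneg (B := B - c₀ • ContinuousLinearMap.id ℝ (E k)) (by
    intro η ζ
    simp [inner_sub_left, inner_sub_right, hB, inner_smul_left, inner_smul_right])
  rw [hsq]
  refine ⟨h1, fun h0 => ⟨c₀, sub_eq_zero.mp (h2 h0)⟩, ?_⟩
  rintro ⟨c, rfl⟩
  have : c₀ = c := by rw [hc₀, map_smul, hid, smul_eq_mul]; field_simp
  rw [this]; simp

/-- The volume distortion of `(η, s) ↦ L η + s φ N`, for an orthonormal identification of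
`ℝᵏ × ℝ` with `ℝⁿ`. -/
theorem Adapted.abs_det_coprod {k n : ℕ} {L : E k →L[ℝ] E n} {N : E n} {P : E n →L[ℝ] E k}
    (h : Adapted L N P) (φ : ℝ) (ι : WithLp 2 (E k × ℝ) ≃ₗᵢ[ℝ] E n) (T : E n →L[ℝ] E n)
    (hT : ∀ η s, T (ι (WithLp.toLp 2 (η, s))) = L η + s • φ • N) :
    |T.det| = |φ| * gramVol L := by
  let b : OrthonormalBasis (Fin k ⊕ Unit) ℝ (E n) :=
    ((EuclideanSpace.basisFun (Fin k) ℝ).prod (OrthonormalBasis.singleton Unit ℝ)).map ι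
  have hb1 : ∀ a, T (b (Sum.inl a)) = L (EuclideanSpace.single a 1) := by
    intro a
    have := hT (EuclideanSpace.single a 1) 0
    simp [b] at this ⊢
    exact this
  have hb2 : T (b (Sum.inr ())) = φ • N := by
    have := hT 0 1
    simp [b] at this ⊢
    exact this
  let M : Matrix (Fin k ⊕ Unit) (Fin k ⊕ Unit) ℝ := LinearMap.toMatrix b.toBasis b.toBasis T
  -- Orthogonality of `N` to the range of `L` makes the ambient Gram matrix block diagonal, so the
  -- squared determinant factors.
  have hM : M.transpose * M = Matrix.fromBlocks (gram L) 0 0 (Matrix.of fun _ _ => φ ^ 2) := by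
    have hin : ∀ i j, (M.transpose * M) i j = inner ℝ (T (b i)) (T (b j)) := by
      intro i j
      rw [Matrix.mul_apply, ← b.sum_inner_mul_inner (T (b i)) (T (b j))]
      refine Finset.sum_congr rfl fun l _ => ?_
      simp [M, LinearMap.toMatrix_apply, OrthonormalBasis.repr_apply_apply, real_inner_comm]
    ext i j
    rw [hin]
    rcases i with i | i <;> rcases j with j | j
    · simp [hb1, gram]
    · simp [hb1, hb2, inner_smul_right, real_inner_comm, h.orthogonal]
    · simp [hb1, hb2, inner_smul_left, h.orthogonal]
    · simp only [hb2, inner_smul_left, inner_smul_right, h.norm_normal]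
      simp [pow_two]
  have hdet : T.det ^ 2 = φ ^ 2 * (gram L).det := by
    have h1 : M.det = T.det := by
      simp only [M]; rw [LinearMap.det_toMatrix]
    have h2 := congrArg Matrix.det hM
    rw [Matrix.det_mul, Matrix.det_transpose, h1, Matrix.det_fromBlocks_zero₂₁] at h2
    rw [pow_two, h2]; simp [mul_comm]
  rw [← Real.sqrt_sq_eq_abs, hdet, Real.sqrt_mul (sq_nonneg _), Real.sqrt_sq_eq_abs, gramVol]

/-! ### Normal flows of a hypersurface in a chart -/

/-- The differential in the space variables. -/
def zD {k : ℕ} {F : Type*} [NormedAddCommGroup F] [NormedSpace ℝ F] (f : E k × ℝ → F)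
    (w : E k × ℝ) : E k →L[ℝ] F :=
  fderiv ℝ f w ∘L ContinuousLinearMap.inl ℝ (E k) ℝ

/-- The time derivative. -/
def tD {k : ℕ} {F : Type*} [NormedAddCommGroup F] [NormedSpace ℝ F] (f : E k × ℝ → F)
    (w : E k × ℝ) : F :=
  fderiv ℝ f w (0, 1)

/-- A family of immersions `X(·, t)` with unit normal `N`, moving with normal speed `φ`. -/
structure LocalFlow {k n : ℕ} (O : Set (E k × ℝ)) (X N : E k × ℝ → E n) (φ : E k × ℝ → ℝ) :
    Prop where
  dim : n = k + 1
  isOpen : IsOpen O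
  smooth : ContDiffOn ℝ ∞ X O
  smooth_normal : ContDiffOn ℝ ∞ N O
  smooth_speed : ContDiffOn ℝ ∞ φ O
  immersion : ∀ w ∈ O, Function.Injective (zD X w)
  unit : ∀ w ∈ O, inner ℝ (N w) (N w) = (1 : ℝ)
  orthogonal : ∀ w ∈ O, ∀ η, inner ℝ (N w) (zD X w η) = (0 : ℝ)
  flow : ∀ w ∈ O, tD X w = φ w • N w

/-- The left inverse of the differential that vanishes on the normal. -/
def proj {k n : ℕ} (X N : E k × ℝ → E n) (w : E k × ℝ) : E n →L[ℝ] E k := leftInv (zD X w) (N w)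

/-- The area density. -/
def dens {k n : ℕ} (X : E k × ℝ → E n) (w : E k × ℝ) : ℝ := gramVol (zD X w)

/-- The shape operator. -/
def shape {k n : ℕ} (X N : E k × ℝ → E n) (w : E k × ℝ) : E k →L[ℝ] E k :=
  proj X N w ∘L zD N w

/-- The mean curvature with respect to the Euclidean metric. -/
def mean {k n : ℕ} (X N : E k × ℝ → E n) (w : E k × ℝ) : ℝ := tr (E k) (shape X N w)

/-- The divergence in the space variables. -/
def zdiv {k : ℕ} (Y : E k × ℝ → E k) (w : E k × ℝ) : ℝ := tr (E k) (zD Y w)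

/-! ### Smoothness and commutation of space and time derivatives. -/

section Calculus

variable {k : ℕ} {F G : Type*} [NormedAddCommGroup F] [NormedSpace ℝ F]
  [NormedAddCommGroup G] [NormedSpace ℝ G] {O : Set (E k × ℝ)} {w : E k × ℝ}

theorem ContDiffOn.zD {f : E k × ℝ → F} (hO : IsOpen O) (hf : ContDiffOn ℝ ∞ f O) :
    ContDiffOn ℝ ∞ (zD f) O :=
  (hf.fderiv_of_isOpen hO (m := ∞) (by simp)).clm_comp contDiffOn_const

theorem ContDiffOn.tD {f : E k × ℝ → F} (hO : IsOpen O) (hf : ContDiffOn ℝ ∞ f O) :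
    ContDiffOn ℝ ∞ (tD f) O :=
  (hf.fderiv_of_isOpen hO (m := ∞) (by simp)).clm_apply contDiffOn_const

theorem diffAt {f : E k × ℝ → F} (hO : IsOpen O) (hf : ContDiffOn ℝ ∞ f O) (hw : w ∈ O) :
    DifferentiableAt ℝ f w :=
  (hf.contDiffAt (hO.mem_nhds hw)).differentiableAt (by simp)

theorem fderiv_zD_apply {f : E k × ℝ → F} (hO : IsOpen O) (hf : ContDiffOn ℝ ∞ f O) (hw : w ∈ O)
    (ξ : E k × ℝ) (η : E k) : fderiv ℝ (Schwarzschild.zD f) w ξ η =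
      fderiv ℝ (fderiv ℝ f) w ξ (η, 0) := by
  have h1 : DifferentiableAt ℝ (fderiv ℝ f) w :=
    diffAt hO (hf.fderiv_of_isOpen hO (m := ∞) (by simp)) hw
  have h2 : HasFDerivAt (Schwarzschild.zD f) _ w :=
    h1.hasFDerivAt.clm_comp (hasFDerivAt_const (ContinuousLinearMap.inl ℝ (E k) ℝ) w)
  rw [h2.fderiv]
  simp

theorem snd_symm {f : E k × ℝ → F} (hO : IsOpen O) (hf : ContDiffOn ℝ ∞ f O) (hw : w ∈ O)
    (ξ ζ : E k × ℝ) : fderiv ℝ (fderiv ℝ f) w ξ ζ = fderiv ℝ (fderiv ℝ f) w ζ ξ := by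
  have := (hf.contDiffAt (hO.mem_nhds hw)).isSymmSndFDerivAt
    (by simpa using ENat.LEInfty.out)
  exact this ξ ζ

theorem fderiv_tD_apply {f : E k × ℝ → F} (hO : IsOpen O) (hf : ContDiffOn ℝ ∞ f O) (hw : w ∈ O)
    (ξ : E k × ℝ) : fderiv ℝ (Schwarzschild.tD f) w ξ = fderiv ℝ (fderiv ℝ f) w ξ (0, 1) := by
  have h1 : DifferentiableAt ℝ (fderiv ℝ f) w :=
    diffAt hO (hf.fderiv_of_isOpen hO (m := ∞) (by simp)) hw
  have h2 : HasFDerivAt (Schwarzschild.tD f) _ w :=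
    h1.hasFDerivAt.clm_apply (hasFDerivAt_const ((0, 1) : E k × ℝ) w)
  rw [h2.fderiv]
  simp

theorem tD_zD {f : E k × ℝ → F} (hO : IsOpen O) (hf : ContDiffOn ℝ ∞ f O) (hw : w ∈ O) :
    Schwarzschild.tD (Schwarzschild.zD f) w = Schwarzschild.zD (Schwarzschild.tD f) w := by
  ext1 η
  rw [Schwarzschild.tD, fderiv_zD_apply hO hf hw, snd_symm hO hf hw, ← fderiv_tD_apply hO hf hw]
  rfl

theorem zD_apply (f : E k × ℝ → F) (η : E k) : Schwarzschild.zD f w η = fderiv ℝ f w (η, 0) := rfl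

end Calculus

/-! ### First variation formulas for a normal flow in Euclidean space. -/

namespace LocalFlow

variable {k n : ℕ} {O : Set (E k × ℝ)} {X N : E k × ℝ → E n} {φ : E k × ℝ → ℝ} {w : E k × ℝ}

theorem adapted (h : LocalFlow O X N φ) (hw : w ∈ O) : Adapted (zD X w) (N w) (proj X N w) :=
  adapted_leftInv h.dim (h.unit w hw) (h.orthogonal w hw) (h.immersion w hw)

/-- Operator inversion is smooth at invertible operators, and the coproduct of `dX` and `N` depends
smoothly on the point. -/
theorem smooth_proj (h : LocalFlow O X N φ) : ContDiffOn ℝ ∞ (proj X N) O := by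
  intro w hw
  have hL : ContDiffAt ℝ ∞ (zD X) w := (ContDiffOn.zD h.isOpen h.smooth).contDiffAt
    (h.isOpen.mem_nhds hw)
  have hN : ContDiffAt ℝ ∞ N w := h.smooth_normal.contDiffAt (h.isOpen.mem_nhds hw)
  have h1 : ContDiffAt ℝ ∞ (fun x => (zD X x).coprod
      (ContinuousLinearMap.toSpanSingleton ℝ (N x))) w := by
    have he : (fun x => (zD X x).coprod (ContinuousLinearMap.toSpanSingleton ℝ (N x))) =
        fun x => zD X x ∘L ContinuousLinearMap.fst ℝ (E k) ℝ +
          (ContinuousLinearMap.snd ℝ (E k) ℝ).smulRight (N x) := by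
      ext x y <;> simp
    rw [he]
    exact (hL.clm_comp contDiffAt_const).add (contDiffAt_const.smulRight hN)
  have h2 := (isInvertible_coprod h.dim (h.unit w hw) (h.orthogonal w hw)
    (h.immersion w hw)).contDiffAt_map_inverse (n := ∞)
  exact ((contDiffAt_const (c := ContinuousLinearMap.fst ℝ (E k) ℝ)).clm_comp
    (h2.comp w h1)).contDiffWithinAt

/-- Obtained by differentiating `P (L η) = η`. The companion formula on the normal comes from `P N =
0`; together they determine the derivative of `P` without a formula for `P`. -/
theorem fderiv_proj_L (h : LocalFlow O X N φ) (hw : w ∈ O) (ξ : E k × ℝ) (η : E k) :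
    fderiv ℝ (proj X N) w ξ (zD X w η) = - proj X N w (fderiv ℝ (zD X) w ξ η) := by
  have h1 := (diffAt h.isOpen h.smooth_proj hw).hasFDerivAt.clm_apply
    ((diffAt h.isOpen (ContDiffOn.zD h.isOpen h.smooth) hw).hasFDerivAt.clm_apply
      (hasFDerivAt_const η w))
  have h2 : HasFDerivAt (fun x => proj X N x (zD X x η)) (0 : E k × ℝ →L[ℝ] E k) w := by
    refine (hasFDerivAt_const η w).congr_of_eventuallyEq ?_
    filter_upwards [h.isOpen.mem_nhds hw] with x hx using (h.adapted hx).left_inv η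
  have h3 := DFunLike.congr_fun (h1.unique h2) ξ
  simp at h3
  rw [eq_neg_iff_add_eq_zero, add_comm]
  exact h3

theorem fderiv_proj_N (h : LocalFlow O X N φ) (hw : w ∈ O) (ξ : E k × ℝ) :
    fderiv ℝ (proj X N) w ξ (N w) = - proj X N w (fderiv ℝ N w ξ) := by
  have h1 := (diffAt h.isOpen h.smooth_proj hw).hasFDerivAt.clm_apply
    (diffAt h.isOpen h.smooth_normal hw).hasFDerivAt
  have h2 : HasFDerivAt (fun x => proj X N x (N x)) (0 : E k × ℝ →L[ℝ] E k) w := by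
    refine (hasFDerivAt_const 0 w).congr_of_eventuallyEq ?_
    filter_upwards [h.isOpen.mem_nhds hw] with x hx using (h.adapted hx).ker
  have h3 := DFunLike.congr_fun (h1.unique h2) ξ
  simp at h3
  rw [eq_neg_iff_add_eq_zero, add_comm]
  exact h3

theorem hasFDerivAt_dens (h : LocalFlow O X N φ) (hw : w ∈ O) :
    HasFDerivAt (dens X) (dens X w • (tr (E k) ∘L
      ContinuousLinearMap.compL ℝ (E k) (E n) (E k) (proj X N w) ∘L fderiv ℝ (zD X) w)) w :=
  hasFDerivAt_gramVol (h.adapted hw)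
    (diffAt h.isOpen (ContDiffOn.zD h.isOpen h.smooth) hw).hasFDerivAt

theorem fderiv_dens (h : LocalFlow O X N φ) (hw : w ∈ O) (ξ : E k × ℝ) :
    fderiv ℝ (dens X) w ξ = dens X w * tr (E k) (proj X N w ∘L fderiv ℝ (zD X) w ξ) := by
  rw [(h.hasFDerivAt_dens hw).fderiv]; rfl

theorem dens_pos (h : LocalFlow O X N φ) (hw : w ∈ O) : 0 < dens X w :=
  gramVol_pos (h.immersion w hw)

theorem smooth_dens (h : LocalFlow O X N φ) : ContDiffOn ℝ ∞ (dens X) O := by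
  have hL := ContDiffOn.zD h.isOpen h.smooth
  have h1 : ContDiffOn ℝ ∞ (fun w => (gram (zD X w)).det) O := by
    have he : ∀ a b, ContDiffOn ℝ ∞ (fun w => gram (zD X w) a b) O := fun a b =>
      (hL.clm_apply contDiffOn_const).inner ℝ (hL.clm_apply contDiffOn_const)
    simp only [Matrix.det_apply]
    refine ContDiffOn.sum fun σ _ => ContDiffOn.const_smul _ ?_
    exact contDiffOn_prod fun i _ => he _ _
  exact h1.sqrt fun w hw => (det_gram_pos (h.immersion w hw)).ne'

/-- The surface divergence theorem in its infinitesimal form. -/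
theorem zdiv_dens_smul_proj (h : LocalFlow O X N φ) (hw : w ∈ O) {V : E k × ℝ → E n}
    (hV : DifferentiableAt ℝ V w) :
    zdiv (fun x => dens X x • proj X N x (V x)) w =
      dens X w * (tr (E k) (proj X N w ∘L zD V w) - mean X N w * inner ℝ (N w) (V w)) := by
  set P := proj X N w with hP
  have hD : HasFDerivAt (fun x => dens X x • proj X N x (V x)) _ w :=
    (h.hasFDerivAt_dens hw).smul
      ((diffAt h.isOpen h.smooth_proj hw).hasFDerivAt.clm_apply hV.hasFDerivAt)
  -- By symmetry of second derivatives, differentiating `P` on the tangential part of `V` produces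
  -- `-Q`, whereas differentiating the density produces `+tr Q`. These cancel in the trace, leaving
  -- no Christoffel terms.
  let Q : E k →L[ℝ] E k := P ∘L (fderiv ℝ (zD X) w (P (V w), 0))
  let R : E k →L[ℝ] ℝ := tr (E k) ∘L ContinuousLinearMap.compL ℝ (E k) (E n) (E k) P ∘L
    fderiv ℝ (zD X) w ∘L ContinuousLinearMap.inl ℝ (E k) ℝ
  have key : zD (fun x => dens X x • proj X N x (V x)) w =
      dens X w • (P ∘L zD V w - Q - (inner ℝ (N w) (V w) : ℝ) • shape X N w) +
        dens X w • R.smulRight (P (V w)) := by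
    ext1 η
    rw [zD_apply, hD.fderiv]
    have h1 : fderiv ℝ (proj X N) w (η, 0) (V w) = - Q η -
        (inner ℝ (N w) (V w) : ℝ) • shape X N w η := by
      conv_lhs => rw [← (h.adapted hw).decomp (V w)]
      rw [map_add, map_smul, h.fderiv_proj_L hw, h.fderiv_proj_N hw,
        fderiv_zD_apply h.isOpen h.smooth hw, snd_symm h.isOpen h.smooth hw,
        ← fderiv_zD_apply h.isOpen h.smooth hw]
      simp only [Q, P, shape, ContinuousLinearMap.comp_apply, zD_apply]
      module
    simp only [_root_.add_apply, _root_.smul_apply, ContinuousLinearMap.smulRight_apply,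
      ContinuousLinearMap.comp_apply, ContinuousLinearMap.flip_apply, h1, _root_.sub_apply,
      zD_apply, R, ContinuousLinearMap.inl_apply, smul_eq_mul]
    module
  rw [zdiv, key]
  simp only [map_add, map_sub, map_smul, smul_eq_mul, tr_smulRight]
  have : R (P (V w)) = tr (E k) Q := rfl
  rw [this, mean]; ring

/-- Mixed partials commute, so the time derivative of `dX` is the space differential of `φ N`. -/
theorem fderiv_zD_time (h : LocalFlow O X N φ) (hw : w ∈ O) :
    tD (zD X) w = φ w • zD N w + (zD φ w).smulRight (N w) := by
  rw [tD_zD h.isOpen h.smooth hw]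
  have h1 : HasFDerivAt (tD X) _ w :=
    ((diffAt h.isOpen h.smooth_speed hw).hasFDerivAt.smul
      (diffAt h.isOpen h.smooth_normal hw).hasFDerivAt).congr_of_eventuallyEq
      (by filter_upwards [h.isOpen.mem_nhds hw] with x hx using h.flow x hx)
  ext1 η
  rw [zD_apply, h1.fderiv]
  simp [zD_apply]

/-- First variation of area: the projection kills the `dφ ⊗ N` part of the variation of `dX`, and `φ
dN` contributes `φ` times the trace of the shape operator. -/
theorem tD_dens (h : LocalFlow O X N φ) (hw : w ∈ O) :
    tD (dens X) w = dens X w * (φ w * mean X N w) := by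
  rw [tD, h.fderiv_dens hw, show fderiv ℝ (zD X) w (0, 1) = tD (zD X) w from rfl,
    h.fderiv_zD_time hw]
  have : proj X N w ∘L (φ w • zD N w + (zD φ w).smulRight (N w)) = φ w • shape X N w := by
    ext1 η; simp [shape, (h.adapted hw).ker]
  rw [this, map_smul, smul_eq_mul, mean]

theorem inner_fderiv_normal (h : LocalFlow O X N φ) (hw : w ∈ O) (ξ : E k × ℝ) :
    inner ℝ (N w) (fderiv ℝ N w ξ) = (0 : ℝ) := by
  have hN := (diffAt h.isOpen h.smooth_normal hw).hasFDerivAt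
  have h1 := hN.inner ℝ hN
  have h2 : HasFDerivAt (fun x => inner ℝ (N x) (N x)) (0 : E k × ℝ →L[ℝ] ℝ) w := by
    refine (hasFDerivAt_const 1 w).congr_of_eventuallyEq ?_
    filter_upwards [h.isOpen.mem_nhds hw] with x hx using h.unit x hx
  have h3 := DFunLike.congr_fun (h1.unique h2) ξ
  simp only [ContinuousLinearMap.comp_apply, ContinuousLinearMap.prod_apply, fderivInnerCLM_apply,
    _root_.zero_apply] at h3
  rw [real_inner_comm (N w)] at h3
  linarith

/-- Differentiating the orthogonality relation. -/
theorem inner_fderiv_normal_tangent (h : LocalFlow O X N φ) (hw : w ∈ O) (ξ : E k × ℝ) (η : E k) :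
    (inner ℝ (fderiv ℝ N w ξ) (zD X w η) : ℝ) = - inner ℝ (N w) (fderiv ℝ (zD X) w ξ η) := by
  have hN := (diffAt h.isOpen h.smooth_normal hw).hasFDerivAt
  have hL := (diffAt h.isOpen (ContDiffOn.zD h.isOpen h.smooth) hw).hasFDerivAt.clm_apply
    (hasFDerivAt_const η w)
  have h1 := hN.inner ℝ hL
  have h2 : HasFDerivAt (fun x => inner ℝ (N x) (zD X x η)) (0 : E k × ℝ →L[ℝ] ℝ) w := by
    refine (hasFDerivAt_const 0 w).congr_of_eventuallyEq ?_
    filter_upwards [h.isOpen.mem_nhds hw] with x hx using h.orthogonal x hx η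
  have h3 := DFunLike.congr_fun (h1.unique h2) ξ
  simp at h3
  linarith

/-- This is `∂N/∂t = -∇φ`: differentiating `⟨N, dX⟩ = 0` in time gives the tangential part, and `|N|
= 1` excludes a normal part. -/
theorem inner_tD_normal (h : LocalFlow O X N φ) (hw : w ∈ O) (V : E n) :
    (inner ℝ (tD N w) V : ℝ) = - zD φ w (proj X N w V) := by
  conv_lhs => rw [← (h.adapted hw).decomp V]
  rw [inner_add_right, inner_smul_right, tD, h.inner_fderiv_normal_tangent hw,
    real_inner_comm (N w) (fderiv ℝ N w (0, 1)), h.inner_fderiv_normal hw, show fderiv ℝ (zD X) w (0, 1) = tD (zD X) w from rfl,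
    h.fderiv_zD_time hw]
  simp only [_root_.add_apply, _root_.smul_apply, ContinuousLinearMap.smulRight_apply,
    inner_add_right, inner_smul_right, h.unit w hw, zD_apply, h.inner_fderiv_normal hw]
  ring

theorem zD_normal (h : LocalFlow O X N φ) (hw : w ∈ O) (η : E k) :
    zD X w (shape X N w η) = zD N w η := by
  rw [shape, ContinuousLinearMap.comp_apply, (h.adapted hw).decomp', zD_apply N,
    h.inner_fderiv_normal hw]; simp

/-- By orthogonality, `⟨dN η, dX ζ⟩ = -⟨N, D²X(η, ζ)⟩`, which is symmetric. -/
theorem shape_symm (h : LocalFlow O X N φ) (hw : w ∈ O) (η ζ : E k) :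
    inner ℝ (zD X w (shape X N w η)) (zD X w ζ) =
      (inner ℝ (zD X w η) (zD X w (shape X N w ζ)) : ℝ) := by
  rw [h.zD_normal hw, h.zD_normal hw, real_inner_comm (zD N w ζ), zD_apply N, zD_apply N,
    h.inner_fderiv_normal_tangent hw, h.inner_fderiv_normal_tangent hw,
    fderiv_zD_apply h.isOpen h.smooth hw, fderiv_zD_apply h.isOpen h.smooth hw,
    snd_symm h.isOpen h.smooth hw]

theorem smooth_shape (h : LocalFlow O X N φ) : ContDiffOn ℝ ∞ (shape X N) O :=
  h.smooth_proj.clm_comp (ContDiffOn.zD h.isOpen h.smooth_normal)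

theorem smooth_mean (h : LocalFlow O X N φ) : ContDiffOn ℝ ∞ (mean X N) O :=
  (tr (E k)).contDiff.comp_contDiffOn h.smooth_shape

/-- In `∂_t (P dN)`, the derivative of `P` gives `-φ A²`. The remaining trace is the surface
divergence of `∂_t N = -∇φ`, which is `-Δφ` kept in undifferentiated form. -/
theorem tD_mean (h : LocalFlow O X N φ) (hw : w ∈ O) :
    tD (mean X N) w = - φ w * tr (E k) (shape X N w ∘L shape X N w) +
      tr (E k) (proj X N w ∘L zD (tD N) w) := by
  have h1 := (diffAt h.isOpen h.smooth_proj hw).hasFDerivAt.clm_comp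
    (diffAt h.isOpen (ContDiffOn.zD h.isOpen h.smooth_normal) hw).hasFDerivAt
  have h2 : HasFDerivAt (mean X N) _ w := (tr (E k)).hasFDerivAt.comp w h1
  rw [tD, h2.fderiv]
  have h3 : fderiv ℝ (proj X N) w (0, 1) ∘L zD N w = - φ w • (shape X N w ∘L shape X N w) := by
    ext1 η
    rw [ContinuousLinearMap.comp_apply, ← h.zD_normal hw, h.fderiv_proj_L hw,
      show fderiv ℝ (zD X) w (0, 1) = tD (zD X) w from rfl, h.fderiv_zD_time hw]
    simp [(h.adapted hw).ker, shape]
  rw [← tD_zD h.isOpen h.smooth_normal hw]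
  simp only [ContinuousLinearMap.comp_apply, _root_.add_apply, ContinuousLinearMap.compL_apply,
    ContinuousLinearMap.flip_apply, h3, map_add, map_smul, smul_eq_mul]
  rw [add_comm]
  rfl

/-- The evolution of the flux density of an ambient vector field. -/
theorem flux_evolution (h : LocalFlow O X N φ) (hw : w ∈ O) {V : E n → E n}
    (hV : DifferentiableAt ℝ V (X w)) :
    tD (fun x => dens X x * inner ℝ (V (X x)) (N x)) w +
      zdiv (fun x => dens X x • proj X N x (φ x • V (X x))) w =
      φ w * dens X w * tr (E n) (fderiv ℝ V (X w)) := by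
  have hX := (diffAt h.isOpen h.smooth hw).hasFDerivAt
  have hφ := (diffAt h.isOpen h.smooth_speed hw).hasFDerivAt
  have hVX : HasFDerivAt (fun x => V (X x)) _ w := hV.hasFDerivAt.comp w hX
  have h1 : HasFDerivAt (fun x => φ x • V (X x)) _ w := hφ.smul hVX
  have h2 : zD (fun x => φ x • V (X x)) w =
      φ w • (fderiv ℝ V (X w) ∘L zD X w) + (zD φ w).smulRight (V (X w)) := by
    ext1 η
    rw [zD_apply, h1.fderiv]
    simp [zD_apply]
  have h3 : proj X N w ∘L (φ w • (fderiv ℝ V (X w) ∘L zD X w) + (zD φ w).smulRight (V (X w))) =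
      φ w • (proj X N w ∘L fderiv ℝ V (X w) ∘L zD X w) +
        (zD φ w).smulRight (proj X N w (V (X w))) := by
    ext1 η; simp
  have h4 : HasFDerivAt (fun x => dens X x * inner ℝ (V (X x)) (N x)) _ w :=
    (diffAt h.isOpen h.smooth_dens hw).hasFDerivAt.mul
      (hVX.inner ℝ (diffAt h.isOpen h.smooth_normal hw).hasFDerivAt)
  have h5 := h.inner_tD_normal hw (V (X w))
  rw [real_inner_comm] at h5
  rw [h.zdiv_dens_smul_proj hw h1.differentiableAt, h2, h3, map_add, map_smul, tr_smulRight,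
    (h.adapted hw).tr_conj, tD, h4.fderiv]
  simp only [_root_.add_apply, _root_.smul_apply, ContinuousLinearMap.comp_apply,
    ContinuousLinearMap.prod_apply, fderivInnerCLM_apply, smul_eq_mul, inner_smul_right]
  have h6 : fderiv ℝ X w (0, 1) = φ w • N w := h.flow w hw
  have h7 := h.tD_dens hw
  simp only [tD] at h5 h7
  rw [h6, h7, h5, map_smul, inner_smul_left, real_inner_comm (N w) (V (X w)),
    real_inner_comm (N w) (fderiv ℝ V (X w) (N w))]
  simp only [conj_trivial]
  ring

/-- The evolution of the weighted mean curvature density. -/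
theorem mean_evolution (h : LocalFlow O X N φ) (hw : w ∈ O) {F : E n → ℝ} {G : E n → E n}
    (hF : HasFDerivAt F (innerSL ℝ (G (X w))) (X w)) (hG : DifferentiableAt ℝ G (X w)) :
    tD (fun x => dens X x * (F (X x) * mean X N x)) w =
      dens X w * φ w * (2 * inner ℝ (N w) (G (X w)) * mean X N w +
        F (X w) * (mean X N w ^ 2 - tr (E k) (shape X N w ∘L shape X N w)) -
        tr (E n) (fderiv ℝ G (X w)) + inner ℝ (N w) (fderiv ℝ G (X w) (N w))) +
      zdiv (fun x => dens X x • proj X N x (F (X x) • tD N x + φ x • G (X x))) w := by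
  have hX := (diffAt h.isOpen h.smooth hw).hasFDerivAt
  have hφ := (diffAt h.isOpen h.smooth_speed hw).hasFDerivAt
  have hNt := (diffAt h.isOpen (ContDiffOn.tD h.isOpen h.smooth_normal) hw).hasFDerivAt
  have hGX : HasFDerivAt (fun x => G (X x)) _ w := hG.hasFDerivAt.comp w hX
  have hFX : HasFDerivAt (fun x => F (X x)) _ w := hF.comp w hX
  have h1 : HasFDerivAt (fun x => F (X x) • tD N x + φ x • G (X x)) _ w :=
    (hFX.smul hNt).add (hφ.smul hGX)
  have h2 : proj X N w ∘L zD (fun x => F (X x) • tD N x + φ x • G (X x)) w =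
      F (X w) • (proj X N w ∘L zD (tD N) w) +
        ((innerSL ℝ (G (X w))) ∘L zD X w).smulRight (proj X N w (tD N w)) +
      (φ w • (proj X N w ∘L fderiv ℝ G (X w) ∘L zD X w) +
        (zD φ w).smulRight (proj X N w (G (X w)))) := by
    ext1 η
    rw [ContinuousLinearMap.comp_apply, zD_apply, h1.fderiv]
    simp [zD_apply]
  have h4 : HasFDerivAt (fun x => dens X x * (F (X x) * mean X N x)) _ w :=
    (diffAt h.isOpen h.smooth_dens hw).hasFDerivAt.mul
      (hFX.mul (diffAt h.isOpen h.smooth_mean hw).hasFDerivAt)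
  have h5 := h.inner_tD_normal hw (G (X w))
  rw [h.zdiv_dens_smul_proj hw h1.differentiableAt, h2]
  simp only [map_add, map_smul, tr_smulRight, (h.adapted hw).tr_conj]
  rw [tD, h4.fderiv]
  simp only [_root_.add_apply, _root_.smul_apply, ContinuousLinearMap.comp_apply,
    smul_eq_mul, inner_add_right, inner_smul_right, innerSL_apply_apply]
  have h6 : fderiv ℝ X w (0, 1) = φ w • N w := h.flow w hw
  have h7 := h.tD_dens hw
  have h8 := h.tD_mean hw
  have h9 : inner ℝ (N w) (tD N w) = (0 : ℝ) := h.inner_fderiv_normal hw _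
  -- Green's identity enters here: since `∂_t N = -∇φ`, the derivative of `F` along it cancels the
  -- `dφ (G)` term from the product rule for `φ G`. Thus `-F Δφ` becomes `-φ ΔF` up to a divergence.
  have h10 : (inner ℝ (G (X w)) (zD X w (proj X N w (tD N w))) : ℝ) =
      - zD φ w (proj X N w (G (X w))) := by
    rw [(h.adapted hw).decomp', h9, zero_smul, sub_zero, real_inner_comm, h5]
  rw [h10, h9, h6]
  simp only [tD] at h7 h8 ⊢
  rw [h7, h8, inner_smul_right, real_inner_comm (N w) (G (X w))]
  ring

end LocalFlow

/-! ### The harmonic function `1 + (m / 2) |x| ^ (2 - n)` and the conformal factor -/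

section Potential

variable {n : ℕ} {m : ℝ} {x : E n}

theorem hasFDerivAt_norm_rpow_of_ne_zero (hx : x ≠ 0) (a : ℝ) :
    HasFDerivAt (fun y : E n => ‖y‖ ^ a) ((a * ‖x‖ ^ (a - 2)) • innerSL ℝ x) x := by
  have hpos : 0 < ‖x‖ := norm_pos_iff.mpr hx
  have h1 := (hasStrictFDerivAt_norm_sq x).hasFDerivAt.rpow_const (p := a / 2)
    (Or.inl (by positivity))
  have h2 : (fun y : E n => ‖y‖ ^ a) = fun y : E n => (‖y‖ ^ 2) ^ (a / 2) := by
    ext y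
    rw [← Real.rpow_natCast, ← Real.rpow_mul (norm_nonneg _)]
    congr 1; push_cast; ring
  rw [h2]
  refine h1.congr_fderiv ?_
  ext y
  have h3 : (‖x‖ ^ 2) ^ (a / 2 - 1) = ‖x‖ ^ (a - 2) := by
    rw [← Real.rpow_natCast, ← Real.rpow_mul (norm_nonneg _)]
    congr 1; push_cast; ring
  simp only [_root_.smul_apply, innerSL_apply_apply, smul_eq_mul, h3]
  simp
  ring

/-- The Euclidean gradient of `potentialU m`. -/
def gradU (m : ℝ) (x : E n) : E n := (m / 2 * (2 - (n : ℝ)) * ‖x‖ ^ (-(n : ℝ))) • x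

theorem hasFDerivAt_potentialU (hx : x ≠ 0) :
    HasFDerivAt (potentialU m) (innerSL ℝ (gradU m x)) x := by
  have h := ((hasFDerivAt_norm_rpow_of_ne_zero hx (2 - (n : ℝ))).const_mul (m / 2)).const_add 1
  refine h.congr_fderiv ?_
  ext y
  simp only [gradU, _root_.smul_apply, innerSL_apply_apply, smul_eq_mul, inner_smul_left,
    conj_trivial]
  rw [show (2 - (n : ℝ) - 2) = -(n : ℝ) by ring]
  ring

theorem hasFDerivAt_gradU (hx : x ≠ 0) : HasFDerivAt (gradU m)
    ((m / 2 * (2 - (n : ℝ)) * ‖x‖ ^ (-(n : ℝ))) • ContinuousLinearMap.id ℝ (E n) +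
      ((m / 2 * (2 - (n : ℝ)) * (-(n : ℝ) * ‖x‖ ^ (-(n : ℝ) - 2))) • innerSL ℝ x).smulRight x) x := by
  have h := ((hasFDerivAt_norm_rpow_of_ne_zero hx (-(n : ℝ))).const_mul
    (m / 2 * (2 - (n : ℝ)))).smul (hasFDerivAt_id x)
  refine h.congr_fderiv ?_
  ext1 y
  simp [smul_smul]

theorem rpow_sub_two (hx : x ≠ 0) : ‖x‖ ^ (-(n : ℝ) - 2) = ‖x‖ ^ (-(n : ℝ)) / ‖x‖ ^ 2 := by
  rw [Real.rpow_sub (norm_pos_iff.mpr hx)]; norm_num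

theorem rpow_two_sub (hx : x ≠ 0) : ‖x‖ ^ (2 - (n : ℝ)) = ‖x‖ ^ (-(n : ℝ)) * ‖x‖ ^ 2 := by
  rw [sub_eq_add_neg, Real.rpow_add (norm_pos_iff.mpr hx), mul_comm]; norm_num

/-- The function `potentialU m` is harmonic. -/
theorem tr_fderiv_gradU (hx : x ≠ 0) : tr (E n) (fderiv ℝ (gradU m) x) = 0 := by
  have hpos : 0 < ‖x‖ := norm_pos_iff.mpr hx
  rw [(hasFDerivAt_gradU hx).fderiv, map_add, map_smul, tr_smulRight, tr_id]
  simp only [finrank_euclideanSpace_fin, _root_.smul_apply, innerSL_apply_apply, smul_eq_mul,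
    real_inner_self_eq_norm_sq, rpow_sub_two hx]
  field_simp
  ring

/-- The static equation in Euclidean terms. -/
theorem static_identity (hx : x ≠ 0) (N : E n) :
    ((n : ℝ) - 2) * ((2 - 2 * potentialU m x) * inner ℝ N (fderiv ℝ (gradU m) x N)) =
      2 * (inner ℝ (gradU m x) (gradU m x) * inner ℝ N N - n * inner ℝ N (gradU m x) ^ 2) := by
  have hpos : 0 < ‖x‖ := norm_pos_iff.mpr hx
  rw [(hasFDerivAt_gradU hx).fderiv]
  simp only [_root_.add_apply, _root_.smul_apply, ContinuousLinearMap.id_apply,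
    ContinuousLinearMap.smulRight_apply, innerSL_apply_apply, inner_add_right, inner_smul_right,
    gradU, inner_smul_left, conj_trivial, potentialU, rpow_sub_two hx, rpow_two_sub hx, smul_eq_mul,
    real_inner_comm N x]
  rw [real_inner_self_eq_norm_sq x]
  field_simp
  ring

theorem potentialU_pos (hm : 0 < m) : 0 < potentialU m x := by
  unfold potentialU; positivity

theorem horizonRadius_pos (hm : 0 < m) : 0 < horizonRadius n m := by
  unfold horizonRadius; positivity

theorem ne_zero_of_mem (hm : 0 < m) (hx : x ∈ interiorM n m) : x ≠ 0 :=
  norm_pos_iff.mp ((horizonRadius_pos hm).trans hx)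

/-- The horizon radius satisfies `r₀ ^ (n - 2) = m / 2`, so `u = 2` exactly there and `u` falls off
outwards. This strictness makes the weight `(2 - u) u`, and hence the dissipation coefficient,
positive. -/
theorem potentialU_lt_two (hn : 3 ≤ n) (hm : 0 < m) (hx : x ∈ interiorM n m) :
    potentialU m x < 2 := by
  have hp : (0 : ℝ) < (n : ℝ) - 2 := by
    have : (3 : ℝ) ≤ n := by exact_mod_cast hn
    linarith
  have h0 : 0 < ‖x‖ := (horizonRadius_pos hm).trans hx
  have h1 : m / 2 < ‖x‖ ^ ((n : ℝ) - 2) := by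
    have h2 := Real.rpow_lt_rpow (horizonRadius_pos hm).le hx hp
    rwa [horizonRadius, ← Real.rpow_mul (by positivity), one_div, inv_mul_cancel₀ hp.ne',
      Real.rpow_one] at h2
  have h3 : ‖x‖ ^ (2 - (n : ℝ)) = (‖x‖ ^ ((n : ℝ) - 2))⁻¹ := by
    rw [← Real.rpow_neg h0.le]; congr 1; ring
  have h4 : 0 < ‖x‖ ^ ((n : ℝ) - 2) := by positivity
  unfold potentialU
  rw [h3]
  have : m / 2 * (‖x‖ ^ ((n : ℝ) - 2))⁻¹ < 1 := by
    rw [← div_eq_mul_inv, div_lt_one h4]; exact h1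
  linarith

/-- Since `s ^ (2 - n) = |x| ^ (2 - n) / u²` and `m |x| ^ (2 - n) = 2 (u - 1)`, the radicand is `(u²
- 4u + 4) / u²`; the sign of the root comes from `u < 2`. -/
theorem potential_eq (hn : 3 ≤ n) (hm : 0 < m) (hx : x ∈ interiorM n m) :
    potential m x = (2 - potentialU m x) / potentialU m x := by
  have hp : (0 : ℝ) < (n : ℝ) - 2 := by
    have : (3 : ℝ) ≤ n := by exact_mod_cast hn
    linarith
  have h0 : 0 < ‖x‖ := (horizonRadius_pos hm).trans hx
  have hu : 0 < potentialU m x := potentialU_pos hm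
  have h1 : areaRadius m x ^ (2 - (n : ℝ)) = ‖x‖ ^ (2 - (n : ℝ)) / potentialU m x ^ 2 := by
    rw [areaRadius, Real.mul_rpow h0.le (by positivity), ← Real.rpow_mul hu.le,
      show 2 / ((n : ℝ) - 2) * (2 - n) = -((2 : ℕ) : ℝ) by push_cast; field_simp; ring,
      Real.rpow_neg hu.le, Real.rpow_natCast, div_eq_mul_inv]
  have h2 : m * ‖x‖ ^ (2 - (n : ℝ)) = 2 * (potentialU m x - 1) := by unfold potentialU; ring
  have h3 : 1 - 2 * m * areaRadius m x ^ (2 - (n : ℝ)) =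
      ((2 - potentialU m x) / potentialU m x) ^ 2 := by
    rw [h1]
    field_simp
    linear_combination (-2) * h2
  have h4 := potentialU_lt_two hn hm hx
  rw [potential, h3, Real.sqrt_sq]
  exact div_nonneg (by linarith) hu.le

/-- The conformal factor: `g = conf² ⟨·, ·⟩`. -/
def conf (m : ℝ) (x : E n) : ℝ := potentialU m x ^ (2 / ((n : ℝ) - 2))

theorem conf_pos (hm : 0 < m) : 0 < conf m x := Real.rpow_pos_of_pos (potentialU_pos hm) _

theorem metric_eq (hm : 0 < m) (v w : E n) : metric m x v w = conf m x ^ 2 * inner ℝ v w := by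
  rw [metric, conf, ← Real.rpow_natCast, ← Real.rpow_mul (potentialU_pos hm).le]
  congr 2; push_cast; ring

/-- The exponent identity is `2(n-1)/(n-2) = 2/(n-2) + 2`. One factor of `c` is spent on the mean
curvature and `u²` clears the denominator of `f`. -/
theorem conf_pow (hn : 3 ≤ n) (hm : 0 < m) {k : ℕ} (hk : n = k + 1) :
    conf m x ^ k = conf m x * potentialU m x ^ 2 := by
  have hp : (n : ℝ) - 2 ≠ 0 := by
    have : (3 : ℝ) ≤ n := by exact_mod_cast hn
    linarith
  obtain ⟨p, rfl⟩ : ∃ p, k = p + 1 := ⟨k - 1, by omega⟩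
  rw [pow_succ', conf, ← Real.rpow_natCast (_ ^ _) p, ← Real.rpow_mul (potentialU_pos hm).le,
    ← Real.rpow_natCast _ 2]
  congr 2
  subst hk
  push_cast at hp ⊢
  field_simp
  ring

/-- The logarithmic derivative of the conformal factor in the direction `N`. -/
def confSlope (m : ℝ) (x N : E n) : ℝ :=
  2 / ((n : ℝ) - 2) * inner ℝ (gradU m x) N / potentialU m x

theorem hasFDerivAt_conf (hm : 0 < m) (hx : x ≠ 0) :
    HasFDerivAt (conf m) ((conf m x * (2 / ((n : ℝ) - 2)) / potentialU m x) •
      innerSL ℝ (gradU m x)) x := by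
  have hu : 0 < potentialU m x := potentialU_pos hm
  have h := (hasFDerivAt_potentialU (m := m) hx).rpow_const (p := 2 / ((n : ℝ) - 2)) (Or.inl hu.ne')
  refine h.congr_fderiv ?_
  rw [Real.rpow_sub hu, Real.rpow_one, conf]
  congr 1; ring

theorem fderiv_conf (hm : 0 < m) (hx : x ≠ 0) (v : E n) :
    fderiv ℝ (conf m) x v = conf m x * confSlope m x v := by
  rw [(hasFDerivAt_conf hm hx).fderiv, confSlope]
  simp only [_root_.smul_apply, innerSL_apply_apply, smul_eq_mul]
  ring

/-- For a conformally flat metric, only the logarithmic derivative of the conformal factor enters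
the Levi-Civita connection. -/
theorem christoffel_eq (hm : 0 < m) (hx : x ≠ 0) (a b c : E n) :
    christoffel m x a b c = conf m x ^ 2 * (confSlope m x a * inner ℝ b c +
      confSlope m x b * inner ℝ a c - confSlope m x c * inner ℝ a b) := by
  have h : ∀ v w z : E n, fderiv ℝ (fun y => metric m y v w) x z =
      2 * conf m x ^ 2 * confSlope m x z * inner ℝ v w := by
    intro v w z
    have h1 : (fun y : E n => metric m y v w) = fun y => conf m y ^ 2 * inner ℝ v w := by
      ext y; exact metric_eq hm v w
    have h2 := (((hasFDerivAt_conf hm hx).differentiableAt.hasFDerivAt.pow 2).mul_const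
      (inner ℝ v w : ℝ))
    rw [h1, h2.fderiv]
    simp only [_root_.smul_apply, smul_eq_mul, fderiv_conf hm hx]
    simp
    ring
  rw [christoffel, h, h, h]
  ring

end Potential

/-! ### The evolution of the area and weighted mean curvature densities -/

section Evolution

variable {k n : ℕ} {O : Set (E k × ℝ)} {X N : E k × ℝ → E n} {φ : E k × ℝ → ℝ} {w : E k × ℝ}
  {m : ℝ}

/-- The mean curvature with respect to the Schwarzschild metric, times the conformal factor. -/
def confMean (m : ℝ) (X N : E k × ℝ → E n) (w : E k × ℝ) : ℝ :=
  mean X N w + k * confSlope m (X w) (N w)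

/-- The area density with respect to the Schwarzschild metric. -/
def areaDens (m : ℝ) (X : E k × ℝ → E n) (w : E k × ℝ) : ℝ := conf m (X w) ^ k * dens X w

/-- The density of `f H dμ`. -/
def weightDens (m : ℝ) (X N : E k × ℝ → E n) (w : E k × ℝ) : ℝ :=
  (2 - potentialU m (X w)) * potentialU m (X w) * confMean m X N w * dens X w

/-- The squared norm of the trace-free second fundamental form. -/
def umbilicDefect (m : ℝ) (X N : E k × ℝ → E n) (w : E k × ℝ) : ℝ :=
  tr (E k) ((shape X N w + confSlope m (X w) (N w) • ContinuousLinearMap.id ℝ (E k)) ∘L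
    (shape X N w + confSlope m (X w) (N w) • ContinuousLinearMap.id ℝ (E k))) -
  (tr (E k) (shape X N w + confSlope m (X w) (N w) • ContinuousLinearMap.id ℝ (E k))) ^ 2 / k

/-- The dissipation density of the monotone quantity. -/
def defectDens (m : ℝ) (X N : E k × ℝ → E n) (w : E k × ℝ) : ℝ :=
  (2 - potentialU m (X w)) * potentialU m (X w) * (confMean m X N w)⁻¹ *
    umbilicDefect m X N w * dens X w

/-- The ambient field whose tangential part is the flux of the weighted mean curvature. -/
def weightFlux (m : ℝ) (X N : E k × ℝ → E n) (φ : E k × ℝ → ℝ) (w : E k × ℝ) : E n :=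
  ((2 - potentialU m (X w)) * potentialU m (X w)) • tD N w +
    φ w • (2 - 2 * potentialU m (X w)) • gradU m (X w) -
    (2 * k / ((n : ℝ) - 2)) • φ w • (2 - potentialU m (X w)) • gradU m (X w)

theorem tr_shape_add (s : ℝ) :
    tr (E k) (shape X N w + s • ContinuousLinearMap.id ℝ (E k)) = mean X N w + k * s := by
  rw [map_add, map_smul, tr_id, mean]; simp [mul_comm]

theorem tr_shape_add_sq (s : ℝ) :
    tr (E k) ((shape X N w + s • ContinuousLinearMap.id ℝ (E k)) ∘L
      (shape X N w + s • ContinuousLinearMap.id ℝ (E k))) =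
      tr (E k) (shape X N w ∘L shape X N w) + 2 * s * mean X N w + k * s ^ 2 := by
  have : (shape X N w + s • ContinuousLinearMap.id ℝ (E k)) ∘L
      (shape X N w + s • ContinuousLinearMap.id ℝ (E k)) =
      shape X N w ∘L shape X N w + (2 * s) • shape X N w +
        s ^ 2 • ContinuousLinearMap.id ℝ (E k) := by
    ext1 η
    simp only [ContinuousLinearMap.comp_apply, _root_.add_apply,
      _root_.smul_apply, ContinuousLinearMap.id_apply, map_add, map_smul]
    module
  rw [this, map_add, map_add, map_smul, map_smul, tr_id, mean]
  simp [mul_comm]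

namespace LocalFlow

/-- Newton's inequality applied to the conformally shifted shape operator. The shift is a multiple
of the identity, so symmetry and the umbilicity condition are unaffected. -/
theorem umbilicDefect_nonneg (h : LocalFlow O X N φ) (hw : w ∈ O) (hk : 0 < k) :
    0 ≤ umbilicDefect m X N w ∧ (umbilicDefect m X N w = 0 ↔
      ∃ c : ℝ, shape X N w = c • ContinuousLinearMap.id ℝ (E k)) := by
  have := (h.adapted hw).sq_tr_le hk
    (B := shape X N w + confSlope m (X w) (N w) • ContinuousLinearMap.id ℝ (E k)) (by
      intro η ζ
      simp [inner_add_left, inner_add_right, h.shape_symm hw, inner_smul_left, inner_smul_right])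
  refine ⟨this.1, this.2.trans ⟨?_, ?_⟩⟩
  · rintro ⟨c, hc⟩
    exact ⟨c - confSlope m (X w) (N w), by rw [eq_sub_of_add_eq hc]; module⟩
  · rintro ⟨c, hc⟩
    exact ⟨c + confSlope m (X w) (N w), by rw [hc]; module⟩

/-- The relative growth rate is `φ (tr A + k ∂_N log c)`, which the speed hypothesis normalises to
`1`. -/
theorem tD_areaDens (h : LocalFlow O X N φ) (hm : 0 < m) (hw : w ∈ O) (hX : X w ≠ 0)
    (hφ : φ w * confMean m X N w = 1) : tD (areaDens m X) w = areaDens m X w := by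
  have hXd := (diffAt h.isOpen h.smooth hw).hasFDerivAt
  have hc : HasFDerivAt (fun x => conf m (X x)) _ w :=
    (hasFDerivAt_conf hm hX).differentiableAt.hasFDerivAt.comp w hXd
  have h1 : HasFDerivAt (areaDens m X) _ w :=
    (hc.pow k).mul (diffAt h.isOpen h.smooth_dens hw).hasFDerivAt
  rw [tD, h1.fderiv]
  have h6 : fderiv ℝ X w (0, 1) = φ w • N w := h.flow w hw
  have h7 := h.tD_dens hw
  have hs : ∀ s : ℝ, confSlope m (X w) (s • N w) = s * confSlope m (X w) (N w) := by
    intro s; simp only [confSlope, inner_smul_right]; ring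
  simp only [tD] at h7
  simp only [_root_.add_apply, _root_.smul_apply, ContinuousLinearMap.comp_apply, h6, h7,
    fderiv_conf hm hX, hs, smul_eq_mul, areaDens]
  -- The derivative of a `k`-th power carries the truncated exponent `k - 1`, so `k = 0` is treated
  -- apart.
  rcases k with _ | k
  · simp only [confMean, Nat.cast_zero, zero_mul, add_zero] at hφ
    simp [hφ]
  · simp only [confMean] at hφ
    simp only [Nat.add_sub_cancel, nsmul_eq_mul, pow_succ]
    linear_combination (conf m (X w) ^ k * conf m (X w) * dens X w) * hφ

/-- The density splits into a mean curvature part with weight `(2 - u) u` and a flux part for the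
field `(2 - u)∇u`. Adding their evolution equations, harmonicity removes `Δu`, and `static_identity`
eliminates `Hess u (N, N)` along with the `|∇u|²` terms. -/
theorem tD_weightDens (h : LocalFlow O X N φ) (hn : 3 ≤ n) (hm : 0 < m) (hw : w ∈ O)
    (hX : ∀ x ∈ O, X x ≠ 0) (hφ : φ w * confMean m X N w = 1) :
    tD (weightDens m X N) w = -4 * inner ℝ (N w) (gradU m (X w)) * dens X w +
      (((n : ℝ) - 2) / ((n : ℝ) - 1)) * weightDens m X N w - defectDens m X N w +
      zdiv (fun x => dens X x • proj X N x (weightFlux m X N φ x)) w := by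
  have hp : (n : ℝ) - 2 ≠ 0 := by
    have : (3 : ℝ) ≤ n := by exact_mod_cast hn
    linarith
  have hkn : (n : ℝ) = k + 1 := by exact_mod_cast h.dim
  have hk : (k : ℝ) ≠ 0 := by
    have : (3 : ℝ) ≤ n := by exact_mod_cast hn
    intro h0; rw [h0] at hkn; linarith
  have hx := hX w hw
  have hu : 0 < potentialU m (X w) := potentialU_pos hm
  have dU := hasFDerivAt_potentialU (m := m) hx
  have dG := (hasFDerivAt_gradU (m := m) hx).differentiableAt.hasFDerivAt
  -- the mean curvature part
  have hF : HasFDerivAt (fun y => (2 - potentialU m y) * potentialU m y)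
      (innerSL ℝ ((2 - 2 * potentialU m (X w)) • gradU m (X w))) (X w) := by
    refine ((dU.const_sub 2).mul dU).congr_fderiv ?_
    ext v
    simp only [_root_.add_apply, _root_.smul_apply, _root_.neg_apply, innerSL_apply_apply,
      inner_smul_left, conj_trivial, smul_eq_mul]
    ring
  have hG : HasFDerivAt (fun y => (2 - 2 * potentialU m y) • gradU m y) _ (X w) :=
    ((dU.const_mul 2).const_sub 2).smul dG
  have e1 := h.mean_evolution hw (F := fun y => (2 - potentialU m y) * potentialU m y)
    (G := fun y => (2 - 2 * potentialU m y) • gradU m y) hF hG.differentiableAt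
  -- the flux part
  have hV : HasFDerivAt (fun y => (2 - potentialU m y) • gradU m y) _ (X w) :=
    (dU.const_sub 2).smul dG
  have e2 := h.flux_evolution hw (V := fun y => (2 - potentialU m y) • gradU m y)
    hV.differentiableAt
  -- decomposition of both sides
  have hXd := (diffAt h.isOpen h.smooth hw)
  have hUX : DifferentiableAt ℝ (fun x => potentialU m (X x)) w :=
    dU.differentiableAt.comp w hXd
  have hGX : DifferentiableAt ℝ (fun x => gradU m (X x)) w := dG.differentiableAt.comp w hXd
  have hN := diffAt h.isOpen h.smooth_normal hw
  have hNt := diffAt h.isOpen (ContDiffOn.tD h.isOpen h.smooth_normal) hw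
  have hd := diffAt h.isOpen h.smooth_dens hw
  have hP := diffAt h.isOpen h.smooth_proj hw
  have hmn := diffAt h.isOpen h.smooth_mean hw
  have hsp := diffAt h.isOpen h.smooth_speed hw
  have hl : tD (weightDens m X N) w =
      tD (fun x => dens X x * ((2 - potentialU m (X x)) * potentialU m (X x) * mean X N x)) w +
      (2 * k / ((n : ℝ) - 2)) *
        tD (fun x => dens X x * inner ℝ ((2 - potentialU m (X x)) • gradU m (X x)) (N x)) w := by
    have he : weightDens m X N = fun x =>
        dens X x * ((2 - potentialU m (X x)) * potentialU m (X x) * mean X N x) +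
        (2 * k / ((n : ℝ) - 2)) *
          (dens X x * inner ℝ ((2 - potentialU m (X x)) • gradU m (X x)) (N x)) := by
      ext x
      have : potentialU m (X x) ≠ 0 := (potentialU_pos hm).ne'
      simp only [weightDens, confMean, confSlope, inner_smul_left, conj_trivial]
      field_simp
    have d1 : DifferentiableAt ℝ (fun x =>
        dens X x * ((2 - potentialU m (X x)) * potentialU m (X x) * mean X N x)) w := by fun_prop
    have d2 : DifferentiableAt ℝ (fun x =>
        dens X x * inner ℝ ((2 - potentialU m (X x)) • gradU m (X x)) (N x)) w :=
      hd.mul (DifferentiableAt.inner ℝ ((hUX.const_sub 2).smul hGX) hN)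
    rw [he, tD, (d1.hasFDerivAt.fun_add (d2.hasFDerivAt.const_mul _)).fderiv]
    simp [tD]
  have hr : zdiv (fun x => dens X x • proj X N x (weightFlux m X N φ x)) w =
      zdiv (fun x => dens X x • proj X N x (((2 - potentialU m (X x)) * potentialU m (X x)) • tD N x
        + φ x • (2 - 2 * potentialU m (X x)) • gradU m (X x))) w -
      (2 * k / ((n : ℝ) - 2)) * zdiv (fun x => dens X x • proj X N x
        (φ x • (2 - potentialU m (X x)) • gradU m (X x))) w := by
    have he : (fun x => dens X x • proj X N x (weightFlux m X N φ x)) = fun x =>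
        dens X x • proj X N x (((2 - potentialU m (X x)) * potentialU m (X x)) • tD N x
          + φ x • (2 - 2 * potentialU m (X x)) • gradU m (X x)) -
        (2 * k / ((n : ℝ) - 2)) • (dens X x • proj X N x
          (φ x • (2 - potentialU m (X x)) • gradU m (X x))) := by
      ext1 x
      simp only [weightFlux, map_sub, map_smul]
      module
    have d1 : DifferentiableAt ℝ (fun x => dens X x • proj X N x
        (((2 - potentialU m (X x)) * potentialU m (X x)) • tD N x
          + φ x • (2 - 2 * potentialU m (X x)) • gradU m (X x))) w :=
      hd.smul (hP.clm_apply ((((hUX.const_sub 2).mul hUX).smul hNt).add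
        (hsp.smul (((hUX.const_mul 2).const_sub 2).smul hGX))))
    have d2 : DifferentiableAt ℝ (fun x => dens X x • proj X N x
        (φ x • (2 - potentialU m (X x)) • gradU m (X x))) w :=
      hd.smul (hP.clm_apply (hsp.smul ((hUX.const_sub 2).smul hGX)))
    rw [he, zdiv, zD, (d1.hasFDerivAt.fun_sub (d2.hasFDerivAt.fun_const_smul _)).fderiv,
      ContinuousLinearMap.sub_comp, ContinuousLinearMap.smul_comp, map_sub, map_smul]
    rfl
  have t1 : tr (E n) (fderiv ℝ (fun y => (2 - 2 * potentialU m y) • gradU m y) (X w)) =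
      -2 * inner ℝ (gradU m (X w)) (gradU m (X w)) := by
    rw [hG.fderiv, map_add, map_smul, tr_fderiv_gradU hx, tr_smulRight]
    simp [innerSL_apply_apply]
  have t2 : inner ℝ (N w) (fderiv ℝ (fun y => (2 - 2 * potentialU m y) • gradU m y) (X w) (N w)) =
      -2 * inner ℝ (N w) (gradU m (X w)) ^ 2 +
        (2 - 2 * potentialU m (X w)) * inner ℝ (N w) (fderiv ℝ (gradU m) (X w) (N w)) := by
    rw [hG.fderiv]
    simp only [_root_.add_apply, _root_.smul_apply, _root_.neg_apply, innerSL_apply_apply,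
      ContinuousLinearMap.smulRight_apply, inner_add_right, inner_smul_right, smul_eq_mul,
      real_inner_comm (N w) (gradU m (X w))]
    ring
  have t3 : tr (E n) (fderiv ℝ (fun y => (2 - potentialU m y) • gradU m y) (X w)) =
      - inner ℝ (gradU m (X w)) (gradU m (X w)) := by
    rw [hV.fderiv, map_add, map_smul, tr_fderiv_gradU hx, tr_smulRight]
    simp [innerSL_apply_apply]
  have st := static_identity (m := m) hx (N w)
  rw [h.unit w hw, mul_one] at st
  rw [t3] at e2
  rw [t1, t2] at e1
  have hinv : (confMean m X N w)⁻¹ = φ w := inv_eq_of_mul_eq_one_left hφ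
  rw [hl, hr, e1, eq_sub_of_add_eq e2]
  simp only [defectDens, hinv, umbilicDefect, tr_shape_add, tr_shape_add_sq, weightDens,
    inner_smul_right]
  have hslope : inner ℝ (N w) (gradU m (X w)) = ((n : ℝ) - 2) / 2 * potentialU m (X w) *
      confSlope m (X w) (N w) := by
    rw [confSlope, real_inner_comm]; field_simp
  simp only [confMean] at hφ ⊢
  rw [hslope] at st ⊢
  generalize (inner ℝ (gradU m (X w)) (gradU m (X w)) : ℝ) = g2 at *
  generalize (inner ℝ (N w) (fderiv ℝ (gradU m) (X w) (N w)) : ℝ) = unn at *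
  generalize confSlope m (X w) (N w) = s at *
  generalize potentialU m (X w) = u at *
  generalize mean X N w = H at *
  generalize dens X w = d at *
  generalize tr (E k) (shape X N w ∘L shape X N w) = a2 at *
  generalize φ w = f at *
  obtain ⟨p, hnp⟩ : ∃ p : ℝ, (n : ℝ) = p + 2 := ⟨n - 2, by ring⟩
  have hkp : (k : ℝ) = p + 1 := by linarith
  have hf : f ≠ 0 := by rintro rfl; simp at hφ
  -- The speed law eliminates the Euclidean mean curvature, reducing the claim to a rational
  -- identity in the remaining scalars.
  have hH : H = f⁻¹ - k * s := by field_simp; linarith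
  rw [hnp, show p + 2 - 2 = p by ring] at st hp ⊢
  rw [hkp] at hk hH ⊢
  rw [show p + 2 - 1 = p + 1 by ring]
  have st' : (2 - 2 * u) * unn = 2 * (g2 - (p + 2) * (p / 2 * u * s) ^ 2) / p := by
    field_simp; linarith
  rw [st', hH]
  field_simp
  ring

end LocalFlow

end Evolution

/-! ### Hypersurfaces in charts -/

section Charts

variable {n : ℕ} {S : Type*} [TopologicalSpace S] [ChartedSpace (E (n - 1)) S]

/-- A family of maps on `S` in the chart at `q`. -/
def chartFun {F : Type*} (x : ℝ → S → F) (q : S) (w : E (n - 1) × ℝ) : F :=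
  x w.2 ((chartAt (E (n - 1)) q).symm w.1)

/-- The domain of the space-time chart at `q`. -/
def chartDom (n : ℕ) {S : Type*} [TopologicalSpace S] [ChartedSpace (E (n - 1)) S] (T : ℝ) (q : S) :
    Set (E (n - 1) × ℝ) :=
  (chartAt (E (n - 1)) q).target ×ˢ Ioo 0 T

/-- The Euclidean unit normal. -/
def euclNormal (m : ℝ) (x ν : ℝ → S → E n) (t : ℝ) (p : S) : E n := conf m (x t p) • ν t p

/-- The Euclidean normal speed in the chart at `q`. -/
def chartSpeed (m : ℝ) (x ν : ℝ → S → E n) (q : S) (w : E (n - 1) × ℝ) : ℝ :=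
  inner ℝ (tD (chartFun x q) w) (chartFun (euclNormal m x ν) q w)

theorem isOpen_chartDom (T : ℝ) (q : S) : IsOpen (chartDom n T q) :=
  (chartAt (E (n - 1)) q).open_target.prod isOpen_Ioo

variable [IsManifold (𝓡 (n - 1)) ∞ S]

theorem contDiffOn_chartFun {F : Type*} [NormedAddCommGroup F] [NormedSpace ℝ F] {T : ℝ}
    {x : ℝ → S → F}
    (hx : ContMDiffOn ((𝓡 (n - 1)).prod 𝓘(ℝ, ℝ)) 𝓘(ℝ, F) ∞ (fun q : S × ℝ => x q.2 q.1)
      (univ ×ˢ Ico 0 T)) (q : S) : ContDiffOn ℝ ∞ (chartFun x q) (chartDom n T q) := by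
  have h1 : ContMDiffOn 𝓘(ℝ, E (n - 1)) (𝓡 (n - 1)) ∞ (chartAt (E (n - 1)) q).symm
      (chartAt (E (n - 1)) q).target := contMDiffOn_chart_symm
  have h2 : ContMDiffOn 𝓘(ℝ, E (n - 1) × ℝ) ((𝓡 (n - 1)).prod 𝓘(ℝ, ℝ)) ∞
      (fun w : E (n - 1) × ℝ => ((chartAt (E (n - 1)) q).symm w.1, w.2)) (chartDom n T q) := by
    refine ContMDiffOn.prodMk (h1.comp contDiff_fst.contMDiff.contMDiffOn fun w hw => hw.1)
      contDiff_snd.contMDiff.contMDiffOn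
  have h3 := hx.comp h2 fun w hw => ⟨mem_univ _, hw.2.1.le, hw.2.2⟩
  exact contMDiffOn_iff_contDiffOn.mp h3

theorem contMDiffAt_slice {F : Type*} [NormedAddCommGroup F] [NormedSpace ℝ F] {T : ℝ}
    {x : ℝ → S → F}
    (hx : ContMDiffOn ((𝓡 (n - 1)).prod 𝓘(ℝ, ℝ)) 𝓘(ℝ, F) ∞ (fun q : S × ℝ => x q.2 q.1)
      (univ ×ˢ Ico 0 T)) {t : ℝ} (ht : t ∈ Ioo 0 T) : ContMDiff (𝓡 (n - 1)) 𝓘(ℝ, F) ∞ (x t) := by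
  have h1 : ContMDiff (𝓡 (n - 1)) ((𝓡 (n - 1)).prod 𝓘(ℝ, ℝ)) ∞ (fun p : S => (p, t)) :=
    contMDiff_id.prodMk contMDiff_const
  have h2 := hx.comp (s := univ) h1.contMDiffOn fun p _ => ⟨mem_univ _, ht.1.le, ht.2⟩
  exact contMDiffOn_univ.mp h2

/-- The differential of a map on `S` as a continuous linear map on the model space. -/
def diffCLM {F : Type*} [NormedAddCommGroup F] [NormedSpace ℝ F] (f : S → F) (p : S) :
    E (n - 1) →L[ℝ] F :=
  mfderiv (𝓡 (n - 1)) 𝓘(ℝ, F) f p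

/-- The differential of the inverse of the chart at `q`. -/
theorem exists_chart_differential (q : S) {z : E (n - 1)}
    (hz : z ∈ (chartAt (E (n - 1)) q).target) :
    ∃ A : E (n - 1) ≃L[ℝ] E (n - 1), ∀ {F : Type} [NormedAddCommGroup F] [NormedSpace ℝ F]
      (f : S → F), MDifferentiableAt (𝓡 (n - 1)) 𝓘(ℝ, F) f ((chartAt (E (n - 1)) q).symm z) →
      HasFDerivAt (fun y => f ((chartAt (E (n - 1)) q).symm y))
        (diffCLM f ((chartAt (E (n - 1)) q).symm z) ∘L (A : E (n - 1) →L[ℝ] E (n - 1))) z := by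
  have he : (chartAt (E (n - 1)) q).MDifferentiable (𝓡 (n - 1)) 𝓘(ℝ, E (n - 1)) :=
    mdifferentiable_chart q
  refine ⟨he.symm.mfderiv hz, fun f hf => ?_⟩
  have h1 := (he.symm.mdifferentiableAt hz)
  have h2 := hf.hasMFDerivAt.comp z h1.hasMFDerivAt
  exact h2.hasFDerivAt

theorem hasFDerivAt_slice {k : ℕ} {F : Type*} [NormedAddCommGroup F] [NormedSpace ℝ F]
    {f : E k × ℝ → F} {w : E k × ℝ} (hf : DifferentiableAt ℝ f w) :
    HasFDerivAt (fun z => f (z, w.2)) (zD f w) w.1 := by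
  have h1 : HasFDerivAt (fun z : E k => (z, w.2)) (ContinuousLinearMap.inl ℝ (E k) ℝ) w.1 :=
    hasFDerivAt_prodMk_left _ _
  exact hf.hasFDerivAt.comp (f := fun z : E k => (z, w.2)) w.1 h1

end Charts

/-! ### The flow and its extrinsic geometry in space-time charts. -/

section Flow

variable {n : ℕ} {S : Type*} [TopologicalSpace S] [ChartedSpace (E (n - 1)) S]
  [IsManifold (𝓡 (n - 1)) ∞ S] {m T : ℝ} {x ν : ℝ → S → E n} {Ω : ℝ → Set (E n)}

namespace IsSmoothIMCF

theorem mem_interior (h : IsSmoothIMCF m T x ν Ω) {t : ℝ} (ht : t ∈ Ico 0 T) (p : S) :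
    x t p ∈ interiorM n m := by
  rcases h.bounds t ht with hb | hb
  · have : x t p ∈ frontier (Ω t) := by rw [hb.frontier_eq]; exact mem_range_self p
    exact hb.closure_subset (frontier_subset_closure this)
  · exact hb.boundary_subset (mem_range_self p)

theorem ne_zero (h : IsSmoothIMCF m T x ν Ω) (hm : 0 < m) {t : ℝ} (ht : t ∈ Ico 0 T) (p : S) :
    x t p ≠ 0 := ne_zero_of_mem hm (h.mem_interior ht p)

theorem contDiffOn_normal (h : IsSmoothIMCF m T x ν Ω) (hm : 0 < m) (q : S) :
    ContDiffOn ℝ ∞ (chartFun (euclNormal m x ν) q) (chartDom n T q) := by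
  have hX := contDiffOn_chartFun h.smooth q
  have hν := contDiffOn_chartFun h.smooth_normal q
  have hc : ContDiffOn ℝ ∞ (fun w => conf m (chartFun x q w)) (chartDom n T q) := by
    intro w hw
    have hne : chartFun x q w ≠ 0 := h.ne_zero hm ⟨hw.2.1.le, hw.2.2⟩ _
    have h1 : ContDiffWithinAt ℝ ∞ (fun w => ‖chartFun x q w‖ ^ (2 - (n : ℝ))) (chartDom n T q) w :=
      ((hX w hw).norm ℝ hne).rpow_const_of_ne (norm_ne_zero_iff.mpr hne)
    exact (contDiffWithinAt_const.add (contDiffWithinAt_const.mul h1)).rpow_const_of_ne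
      (potentialU_pos (x := chartFun x q w) hm).ne'
  exact hc.smul hν

theorem inner_normal (h : IsSmoothIMCF m T x ν Ω) (hm : 0 < m) {t : ℝ} (ht : t ∈ Ico 0 T) (p : S) :
    inner ℝ (euclNormal m x ν t p) (euclNormal m x ν t p) = (1 : ℝ) := by
  have := h.normal_unit t ht p
  rw [metric_eq hm] at this
  rw [euclNormal, real_inner_smul_left, real_inner_smul_right, ← this]; ring

theorem inner_normal_differential (h : IsSmoothIMCF m T x ν Ω) (hm : 0 < m) {t : ℝ}
    (ht : t ∈ Ico 0 T) (p : S) (v : E (n - 1)) :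
    inner ℝ (euclNormal m x ν t p) (diffCLM (n := n) (x t) p v) = (0 : ℝ) := by
  have := h.normal_orthogonal t ht p v
  rw [metric_eq hm] at this
  rw [euclNormal, real_inner_smul_left]
  rcases mul_eq_zero.mp this with h0 | h0
  · exact absurd h0 (by have := conf_pos (x := x t p) hm; positivity)
  · exact mul_eq_zero_of_right _ h0

theorem adapted (h : IsSmoothIMCF m T x ν Ω) (hn : 3 ≤ n) (hm : 0 < m) {t : ℝ} (ht : t ∈ Ico 0 T)
    (p : S) : Adapted (diffCLM (n := n) (x t) p) (euclNormal m x ν t p)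
      (leftInv (diffCLM (n := n) (x t) p) (euclNormal m x ν t p)) :=
  adapted_leftInv (by omega) (h.inner_normal hm ht p) (h.inner_normal_differential hm ht p)
    (h.immersion t ht p)

/-- The speed equation in the chart. -/
theorem tD_chartFun (h : IsSmoothIMCF m T x ν Ω) (q : S) {w : E (n - 1) × ℝ}
    (hw : w ∈ chartDom n T q) : tD (chartFun x q) w =
      (meanCurvature m (x w.2) (ν w.2) ((chartAt (E (n - 1)) q).symm w.1))⁻¹ •
        chartFun ν q w := by
  have h1 := (diffAt (isOpen_chartDom T q) (contDiffOn_chartFun h.smooth q) hw).hasFDerivAt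
  have h2 : HasDerivAt (fun τ : ℝ => (w.1, τ)) ((0, 1) : E (n - 1) × ℝ) w.2 :=
    (hasDerivAt_const w.2 w.1).prodMk (hasDerivAt_id w.2)
  have h3 : HasDerivAt (fun τ => chartFun x q (w.1, τ)) (tD (chartFun x q) w) w.2 :=
    HasFDerivAt.comp_hasDerivAt (f := fun τ : ℝ => (w.1, τ)) w.2 h1 h2
  have h4 := (h.flow w.2 ⟨hw.2.1.le, hw.2.2⟩ ((chartAt (E (n - 1)) q).symm w.1)).hasDerivAt
    (Ico_mem_nhds hw.2.1 hw.2.2)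
  exact h3.unique h4

/-- Passes from the manifold to the Euclidean variation formulas. Defining the speed as `⟨∂_t X, N⟩`
makes its smoothness automatic; the flow equation says that `∂_t X` has no tangential part. -/
theorem localFlow (h : IsSmoothIMCF m T x ν Ω) (hn : 3 ≤ n) (hm : 0 < m) (q : S) :
    LocalFlow (chartDom n T q) (chartFun x q) (chartFun (euclNormal m x ν) q)
      (chartSpeed m x ν q) := by
  have hX := contDiffOn_chartFun h.smooth q
  have hN := h.contDiffOn_normal hm q
  have hO := isOpen_chartDom (n := n) T q
  have hz : ∀ w ∈ chartDom n T q, ∃ A : E (n - 1) ≃L[ℝ] E (n - 1), zD (chartFun x q) w =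
      diffCLM (n := n) (x w.2) ((chartAt (E (n - 1)) q).symm w.1) ∘L (A : E (n - 1) →L[ℝ] E (n - 1)) := by
    intro w hw
    obtain ⟨A, hA⟩ := exists_chart_differential q hw.1
    refine ⟨A, ?_⟩
    exact (hasFDerivAt_slice (diffAt hO hX hw)).unique
      (hA (x w.2) ((contMDiffAt_slice h.smooth hw.2).mdifferentiable (by simp) _))
  refine ⟨by omega, hO, hX, hN, (ContDiffOn.tD hO hX).inner ℝ hN, fun w hw => ?_, fun w hw => ?_,
    fun w hw η => ?_, fun w hw => ?_⟩
  · obtain ⟨A, hA⟩ := hz w hw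
    rw [hA]
    exact (h.immersion w.2 ⟨hw.2.1.le, hw.2.2⟩ _).comp A.injective
  · exact h.inner_normal hm ⟨hw.2.1.le, hw.2.2⟩ _
  · obtain ⟨A, hA⟩ := hz w hw
    rw [hA]
    exact h.inner_normal_differential hm ⟨hw.2.1.le, hw.2.2⟩ _ _
  · have h1 := h.tD_chartFun q hw
    have h2 := h.inner_normal hm ⟨hw.2.1.le, hw.2.2⟩ ((chartAt (E (n - 1)) q).symm w.1)
    have hc : conf m (x w.2 ((chartAt (E (n - 1)) q).symm w.1)) ≠ 0 := (conf_pos hm).ne'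
    have h3 : tD (chartFun x q) w =
        ((meanCurvature m (x w.2) (ν w.2) ((chartAt (E (n - 1)) q).symm w.1))⁻¹ *
          (conf m (x w.2 ((chartAt (E (n - 1)) q).symm w.1)))⁻¹) • chartFun (euclNormal m x ν) q w := by
      rw [h1, mul_smul]
      simp only [chartFun, euclNormal]
      rw [inv_smul_smul₀ hc]
    rw [chartSpeed, h3, real_inner_smul_left]
    rw [show (inner ℝ (chartFun (euclNormal m x ν) q w) (chartFun (euclNormal m x ν) q w) : ℝ) = 1
      from h2, mul_one]

/-- The geometry of the hypersurface in the chart at `q`. -/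
theorem chart_geometry (h : IsSmoothIMCF m T x ν Ω) (hn : 3 ≤ n) (hm : 0 < m) (q : S)
    {w : E (n - 1) × ℝ} (hw : w ∈ chartDom n T q) :
    meanCurvature m (x w.2) (ν w.2) ((chartAt (E (n - 1)) q).symm w.1) *
      conf m (chartFun x q w) = confMean m (chartFun x q) (chartFun (euclNormal m x ν) q) w ∧
    ((∃ c : ℝ, ∀ v v' : E (n - 1),
      secondFundamentalForm m (x w.2) (ν w.2) ((chartAt (E (n - 1)) q).symm w.1) v v' =
        c * inducedMetric m (x w.2) ((chartAt (E (n - 1)) q).symm w.1) v v') ↔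
      ∃ c : ℝ, shape (chartFun x q) (chartFun (euclNormal m x ν) q) w =
        c • ContinuousLinearMap.id ℝ (E (n - 1))) := by
  have ht : w.2 ∈ Ico 0 T := ⟨hw.2.1.le, hw.2.2⟩
  set p := (chartAt (E (n - 1)) q).symm w.1 with hp
  set c₀ := conf m (x w.2 p) with hc₀
  have hcpos : 0 < c₀ := conf_pos hm
  have hx0 : x w.2 p ≠ 0 := h.ne_zero hm ht p
  set L := diffCLM (n := n) (x w.2) p with hL
  set M := diffCLM (n := n) (ν w.2) p with hM
  set N := euclNormal m x ν w.2 p with hN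
  set P := leftInv L N with hP
  have had : Adapted L N P := h.adapted hn hm ht p
  have hflow := h.localFlow hn hm q
  have hν : ν w.2 p = c₀⁻¹ • N := by rw [hN, euclNormal, inv_smul_smul₀ hcpos.ne']
  set s := confSlope m (x w.2 p) (ν w.2 p) with hs
  have hsN : confSlope m (x w.2 p) N = c₀ * s := by
    rw [hs, hN, euclNormal, confSlope, confSlope, inner_smul_right]; ring
  -- the second fundamental form
  have hII : ∀ v v' : E (n - 1), secondFundamentalForm m (x w.2) (ν w.2) p v v' =
      c₀ ^ 2 * (inner ℝ (M v) (L v') + s * inner ℝ (L v) (L v')) := by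
    intro v v'
    have e1 : (inner ℝ (ν w.2 p) (L v') : ℝ) = 0 := by
      rw [hν, real_inner_smul_left, had.orthogonal, mul_zero]
    have e2 : (inner ℝ (L v) (ν w.2 p) : ℝ) = 0 := by
      rw [real_inner_comm, hν, real_inner_smul_left, had.orthogonal, mul_zero]
    have e3 : secondFundamentalForm m (x w.2) (ν w.2) p v v' =
      metric m (x w.2 p) (M v) (L v') + christoffel m (x w.2 p) (L v) (ν w.2 p) (L v') := rfl
    rw [e3, metric_eq hm, christoffel_eq hm hx0, e1, e2]
    ring
  have hI : ∀ v v' : E (n - 1), inducedMetric m (x w.2) p v v' =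
      c₀ ^ 2 * inner ℝ (L v) (L v') := fun v v' => metric_eq hm _ _
  -- the shape operator in the chart
  obtain ⟨A, hA⟩ := exists_chart_differential q hw.1
  have hXd := hasFDerivAt_slice (diffAt hflow.isOpen hflow.smooth hw)
  have hzX : zD (chartFun x q) w = L ∘L (A : E (n - 1) →L[ℝ] E (n - 1)) := hXd.unique
    (hA (x w.2) ((contMDiffAt_slice h.smooth hw.2).mdifferentiable (by simp) _))
  have hzν : HasFDerivAt (fun z => ν w.2 ((chartAt (E (n - 1)) q).symm z))
      (M ∘L (A : E (n - 1) →L[ℝ] E (n - 1))) w.1 :=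
    hA (ν w.2) ((contMDiffAt_slice h.smooth_normal hw.2).mdifferentiable (by simp) _)
  -- Differentiating the factor `c` in `N = c ν` only adds multiples of `N`, which the tangential
  -- projection annihilates; the exact `f` is irrelevant.
  have hzN : ∃ f : E (n - 1) →L[ℝ] ℝ, zD (chartFun (euclNormal m x ν) q) w =
      c₀ • (M ∘L (A : E (n - 1) →L[ℝ] E (n - 1))) + f.smulRight N := by
    have h1 : HasFDerivAt (fun z => conf m (x w.2 ((chartAt (E (n - 1)) q).symm z))) _ w.1 :=
      HasFDerivAt.comp (g := conf m) (f := fun z => x w.2 ((chartAt (E (n - 1)) q).symm z)) w.1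
        (hasFDerivAt_conf hm hx0) hXd
    have h2 := (hasFDerivAt_slice (diffAt hflow.isOpen hflow.smooth_normal hw)).unique
      (h1.smul hzν)
    refine ⟨c₀⁻¹ • (((conf m (x w.2 p) * (2 / ((n : ℝ) - 2)) / potentialU m (x w.2 p)) •
        innerSL ℝ (gradU m (x w.2 p))) ∘L zD (chartFun x q) w), h2.trans (congrArg₂ _ rfl ?_)⟩
    ext1 η
    simp only [ContinuousLinearMap.smulRight_apply, _root_.smul_apply, smul_eq_mul]
    rw [show ν w.2 ((chartAt (E (n - 1)) q).symm w.1) = c₀⁻¹ • N from hν, smul_smul, mul_comm c₀⁻¹]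
  have hPc : proj (chartFun x q) (chartFun (euclNormal m x ν) q) w =
      (A.symm : E (n - 1) →L[ℝ] E (n - 1)) ∘L P := by
    have h1 := had.comp_equiv A
    rw [← hzX] at h1
    exact (h1.unique (hflow.adapted hw).left_inv (hflow.adapted hw).ker)
  have hshape : shape (chartFun x q) (chartFun (euclNormal m x ν) q) w =
      c₀ • ((A.symm : E (n - 1) →L[ℝ] E (n - 1)) ∘L (P ∘L M) ∘L
        (A : E (n - 1) →L[ℝ] E (n - 1))) := by
    obtain ⟨f, hf⟩ := hzN
    rw [shape, hPc, hf]
    ext1 η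
    simp [had.ker]
  have htr : mean (chartFun x q) (chartFun (euclNormal m x ν) q) w =
      c₀ * tr (E (n - 1)) (P ∘L M) := by
    rw [mean, hshape, map_smul, tr_comp_comm, smul_eq_mul]
    congr 2
    ext1 η; simp
  have hPM : ∀ v v', (inner ℝ (M v) (L v') : ℝ) = inner ℝ (L (P (M v))) (L v') :=
    fun v v' => (had.inner_tangential _ _).symm
  constructor
  · have hG : (Matrix.of fun a b => inducedMetric m (x w.2) p (tangentBasis p a)
        (tangentBasis p b)) = c₀ ^ 2 • gram L := by
      ext a b; exact hI _ _
    have hB : (Matrix.of fun a b => secondFundamentalForm m (x w.2) (ν w.2) p (tangentBasis p a)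
        (tangentBasis p b)) = c₀ ^ 2 • ((Matrix.of fun a b =>
          inner ℝ (M (EuclideanSpace.single a 1)) (L (EuclideanSpace.single b 1))) +
            s • gram L) := by
      ext a b; exact hII _ _
    have hu : IsUnit (gram L).det := (det_gram_pos had.injective).ne'.isUnit
    have hinv : (c₀ ^ 2 • gram L)⁻¹ = (c₀ ^ 2)⁻¹ • (gram L)⁻¹ := by
      refine Matrix.inv_eq_left_inv ?_
      rw [Matrix.smul_mul, Matrix.mul_smul, smul_smul, inv_mul_cancel₀ (by positivity), one_smul,
        Matrix.nonsing_inv_mul _ hu]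
    have hH : meanCurvature m (x w.2) (ν w.2) p = tr (E (n - 1)) (P ∘L M) + s * (n - 1 : ℕ) := by
      rw [meanCurvature, hG, hB, hinv, Matrix.smul_mul, Matrix.mul_smul, smul_smul,
        inv_mul_cancel₀ (by positivity), one_smul, Matrix.mul_add, Matrix.trace_add,
        had.trace_gram_inv, Matrix.mul_smul, Matrix.nonsing_inv_mul _ hu, Matrix.trace_smul,
        Matrix.trace_one]
      simp
    have e1 : confMean m (chartFun x q) (chartFun (euclNormal m x ν) q) w =
      mean (chartFun x q) (chartFun (euclNormal m x ν) q) w + (n - 1 : ℕ) *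
        confSlope m (x w.2 p) N := rfl
    rw [e1, htr, hsN, hH]
    change _ * c₀ = _
    ring
  · have hsc : (∃ c : ℝ, shape (chartFun x q) (chartFun (euclNormal m x ν) q) w =
        c • ContinuousLinearMap.id ℝ (E (n - 1))) ↔
        ∃ c : ℝ, P ∘L M = c • ContinuousLinearMap.id ℝ (E (n - 1)) := by
      rw [hshape]
      constructor
      · rintro ⟨c, hc⟩
        refine ⟨c₀⁻¹ * c, ?_⟩
        ext1 η
        have h1 := DFunLike.congr_fun hc (A.symm η)
        simp only [_root_.smul_apply, ContinuousLinearMap.comp_apply, ContinuousLinearMap.id_apply,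
          ContinuousLinearEquiv.coe_coe, ContinuousLinearEquiv.apply_symm_apply] at h1
        have h2 := congrArg A h1
        simp only [map_smul, ContinuousLinearEquiv.apply_symm_apply] at h2
        simp only [_root_.smul_apply, ContinuousLinearMap.comp_apply, ContinuousLinearMap.id_apply]
        rw [mul_smul, ← h2, inv_smul_smul₀ hcpos.ne']
      · rintro ⟨c, hc⟩
        refine ⟨c₀ * c, ?_⟩
        rw [hc]
        ext1 η
        simp [mul_smul]
    rw [hsc]
    constructor
    · rintro ⟨c, hc⟩
      refine ⟨c - s, ?_⟩
      ext1 v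
      apply had.injective
      rw [← sub_eq_zero, ← map_sub]
      -- Testing the umbilicity relation against this very difference shows that its image under `L`
      -- has zero norm.
      set v' := (P ∘L M) v - ((c - s) • ContinuousLinearMap.id ℝ (E (n - 1))) v with hv'
      have h1 := hc v v'
      rw [hII, hI, hPM] at h1
      have h2 : (inner ℝ (L v') (L v') : ℝ) = 0 := by
        have h3 : L v' = L (P (M v)) - (c - s) • L v := by
          rw [hv', map_sub]; simp
        conv_lhs => arg 2; rw [h3]
        rw [inner_sub_left, real_inner_smul_left]
        have h4 : c₀ ^ 2 ≠ 0 := by positivity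
        have h5 := mul_left_cancel₀ h4 (h1.trans (mul_left_comm _ _ _))
        linarith
      exact inner_self_eq_zero.mp h2
    · rintro ⟨c, hc⟩
      refine ⟨c + s, fun v v' => ?_⟩
      have h1 : P (M v) = c • v := DFunLike.congr_fun hc v
      rw [hII, hI, hPM, h1, map_smul, real_inner_smul_left]
      ring

/-- The densities of the area and of the weighted mean curvature in the chart at `q`. -/
theorem chart_densities (h : IsSmoothIMCF m T x ν Ω) (hn : 3 ≤ n) (hm : 0 < m) (q : S)
    {w : E (n - 1) × ℝ} (hw : w ∈ chartDom n T q) :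
    areaDensity m (x w.2) q w.1 = areaDens m (chartFun x q) w ∧
    potential m (x w.2 ((chartAt (E (n - 1)) q).symm w.1)) *
      meanCurvature m (x w.2) (ν w.2) ((chartAt (E (n - 1)) q).symm w.1) *
      areaDensity m (x w.2) q w.1 =
      weightDens m (chartFun x q) (chartFun (euclNormal m x ν) q) w := by
  have ht : w.2 ∈ Ico 0 T := ⟨hw.2.1.le, hw.2.2⟩
  have hflow := h.localFlow hn hm q
  have hXd := hasFDerivAt_slice (diffAt hflow.isOpen hflow.smooth hw)
  have h1 : areaDensity m (x w.2) q w.1 = areaDens m (chartFun x q) w := by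
    have e1 : fderiv ℝ (fun y => x w.2 ((chartAt (E (n - 1)) q).symm y)) w.1 =
      zD (chartFun x q) w := hXd.fderiv
    have e2 : (Matrix.of fun a b : Fin (n - 1) =>
        metric m (x w.2 ((chartAt (E (n - 1)) q).symm w.1))
          (zD (chartFun x q) w (EuclideanSpace.single a 1))
          (zD (chartFun x q) w (EuclideanSpace.single b 1))) =
        conf m (chartFun x q w) ^ 2 • gram (zD (chartFun x q) w) := by
      ext a b; exact metric_eq hm _ _
    have hc : 0 < conf m (chartFun x q w) := conf_pos hm
    simp only [areaDensity]
    rw [e1, e2, Matrix.det_smul, Fintype.card_fin, ← pow_mul, mul_comm 2, pow_mul,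
      Real.sqrt_mul (sq_nonneg _), Real.sqrt_sq (by positivity)]
    rfl
  refine ⟨h1, ?_⟩
  have h2 := (h.chart_geometry hn hm q hw).1
  have hu : 0 < potentialU m (chartFun x q w) := potentialU_pos hm
  rw [h1, weightDens, ← h2, areaDens, conf_pow hn hm (by omega),
    potential_eq hn hm (h.mem_interior ht _)]
  simp only [chartFun] at hu ⊢
  field_simp

/-- Because `ν = c⁻¹ N`, the law `∂_t x = ν / H` has Euclidean speed `1 / (c H)`, while `confMean`
is `c H`. -/
theorem speed_mul_confMean (h : IsSmoothIMCF m T x ν Ω) (hn : 3 ≤ n) (hm : 0 < m) (q : S)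
    {w : E (n - 1) × ℝ} (hw : w ∈ chartDom n T q) :
    0 < confMean m (chartFun x q) (chartFun (euclNormal m x ν) q) w ∧
    chartSpeed m x ν q w * confMean m (chartFun x q) (chartFun (euclNormal m x ν) q) w = 1 := by
  have ht : w.2 ∈ Ico 0 T := ⟨hw.2.1.le, hw.2.2⟩
  have hH := h.meanCurvature_pos w.2 ht ((chartAt (E (n - 1)) q).symm w.1)
  have hc : 0 < conf m (chartFun x q w) := conf_pos hm
  have h2 := (h.chart_geometry hn hm q hw).1
  have h3 := h.inner_normal hm ht ((chartAt (E (n - 1)) q).symm w.1)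
  have h4 : chartFun ν q w = (conf m (chartFun x q w))⁻¹ • chartFun (euclNormal m x ν) q w := by
    simp only [chartFun, euclNormal] at hc ⊢
    rw [inv_smul_smul₀ hc.ne']
  refine ⟨by rw [← h2]; positivity, ?_⟩
  rw [← h2, chartSpeed, h.tD_chartFun q hw, h4, real_inner_smul_left, real_inner_smul_left,
    show (inner ℝ (chartFun (euclNormal m x ν) q w) (chartFun (euclNormal m x ν) q w) : ℝ) = 1
      from h3]
  field_simp

end IsSmoothIMCF

end Flow

/-! ### Integration over the hypersurface in charts -/

section Weights

variable {n : ℕ} {S : Type*} [TopologicalSpace S] [ChartedSpace (E (n - 1)) S]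
  [T2Space S] [CompactSpace S] [IsManifold (𝓡 (n - 1)) ∞ S]

variable (n) in
/-- The partition function at `q` in the chart at `q`, extended by zero. -/
def chartWeight (q : S) : E (n - 1) → ℝ :=
  (chartAt (E (n - 1)) q).target.indicator
    fun z => partition n S q ((chartAt (E (n - 1)) q).symm z)

/-- The integral over `S` of a family of densities in the charts. -/
def chartIntegral (g : S → E (n - 1) → ℝ) : ℝ :=
  ∑ᶠ q : S, ∫ z, chartWeight n q z * g q z

theorem tsupport_partition_subset (q : S) :
    tsupport (partition n S q) ⊆ (chartAt (E (n - 1)) q).source :=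
  (SmoothPartitionOfUnity.exists_isSubordinate_chartAt_source (𝓡 (n - 1)) S).choose_spec q

variable (n S) in
theorem finite_partition_support : {q : S | (Function.support (partition n S q)).Nonempty}.Finite :=
  (partition n S).locallyFinite.finite_nonempty_of_compact

variable (n S) in
/-- The finite set of indices of nonzero partition functions. -/
def partitionIndex : Finset S := (finite_partition_support n S).toFinset

theorem partition_eq_zero {q : S} (hq : q ∉ partitionIndex n S) (p : S) :
    partition n S q p = 0 := by
  by_contra h
  exact hq ((finite_partition_support n S).mem_toFinset.mpr ⟨p, h⟩)

theorem sum_partition (p : S) : ∑ q ∈ partitionIndex n S, partition n S q p = 1 := by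
  rw [← (partition n S).sum_eq_one (mem_univ p)]
  refine (finsum_eq_sum_of_support_subset _ fun q hq => ?_).symm
  by_contra h
  exact hq (partition_eq_zero h p)

theorem chartWeight_eq_zero {q : S} (hq : q ∉ partitionIndex n S) (z : E (n - 1)) :
    chartWeight n q z = 0 := by
  by_cases hz : z ∈ (chartAt (E (n - 1)) q).target
  · rw [chartWeight, indicator_of_mem hz, partition_eq_zero hq]
  · rw [chartWeight, indicator_of_notMem hz]

theorem chartIntegral_eq_sum (g : S → E (n - 1) → ℝ) :
    chartIntegral g = ∑ q ∈ partitionIndex n S, ∫ z, chartWeight n q z * g q z := by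
  refine finsum_eq_sum_of_support_subset _ fun q hq => ?_
  by_contra h
  exact hq (by simp [chartWeight_eq_zero h])

theorem integral_chartWeight (q : S) (g : E (n - 1) → ℝ) :
    ∫ z, chartWeight n q z * g z = ∫ z in (chartAt (E (n - 1)) q).target,
      partition n S q ((chartAt (E (n - 1)) q).symm z) * g z := by
  rw [← integral_indicator (chartAt (E (n - 1)) q).open_target.measurableSet]
  congr 1; ext z
  by_cases hz : z ∈ (chartAt (E (n - 1)) q).target <;> simp [chartWeight, hz]

theorem surfaceIntegral_eq (m : ℝ) (x : S → E n) (F : S → ℝ) :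
    surfaceIntegral m x F = chartIntegral fun q z =>
      F ((chartAt (E (n - 1)) q).symm z) * areaDensity m x q z := by
  refine finsum_congr fun q => ?_
  rw [integral_chartWeight]
  simp only [mul_assoc]

variable (n) in
/-- A compact set carrying the weight at `q`. -/
def chartSupport (q : S) : Set (E (n - 1)) :=
  chartAt (E (n - 1)) q '' tsupport (partition n S q)

theorem isCompact_chartSupport (q : S) : IsCompact (chartSupport n q) :=
  (isClosed_tsupport _).isCompact.image_of_continuousOn
    ((chartAt (E (n - 1)) q).continuousOn.mono (tsupport_partition_subset q))

theorem chartSupport_subset (q : S) : chartSupport n q ⊆ (chartAt (E (n - 1)) q).target := by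
  rintro _ ⟨p, hp, rfl⟩
  exact (chartAt (E (n - 1)) q).map_source (tsupport_partition_subset q hp)

theorem chartWeight_of_notMem {q : S} {z : E (n - 1)} (hz : z ∉ chartSupport n q) :
    chartWeight n q z = 0 := by
  by_cases h : z ∈ (chartAt (E (n - 1)) q).target
  · rw [chartWeight, indicator_of_mem h]
    by_contra h0
    exact hz ⟨_, subset_tsupport _ h0, (chartAt (E (n - 1)) q).right_inv h⟩
  · rw [chartWeight, indicator_of_notMem h]

theorem tsupport_chartWeight_subset (q : S) : tsupport (chartWeight n q) ⊆ chartSupport n q :=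
  closure_minimal (fun z hz => by
    by_contra h
    exact hz (chartWeight_of_notMem h)) (isCompact_chartSupport q).isClosed

theorem hasCompactSupport_chartWeight (q : S) : HasCompactSupport (chartWeight n q) :=
  (isCompact_chartSupport q).of_isClosed_subset (isClosed_tsupport _)
    (tsupport_chartWeight_subset q)

theorem chartWeight_nonneg (q : S) (z : E (n - 1)) : 0 ≤ chartWeight n q z :=
  indicator_nonneg (fun _ _ => (partition n S).nonneg q _) z

/-- The partition function has compact support inside the chart domain, so extending by zero creates
no singularity at the edge of the target. -/
theorem contDiff_chartWeight (q : S) : ContDiff ℝ ∞ (chartWeight n q) := by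
  rw [contDiff_iff_contDiffAt]
  intro z
  by_cases hz : z ∈ (chartAt (E (n - 1)) q).target
  · have h1 : ContMDiffOn 𝓘(ℝ, E (n - 1)) (𝓡 (n - 1)) ∞ (chartAt (E (n - 1)) q).symm
      (chartAt (E (n - 1)) q).target := contMDiffOn_chart_symm
    have h2 := (partition n S q).contMDiff.comp_contMDiffOn h1
    have h3 := (contMDiffOn_iff_contDiffOn.mp h2).contDiffAt
      ((chartAt (E (n - 1)) q).open_target.mem_nhds hz)
    refine h3.congr_of_eventuallyEq ?_
    filter_upwards [(chartAt (E (n - 1)) q).open_target.mem_nhds hz] with y hy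
    rw [chartWeight, indicator_of_mem hy]; rfl
  · have h1 : (chartSupport n q)ᶜ ∈ nhds z :=
      (isCompact_chartSupport q).isClosed.isOpen_compl.mem_nhds fun h =>
        hz (chartSupport_subset q h)
    refine (contDiffAt_const (c := (0 : ℝ))).congr_of_eventuallyEq ?_
    filter_upwards [h1] with y hy using chartWeight_of_notMem hy

end Weights

/-- A function that is continuous on an open set, multiplied by one that is supported there. -/
theorem continuous_mul_of_tsupport_subset {V : Type*} [TopologicalSpace V] {f g : V → ℝ} {U : Set V}
    (hU : IsOpen U) (hf : Continuous f) (hfU : tsupport f ⊆ U) (hg : ContinuousOn g U) :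
    Continuous fun z => f z * g z := by
  rw [continuous_iff_continuousAt]
  intro z
  by_cases hz : z ∈ U
  · exact hf.continuousAt.mul (hg.continuousAt (hU.mem_nhds hz))
  · have h1 : (tsupport f)ᶜ ∈ nhds z :=
      (isClosed_tsupport f).isOpen_compl.mem_nhds fun h => hz (hfU h)
    refine (continuousAt_const (y := (0 : ℝ))).congr ?_
    filter_upwards [h1] with y hy
    rw [image_eq_zero_of_notMem_tsupport hy, zero_mul]

/-! ### Linearity, positivity and time derivatives of integrals over the hypersurface. -/

section Integrals

variable {n : ℕ} {S : Type*} [TopologicalSpace S] [ChartedSpace (E (n - 1)) S]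
  [T2Space S] [CompactSpace S] [IsManifold (𝓡 (n - 1)) ∞ S]

theorem integrable_chartWeight_mul (q : S) {g : E (n - 1) → ℝ}
    (hg : ContinuousOn g (chartAt (E (n - 1)) q).target) :
    Integrable fun z => chartWeight n q z * g z :=
  (continuous_mul_of_tsupport_subset (chartAt (E (n - 1)) q).open_target
    (contDiff_chartWeight q).continuous
    ((tsupport_chartWeight_subset q).trans (chartSupport_subset q)) hg).integrable_of_hasCompactSupport
    (hasCompactSupport_chartWeight q).mul_right

theorem chartIntegral_congr {g g' : S → E (n - 1) → ℝ}
    (h : ∀ q, ∀ z ∈ (chartAt (E (n - 1)) q).target, g q z = g' q z) :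
    chartIntegral g = chartIntegral g' := by
  refine finsum_congr fun q => integral_congr_ae (Filter.Eventually.of_forall fun z => ?_)
  by_cases hz : z ∈ (chartAt (E (n - 1)) q).target
  · simp only [h q z hz]
  · simp [chartWeight, hz]

theorem chartIntegral_add {g g' : S → E (n - 1) → ℝ}
    (hg : ∀ q, ContinuousOn (g q) (chartAt (E (n - 1)) q).target)
    (hg' : ∀ q, ContinuousOn (g' q) (chartAt (E (n - 1)) q).target) :
    chartIntegral (fun q z => g q z + g' q z) = chartIntegral g + chartIntegral g' := by
  simp only [chartIntegral_eq_sum, ← Finset.sum_add_distrib]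
  refine Finset.sum_congr rfl fun q _ => ?_
  rw [← integral_add (integrable_chartWeight_mul q (hg q)) (integrable_chartWeight_mul q (hg' q))]
  simp only [mul_add]

theorem chartIntegral_const_mul (c : ℝ) (g : S → E (n - 1) → ℝ) :
    chartIntegral (fun q z => c * g q z) = c * chartIntegral g := by
  simp only [chartIntegral_eq_sum, Finset.mul_sum]
  refine Finset.sum_congr rfl fun q _ => ?_
  rw [← integral_const_mul]
  simp only [mul_left_comm]

theorem chartIntegral_nonneg {g : S → E (n - 1) → ℝ}
    (hg : ∀ q, ∀ z ∈ (chartAt (E (n - 1)) q).target, 0 ≤ g q z) : 0 ≤ chartIntegral g := by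
  rw [chartIntegral_eq_sum]
  refine Finset.sum_nonneg fun q _ => integral_nonneg fun z => ?_
  by_cases hz : z ∈ (chartAt (E (n - 1)) q).target
  · exact mul_nonneg (chartWeight_nonneg q z) (hg q z hz)
  · simp [chartWeight, hz]

/-- A family of nonnegative continuous densities with vanishing integral vanishes where the
partition functions do not. -/
theorem eq_zero_of_chartIntegral_eq_zero {g : S → E (n - 1) → ℝ}
    (hc : ∀ q, ContinuousOn (g q) (chartAt (E (n - 1)) q).target)
    (hg : ∀ q, ∀ z ∈ (chartAt (E (n - 1)) q).target, 0 ≤ g q z) (h0 : chartIntegral g = 0)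
    (q : S) {z : E (n - 1)} (hz : chartWeight n q z ≠ 0) : g q z = 0 := by
  have hpos : ∀ q : S, 0 ≤ fun z => chartWeight n q z * g q z := fun q z => by
    by_cases hz : z ∈ (chartAt (E (n - 1)) q).target
    · exact mul_nonneg (chartWeight_nonneg q z) (hg q z hz)
    · simp [chartWeight, hz]
  have hq : q ∈ partitionIndex n S := by
    by_contra h; exact hz (chartWeight_eq_zero h z)
  rw [chartIntegral_eq_sum, Finset.sum_eq_zero_iff_of_nonneg fun q _ => integral_nonneg (hpos q)] at h0
  have hcont := continuous_mul_of_tsupport_subset (chartAt (E (n - 1)) q).open_target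
    (contDiff_chartWeight q).continuous
    ((tsupport_chartWeight_subset q).trans (chartSupport_subset q)) (hc q)
  have h1 := (hcont.integral_pos_of_hasCompactSupport_nonneg_nonzero (μ := volume)
    (hasCompactSupport_chartWeight q).mul_right (hpos q) (x := z))
  by_contra hne
  exact (h1 (mul_ne_zero hz hne)).ne' (h0 q hq)

/-- Every point lies in the support of some partition function. -/
theorem exists_chartWeight_ne_zero (p : S) :
    ∃ q : S, p ∈ (chartAt (E (n - 1)) q).source ∧ chartWeight n q (chartAt (E (n - 1)) q p) ≠ 0 := by
  have : ∃ q ∈ partitionIndex n S, partition n S q p ≠ 0 := by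
    apply Finset.exists_ne_zero_of_sum_ne_zero
    rw [sum_partition]; exact one_ne_zero
  obtain ⟨q, -, hq⟩ := this
  have hs : p ∈ (chartAt (E (n - 1)) q).source := tsupport_partition_subset q (subset_tsupport _ hq)
  refine ⟨q, hs, ?_⟩
  rw [chartWeight, indicator_of_mem ((chartAt (E (n - 1)) q).map_source hs),
    (chartAt (E (n - 1)) q).left_inv hs]
  exact hq

theorem chartIntegral_pos [Nonempty S] {g : S → E (n - 1) → ℝ}
    (hc : ∀ q, ContinuousOn (g q) (chartAt (E (n - 1)) q).target)
    (hg : ∀ q, ∀ z ∈ (chartAt (E (n - 1)) q).target, 0 < g q z) : 0 < chartIntegral g := by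
  refine lt_of_le_of_ne (chartIntegral_nonneg fun q z hz => (hg q z hz).le) fun h => ?_
  obtain ⟨q, hs, hq⟩ := exists_chartWeight_ne_zero (n := n) (Classical.arbitrary S)
  exact (hg q _ ((chartAt (E (n - 1)) q).map_source hs)).ne'
    (eq_zero_of_chartIntegral_eq_zero hc (fun q z hz => (hg q z hz).le) h.symm q hq)

/-- Differentiation under the integral sign. -/
theorem hasDerivAt_chartIntegral {T : ℝ} {g : S → E (n - 1) × ℝ → ℝ}
    (hg : ∀ q, ContDiffOn ℝ ∞ (g q) (chartDom n T q)) {t : ℝ} (ht : t ∈ Ioo 0 T) :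
    HasDerivAt (fun s => chartIntegral fun q z => g q (z, s))
      (chartIntegral fun q z => tD (g q) (z, t)) t := by
  simp only [chartIntegral_eq_sum]
  refine HasDerivAt.fun_sum fun q _ => ?_
  obtain ⟨ε, hε, hball⟩ := Metric.nhds_basis_closedBall.mem_iff.mp (isOpen_Ioo.mem_nhds ht)
  have hO := isOpen_chartDom (n := n) T q
  have htD := (ContDiffOn.tD hO (hg q)).continuousOn
  -- A single constant bounds the time derivative on this compact set. Outside it in space the
  -- weight vanishes, so the weight times that constant dominates.
  have hcomp : IsCompact (chartSupport n q ×ˢ closedBall t ε) :=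
    (isCompact_chartSupport q).prod (isCompact_closedBall t ε)
  obtain ⟨C, hC⟩ := hcomp.exists_bound_of_continuousOn
    (htD.mono (prod_mono (chartSupport_subset q) hball))
  have hslice : ∀ s ∈ Ioo 0 T, ∀ f : E (n - 1) × ℝ → ℝ, ContinuousOn f (chartDom n T q) →
      ContinuousOn (fun z => f (z, s)) (chartAt (E (n - 1)) q).target := fun s hs f hf =>
    hf.comp (by fun_prop) fun z hz => ⟨hz, hs⟩
  have hint : ∀ s ∈ Ioo 0 T, Integrable fun z => chartWeight n q z * g q (z, s) := fun s hs =>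
    integrable_chartWeight_mul q (hslice s hs _ (hg q).continuousOn)
  refine (hasDerivAt_integral_of_dominated_loc_of_deriv_le
    (F := fun s z => chartWeight n q z * g q (z, s))
    (F' := fun s z => chartWeight n q z * tD (g q) (z, s))
    (bound := fun z => chartWeight n q z * C) (Metric.ball_mem_nhds t hε) ?_ (hint t ht)
    (integrable_chartWeight_mul q (hslice t ht _ htD)).aestronglyMeasurable ?_
    (integrable_chartWeight_mul q continuousOn_const) ?_).2
  · filter_upwards [isOpen_Ioo.mem_nhds ht] with s hs using (hint s hs).aestronglyMeasurable
  · refine Filter.Eventually.of_forall fun z s hs => ?_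
    rw [norm_mul, Real.norm_of_nonneg (chartWeight_nonneg q z)]
    by_cases hz : z ∈ chartSupport n q
    · exact mul_le_mul_of_nonneg_left (hC _ ⟨hz, ball_subset_closedBall hs⟩)
        (chartWeight_nonneg q z)
    · simp [chartWeight_of_notMem hz]
  · refine Filter.Eventually.of_forall fun z s hs => ?_
    by_cases hz : z ∈ (chartAt (E (n - 1)) q).target
    · have hw : (z, s) ∈ chartDom n T q := ⟨hz, hball (ball_subset_closedBall hs)⟩
      have h2 : HasDerivAt (fun τ : ℝ => (z, τ)) ((0, 1) : E (n - 1) × ℝ) s :=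
        (hasDerivAt_const s z).prodMk (hasDerivAt_id s)
      exact (HasFDerivAt.comp_hasDerivAt (f := fun τ : ℝ => (z, τ)) s
        (diffAt hO (hg q) hw).hasFDerivAt h2).const_mul _
    · simp only [chartWeight, indicator_of_notMem hz, zero_mul]
      exact hasDerivAt_const _ _

end Integrals

/-! ### Independence of the charts and the divergence theorem on the hypersurface -/

section ChartChange

variable {n : ℕ} {S : Type*} [TopologicalSpace S] [ChartedSpace (E (n - 1)) S]

/-- The Euclidean area density in the chart at `q`. -/
def surfDens (X : S → E n) (q : S) (z : E (n - 1)) : ℝ :=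
  gramVol (fderiv ℝ (fun y => X ((chartAt (E (n - 1)) q).symm y)) z)

variable [IsManifold (𝓡 (n - 1)) ∞ S]

/-- Change of variables along the transition map: the Gram volume picks up exactly `|det Dτ|`.
Vanishing of `B` outside each chart reduces both integrals to the overlap. -/
theorem setIntegral_chart_eq {X : S → E n} (hX : MDifferentiable (𝓡 (n - 1)) 𝓘(ℝ, E n) X)
    (q r : S) {B : S → ℝ} (hq : ∀ p, p ∉ (chartAt (E (n - 1)) q).source → B p = 0)
    (hr : ∀ p, p ∉ (chartAt (E (n - 1)) r).source → B p = 0) :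
    ∫ z in (chartAt (E (n - 1)) q).target, B ((chartAt (E (n - 1)) q).symm z) * surfDens X q z =
    ∫ z in (chartAt (E (n - 1)) r).target, B ((chartAt (E (n - 1)) r).symm z) * surfDens X r z := by
  set eq := chartAt (E (n - 1)) q with heq
  set er := chartAt (E (n - 1)) r with her
  let τ := eq.symm.trans er
  have hτs : τ.source ⊆ eq.target := fun z hz => hz.1
  have hτt : τ.target ⊆ er.target := fun z hz => hz.1
  have hd : ∀ z ∈ τ.source, DifferentiableAt ℝ τ z := by
    intro z hz
    have h1 : MDifferentiableAt 𝓘(ℝ, E (n - 1)) (𝓡 (n - 1)) eq.symm z :=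
      ((mdifferentiable_chart (I := 𝓡 (n - 1)) q).symm).mdifferentiableAt hz.1
    have h2 : MDifferentiableAt (𝓡 (n - 1)) 𝓘(ℝ, E (n - 1)) er (eq.symm z) :=
      (mdifferentiable_chart (I := 𝓡 (n - 1)) r).mdifferentiableAt hz.2
    exact (h2.comp z h1).differentiableAt
  have hXd : ∀ (s : S), ∀ z ∈ (chartAt (E (n - 1)) s).target,
      DifferentiableAt ℝ (fun y => X ((chartAt (E (n - 1)) s).symm y)) z := fun s z hz => by
    obtain ⟨A, hA⟩ := exists_chart_differential s hz
    exact (hA X (hX _)).differentiableAt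
  have h1 : ∫ z in eq.target, B (eq.symm z) * surfDens X q z =
      ∫ z in τ.source, B (eq.symm z) * surfDens X q z := by
    refine setIntegral_eq_of_subset_of_forall_sdiff_eq_zero eq.open_target.measurableSet hτs ?_
    intro z hz
    have : B (eq.symm z) = 0 := hr _ fun h => hz.2 ⟨hz.1, h⟩
    rw [this, zero_mul]
  have h2 : ∫ z in er.target, B (er.symm z) * surfDens X r z =
      ∫ z in τ.target, B (er.symm z) * surfDens X r z := by
    refine setIntegral_eq_of_subset_of_forall_sdiff_eq_zero er.open_target.measurableSet hτt ?_
    intro z hz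
    have : B (er.symm z) = 0 := hq _ fun h => hz.2 ⟨hz.1, h⟩
    rw [this, zero_mul]
  rw [h1, h2, ← τ.image_source_eq_target, integral_image_eq_integral_abs_det_fderiv_smul volume
    τ.open_source.measurableSet (fun z hz => (hd z hz).hasFDerivAt.hasFDerivWithinAt) τ.injOn]
  refine setIntegral_congr_fun τ.open_source.measurableSet fun z hz => ?_
  have h3 : er.symm (τ z) = eq.symm z := er.left_inv hz.2
  have h4 : surfDens X q z = |(fderiv ℝ τ z).det| * surfDens X r (τ z) := by
    rw [surfDens, surfDens, ← gramVol_comp]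
    congr 1
    have h5 := (hXd r (τ z) (τ.map_source hz).1).hasFDerivAt.comp z (hd z hz).hasFDerivAt
    rw [← h5.fderiv]
    refine Filter.EventuallyEq.fderiv_eq ?_
    filter_upwards [τ.open_source.mem_nhds hz] with y hy
    exact congrArg X (er.left_inv hy.2).symm
  simp only [h3, h4, smul_eq_mul]
  ring

theorem continuous_of_charts {F : Type*} [TopologicalSpace F] {B : S → F}
    (hB : ∀ r : S, ContinuousOn (fun z => B ((chartAt (E (n - 1)) r).symm z))
      (chartAt (E (n - 1)) r).target) : Continuous B := by
  rw [continuous_iff_continuousAt]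
  intro p
  have hs := mem_chart_source (E (n - 1)) p
  have h1 := (hB p).continuousAt ((chartAt (E (n - 1)) p).open_target.mem_nhds
    ((chartAt (E (n - 1)) p).map_source hs))
  have h2 := ContinuousAt.comp (f := chartAt (E (n - 1)) p) (x := p) h1
    ((chartAt (E (n - 1)) p).continuousAt hs)
  refine h2.congr ?_
  filter_upwards [(chartAt (E (n - 1)) p).open_source.mem_nhds hs] with y hy
  exact congrArg B ((chartAt (E (n - 1)) p).left_inv hy)

variable [T2Space S] [CompactSpace S]

/-- An integral over one chart agrees with the integral defined by the partition of unity. -/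
theorem setIntegral_chart_eq_chartIntegral {X : S → E n}
    (hX : MDifferentiable (𝓡 (n - 1)) 𝓘(ℝ, E n) X)
    (hXc : ∀ r : S, ContinuousOn (surfDens X r) (chartAt (E (n - 1)) r).target)
    (q : S) {B : S → ℝ} (hB : Continuous B) (hq : tsupport B ⊆ (chartAt (E (n - 1)) q).source) :
    ∫ z in (chartAt (E (n - 1)) q).target, B ((chartAt (E (n - 1)) q).symm z) * surfDens X q z =
      chartIntegral fun r z => B ((chartAt (E (n - 1)) r).symm z) * surfDens X r z := by
  rw [chartIntegral_eq_sum]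
  have h1 : ∀ r : S, ∫ z, chartWeight n r z *
      (B ((chartAt (E (n - 1)) r).symm z) * surfDens X r z) =
      ∫ z in (chartAt (E (n - 1)) q).target,
        partition n S r ((chartAt (E (n - 1)) q).symm z) * B ((chartAt (E (n - 1)) q).symm z) *
          surfDens X q z := by
    intro r
    rw [integral_chartWeight]
    have h2 := setIntegral_chart_eq hX q r (B := fun p => partition n S r p * B p)
      (fun p hp => by
        rw [image_eq_zero_of_notMem_tsupport fun h => hp (hq h), mul_zero])
      (fun p hp => by
        rw [image_eq_zero_of_notMem_tsupport fun h => hp (tsupport_partition_subset r h), zero_mul])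
    rw [h2]
    simp only [mul_assoc]
  simp only [h1]
  rw [← integral_finsetSum]
  · refine integral_congr_ae (Filter.Eventually.of_forall fun z => ?_)
    simp only [mul_assoc]
    rw [← Finset.sum_mul, sum_partition, one_mul]
  · intro r _
    set K := chartAt (E (n - 1)) q '' tsupport B with hK
    have hKc : IsCompact K := (isClosed_tsupport B).isCompact.image_of_continuousOn
      ((chartAt (E (n - 1)) q).continuousOn.mono hq)
    have hKt : K ⊆ (chartAt (E (n - 1)) q).target := by
      rintro _ ⟨p, hp, rfl⟩; exact (chartAt (E (n - 1)) q).map_source (hq hp)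
    have hcs := (chartAt (E (n - 1)) q).symm.continuousOn
    have hcont : ContinuousOn (fun z => partition n S r ((chartAt (E (n - 1)) q).symm z) *
        B ((chartAt (E (n - 1)) q).symm z) * surfDens X q z) K :=
      ((((partition n S r).contMDiff.continuous.comp_continuousOn hcs).mul
        (hB.comp_continuousOn hcs)).mul (hXc q)).mono hKt
    refine IntegrableOn.of_forall_sdiff_eq_zero (hcont.integrableOn_compact hKc)
      (chartAt (E (n - 1)) q).open_target.measurableSet fun z hz => ?_
    have : B ((chartAt (E (n - 1)) q).symm z) = 0 := by
      by_contra h0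
      exact hz.2 ⟨_, subset_tsupport _ h0, (chartAt (E (n - 1)) q).right_inv hz.1⟩
    simp only [this, mul_zero, zero_mul]

end ChartChange

/-- Integration by parts against a divergence. -/
theorem integral_mul_tr_fderiv {k : ℕ} {f : E k → ℝ} {Y : E k → E k} {U : Set (E k)} (hU : IsOpen U)
    (hf : ContDiff ℝ ∞ f) (hfc : HasCompactSupport f) (hfU : tsupport f ⊆ U)
    (hY : ContDiffOn ℝ ∞ Y U) :
    ∫ z, f z * tr (E k) (fderiv ℝ Y z) = - ∫ z, fderiv ℝ f z (Y z) := by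
  have hYd : ∀ z ∈ U, DifferentiableAt ℝ Y z := fun z hz =>
    (hY.contDiffAt (hU.mem_nhds hz)).differentiableAt (by simp)
  have hYc : ∀ a, ContinuousOn (fun z => Y z a) U := fun a =>
    (EuclideanSpace.proj (𝕜 := ℝ) a).continuous.comp_continuousOn hY.continuousOn
  have hYa : ∀ a, ∀ z ∈ U, fderiv ℝ (fun y => Y y a) z = (EuclideanSpace.proj a) ∘L fderiv ℝ Y z :=
    fun a z hz => ((EuclideanSpace.proj (𝕜 := ℝ) a).hasFDerivAt.comp z (hYd z hz).hasFDerivAt).fderiv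
  have hDY : ∀ a, ContinuousOn (fun z => fderiv ℝ (fun y => Y y a) z (EuclideanSpace.single a 1)) U :=
    fun a => (((contDiff_const (c := EuclideanSpace.proj (𝕜 := ℝ) a)).contDiffOn.clm_comp
      (hY.fderiv_of_isOpen hU (m := ∞) (by simp))).clm_apply
      (contDiffOn_const (c := EuclideanSpace.single a (1 : ℝ)))).continuousOn.congr
      fun z hz => by simp only [hYa a z hz]
  have hDf : ∀ a : Fin k, Continuous fun z => fderiv ℝ f z (EuclideanSpace.single a (1 : ℝ)) :=
    fun a => (hf.continuous_fderiv (by simp)).clm_apply continuous_const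
  have hDfs : ∀ a : Fin k, tsupport (fun z => fderiv ℝ f z (EuclideanSpace.single a (1 : ℝ))) ⊆
      tsupport f := fun a => closure_minimal (fun z hz => by
    by_contra h
    apply hz
    have : fderiv ℝ f z = 0 := by
      by_contra h'
      exact h (support_fderiv_subset ℝ h')
    simp [this]) (isClosed_tsupport f)
  have hint : ∀ (g h : E k → ℝ), Continuous g → tsupport g ⊆ tsupport f → ContinuousOn h U →
      Integrable fun z => g z * h z := fun g h hg hgs hh =>
    (continuous_mul_of_tsupport_subset hU hg (hgs.trans hfU) hh).integrable_of_hasCompactSupport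
      (HasCompactSupport.mul_right (hfc.of_isClosed_subset (isClosed_tsupport g) hgs))
  have i1 := fun a => hint f _ hf.continuous subset_rfl (hDY a)
  have i2 := fun a => hint _ _ (hDf a) (hDfs a) (hYc a)
  have h1 : ∀ z, f z * tr (E k) (fderiv ℝ Y z) =
      ∑ a, f z * fderiv ℝ (fun y => Y y a) z (EuclideanSpace.single a 1) := by
    intro z
    by_cases hz : z ∈ U
    · rw [tr_euclidean, Finset.mul_sum]
      refine Finset.sum_congr rfl fun a _ => ?_
      rw [hYa a z hz]; rfl
    · have : f z = 0 := image_eq_zero_of_notMem_tsupport fun h => hz (hfU h)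
      simp [this]
  have h2 : ∀ z, fderiv ℝ f z (Y z) = ∑ a, fderiv ℝ f z (EuclideanSpace.single a 1) * Y z a := by
    intro z
    conv_lhs => rw [← single_sum (Y z)]
    simp [mul_comm]
  simp only [h1, h2]
  rw [integral_finsetSum _ fun a _ => i1 a, integral_finsetSum _ fun a _ => i2 a,
    ← Finset.sum_neg_distrib]
  refine Finset.sum_congr rfl fun a _ => ?_
  refine integral_mul_fderiv_eq_neg_fderiv_mul_of_integrable (i2 a) (i1 a)
    (hint f _ hf.continuous subset_rfl (hYc a))
    (fun z _ => (hf.differentiable (by simp)) z) fun z hz => ?_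
  exact (EuclideanSpace.proj (𝕜 := ℝ) a).differentiableAt.comp z (hYd z (hfU hz))

/-! ### Divergences integrate to zero over the closed hypersurface. -/

section Divergence

variable {n : ℕ} {S : Type*} [TopologicalSpace S] [ChartedSpace (E (n - 1)) S]
  [T2Space S] [CompactSpace S] [IsManifold (𝓡 (n - 1)) ∞ S] {m T : ℝ} {x ν : ℝ → S → E n}
  {Ω : ℝ → Set (E n)}

namespace IsSmoothIMCF

theorem dens_eq (h : IsSmoothIMCF m T x ν Ω) (q : S) {w : E (n - 1) × ℝ}
    (hw : w ∈ chartDom n T q) : dens (chartFun x q) w = surfDens (x w.2) q w.1 := by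
  rw [dens, surfDens]
  exact congrArg gramVol (hasFDerivAt_slice (diffAt (isOpen_chartDom T q)
    (contDiffOn_chartFun h.smooth q) hw)).fderiv.symm

theorem continuousOn_surfDens (h : IsSmoothIMCF m T x ν Ω) (hn : 3 ≤ n) (hm : 0 < m) {t : ℝ}
    (ht : t ∈ Ioo 0 T) (q : S) :
    ContinuousOn (surfDens (x t) q) (chartAt (E (n - 1)) q).target := by
  have h1 : ContinuousOn (fun z => dens (chartFun x q) (z, t)) (chartAt (E (n - 1)) q).target :=
    (h.localFlow hn hm q).smooth_dens.continuousOn.comp (f := fun z => (z, t)) (by fun_prop)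
      fun z hz => ⟨hz, ht⟩
  exact h1.congr fun z hz => (h.dens_eq q (w := (z, t)) ⟨hz, ht⟩).symm

/-- The divergence theorem on the closed hypersurface. -/
theorem chartIntegral_zdiv_eq_zero (h : IsSmoothIMCF m T x ν Ω) (hn : 3 ≤ n) (hm : 0 < m) {t : ℝ}
    (ht : t ∈ Ioo 0 T) {V : S → E n} {W : S → E (n - 1) × ℝ → E n}
    (hW : ∀ q, ContDiffOn ℝ ∞ (W q) (chartDom n T q))
    (hVW : ∀ q, ∀ z ∈ (chartAt (E (n - 1)) q).target,
      W q (z, t) = V ((chartAt (E (n - 1)) q).symm z)) :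
    chartIntegral (fun q z => zdiv (fun w => dens (chartFun x q) w •
      proj (chartFun x q) (chartFun (euclNormal m x ν) q) w (W q w)) (z, t)) = 0 := by
  have ht' : t ∈ Ico 0 T := ⟨ht.1.le, ht.2⟩
  have hXd : MDifferentiable (𝓡 (n - 1)) 𝓘(ℝ, E n) (x t) :=
    (contMDiffAt_slice h.smooth ht).mdifferentiable (by simp)
  have hcont := h.continuousOn_surfDens hn hm ht
  -- The derivative of the `q`-th partition function along the tangential part of `V`, as a function
  -- on `S` itself. Integration by parts in chart `q` yields minus its integral, and these functions
  -- sum to zero because the partition sums to one.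
  let β : S → S → ℝ := fun q p => diffCLM (n := n) (partition n S q) p
    (leftInv (diffCLM (n := n) (x t) p) (euclNormal m x ν t p) (V p))
  have hρd : ∀ q : S, MDifferentiable (𝓡 (n - 1)) 𝓘(ℝ, ℝ) (partition n S q) := fun q =>
    (partition n S q).contMDiff.mdifferentiable (by simp)
  -- the derivative of a partition function in any chart
  have hβ : ∀ q r : S, ∀ z ∈ (chartAt (E (n - 1)) r).target,
      fderiv ℝ (fun y => partition n S q ((chartAt (E (n - 1)) r).symm y)) z
        (proj (chartFun x r) (chartFun (euclNormal m x ν) r) (z, t) (W r (z, t))) =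
      β q ((chartAt (E (n - 1)) r).symm z) := by
    intro q r z hz
    obtain ⟨A, hA⟩ := exists_chart_differential r hz
    have hfl := h.localFlow hn hm r
    have hw : (z, t) ∈ chartDom n T r := ⟨hz, ht⟩
    have h1 : zD (chartFun x r) (z, t) = diffCLM (n := n) (x t) ((chartAt (E (n - 1)) r).symm z) ∘L
        (A : E (n - 1) →L[ℝ] E (n - 1)) :=
      (hasFDerivAt_slice (diffAt hfl.isOpen hfl.smooth hw)).unique (hA (x t) (hXd _))
    have had := h.adapted hn hm ht' ((chartAt (E (n - 1)) r).symm z)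
    have h2 := had.comp_equiv A
    rw [← h1] at h2
    rw [(hA _ (hρd q _)).fderiv, h2.unique (hfl.adapted hw).left_inv (hfl.adapted hw).ker,
      hVW r z hz]
    simp [β]
  have hβc : ∀ q, Continuous (β q) := by
    intro q
    refine continuous_of_charts (n := n) fun r => ?_
    have h1 : ContMDiffOn 𝓘(ℝ, E (n - 1)) (𝓡 (n - 1)) ∞ (chartAt (E (n - 1)) r).symm
      (chartAt (E (n - 1)) r).target := contMDiffOn_chart_symm
    have h2 := contMDiffOn_iff_contDiffOn.mp ((partition n S q).contMDiff.comp_contMDiffOn h1)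
    have h3 := (h2.fderiv_of_isOpen (chartAt (E (n - 1)) r).open_target (m := ∞)
      (by simp)).continuousOn
    have h4 : ContinuousOn (fun z => proj (chartFun x r) (chartFun (euclNormal m x ν) r) (z, t)
        (W r (z, t))) (chartAt (E (n - 1)) r).target :=
      ((h.localFlow hn hm r).smooth_proj.clm_apply (hW r)).continuousOn.comp
        (f := fun z => (z, t)) (by fun_prop) fun z hz => ⟨hz, ht⟩
    exact (h3.clm_apply h4).congr fun z hz => (hβ q r z hz).symm
  have hβs : ∀ q, tsupport (β q) ⊆ (chartAt (E (n - 1)) q).source := by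
    intro q
    refine (closure_minimal (fun p hp => ?_) (isClosed_tsupport (partition n S q))).trans
      (tsupport_partition_subset q)
    by_contra hne
    apply hp
    have h1 : diffCLM (n := n) (partition n S q) p = 0 := by
      have h2 : (partition n S q : S → ℝ) =ᶠ[nhds p] fun _ => 0 := by
        filter_upwards [(isClosed_tsupport (partition n S q)).isOpen_compl.mem_nhds hne] with y hy
        exact image_eq_zero_of_notMem_tsupport hy
      exact h2.mfderiv_eq.trans mfderiv_const
    simp only [β, h1]; rfl
  have hsum : ∀ p, ∑ q ∈ partitionIndex n S, β q p = 0 := by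
    intro p
    have h1 : ∑ q ∈ partitionIndex n S, diffCLM (n := n) (partition n S q) p = 0 := by
      obtain ⟨A, hA⟩ := exists_chart_differential p (mem_chart_target (E (n - 1)) p)
      rw [(chartAt (E (n - 1)) p).left_inv (mem_chart_source _ p)] at hA
      have h2 : HasFDerivAt (fun y => ∑ q ∈ partitionIndex n S,
          partition n S q ((chartAt (E (n - 1)) p).symm y)) _ (chartAt (E (n - 1)) p p) :=
        HasFDerivAt.fun_sum fun q _ => hA _ (hρd q p)
      simp only [sum_partition] at h2
      have h3 := h2.unique (hasFDerivAt_const 1 _)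
      ext1 η
      have h4 := DFunLike.congr_fun h3 (A.symm η)
      simpa [_root_.sum_apply] using h4
    have h2 := DFunLike.congr_fun h1
      (leftInv (diffCLM (n := n) (x t) p) (euclNormal m x ν t p) (V p))
    rw [_root_.sum_apply] at h2
    exact h2
  -- integration by parts in each chart
  have hchart : ∀ q : S, ∫ z, chartWeight n q z * zdiv (fun w => dens (chartFun x q) w •
      proj (chartFun x q) (chartFun (euclNormal m x ν) q) w (W q w)) (z, t) =
      - chartIntegral fun r z => β q ((chartAt (E (n - 1)) r).symm z) * surfDens (x t) r z := by
    intro q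
    have hfl := h.localFlow hn hm q
    have hY : ContDiffOn ℝ ∞ (fun w => dens (chartFun x q) w •
      proj (chartFun x q) (chartFun (euclNormal m x ν) q) w (W q w)) (chartDom n T q) :=
      hfl.smooth_dens.smul (hfl.smooth_proj.clm_apply (hW q))
    have hYs : ContDiffOn ℝ ∞ (fun z => dens (chartFun x q) (z, t) •
      proj (chartFun x q) (chartFun (euclNormal m x ν) q) (z, t) (W q (z, t)))
      (chartAt (E (n - 1)) q).target :=
      hY.comp (f := fun z => (z, t)) (contDiff_id.prodMk contDiff_const).contDiffOn
        fun z hz => ⟨hz, ht⟩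
    -- Chart independence replaces the integral over chart `q` by one common global integral, so
    -- that the sum over `q` can be taken under the integral.
    rw [← setIntegral_chart_eq_chartIntegral hXd hcont q (hβc q) (hβs q)]
    have h1 := integral_mul_tr_fderiv (chartAt (E (n - 1)) q).open_target (contDiff_chartWeight q)
      (hasCompactSupport_chartWeight q)
      ((tsupport_chartWeight_subset q).trans (chartSupport_subset q)) hYs
    have h2 : ∀ z, chartWeight n q z * zdiv (fun w => dens (chartFun x q) w •
        proj (chartFun x q) (chartFun (euclNormal m x ν) q) w (W q w)) (z, t) =
        chartWeight n q z * tr (E (n - 1)) (fderiv ℝ (fun z => dens (chartFun x q) (z, t) •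
        proj (chartFun x q) (chartFun (euclNormal m x ν) q) (z, t) (W q (z, t))) z) := by
      intro z
      by_cases hz : z ∈ (chartAt (E (n - 1)) q).target
      · rw [zdiv]
        congr 2
        exact (hasFDerivAt_slice (diffAt hfl.isOpen hY (w := (z, t)) ⟨hz, ht⟩)).fderiv.symm
      · simp [chartWeight, hz]
    simp only [h2]
    rw [h1, ← integral_indicator (chartAt (E (n - 1)) q).open_target.measurableSet]
    congr 1
    refine integral_congr_ae (Filter.Eventually.of_forall fun z => ?_)
    by_cases hz : z ∈ (chartAt (E (n - 1)) q).target
    · simp only [indicator_of_mem hz]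
      rw [← hβ q q z hz, ← h.dens_eq q (w := (z, t)) ⟨hz, ht⟩, map_smul, smul_eq_mul, mul_comm]
      congr 2
      refine Filter.EventuallyEq.fderiv_eq ?_
      filter_upwards [(chartAt (E (n - 1)) q).open_target.mem_nhds hz] with y hy
      rw [chartWeight, indicator_of_mem hy]
    · simp only [indicator_of_notMem hz]
      have : fderiv ℝ (chartWeight n q) z = 0 := by
        by_contra h'
        exact hz (chartSupport_subset q (tsupport_chartWeight_subset q
          (support_fderiv_subset ℝ h')))
      simp [this]
  rw [chartIntegral_eq_sum, Finset.sum_congr rfl fun q _ => hchart q, Finset.sum_neg_distrib,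
    neg_eq_zero]
  simp only [chartIntegral_eq_sum]
  rw [Finset.sum_comm]
  refine Finset.sum_eq_zero fun r _ => ?_
  rw [← integral_finsetSum]
  · refine integral_eq_zero_of_ae (Filter.Eventually.of_forall fun z => ?_)
    simp only [Pi.zero_apply]
    rw [← Finset.mul_sum, ← Finset.sum_mul, hsum, zero_mul, mul_zero]
  · intro q _
    exact integrable_chartWeight_mul r
      (((hβc q).comp_continuousOn (chartAt (E (n - 1)) r).symm.continuousOn).mul (hcont r))

end IsSmoothIMCF

end Divergence

/-! ### The divergence theorem for the enclosed domain -/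

/-- The open sets `B` and the complement of `K` cover the space; on the first the extension is `f`,
on the second it is zero. -/
theorem contDiff_indicator {V W : Type*} [NormedAddCommGroup V] [NormedSpace ℝ V]
    [NormedAddCommGroup W] [NormedSpace ℝ W] {f : V → W} {B K : Set V} (hB : IsOpen B)
    (hf : ContDiffOn ℝ ∞ f B) (hK : IsClosed K) (hKB : K ⊆ B) (h0 : ∀ z ∈ B, z ∉ K → f z = 0) :
    ContDiff ℝ ∞ (B.indicator f) := by
  rw [contDiff_iff_contDiffAt]
  intro z
  by_cases hz : z ∈ B
  · refine (hf.contDiffAt (hB.mem_nhds hz)).congr_of_eventuallyEq ?_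
    filter_upwards [hB.mem_nhds hz] with y hy using indicator_of_mem hy f
  · refine (contDiffAt_const (c := (0 : W))).congr_of_eventuallyEq ?_
    filter_upwards [hK.isOpen_compl.mem_nhds fun h => hz (hKB h)] with y hy
    by_cases hyB : y ∈ B
    · rw [indicator_of_mem hyB, h0 y hyB hy]
    · exact indicator_of_notMem hyB f

theorem hasCompactSupport_indicator {V W : Type*} [NormedAddCommGroup V]
    [NormedAddCommGroup W] {f : V → W} {B K : Set V} (hK : IsCompact K)
    (h0 : ∀ z ∈ B, z ∉ K → f z = 0) : HasCompactSupport (B.indicator f) :=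
  HasCompactSupport.intro hK fun z hz => by
    by_cases hzB : z ∈ B
    · rw [indicator_of_mem hzB, h0 z hzB hz]
    · exact indicator_of_notMem hzB f

theorem integral_tr_fderiv_eq_zero {k : ℕ} {Y : E k → E k} (hY : ContDiff ℝ ∞ Y)
    (hYc : HasCompactSupport Y) : ∫ z, tr (E k) (fderiv ℝ Y z) = 0 := by
  have hYd : Differentiable ℝ Y := hY.differentiable (by simp)
  have hYa : ∀ a z, fderiv ℝ (fun y => Y y a) z = (EuclideanSpace.proj a) ∘L fderiv ℝ Y z :=
    fun a z => ((EuclideanSpace.proj (𝕜 := ℝ) a).hasFDerivAt.comp z (hYd z).hasFDerivAt).fderiv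
  have hcont : ∀ a : Fin k, Continuous fun z => fderiv ℝ (fun y => Y y a) z
      (EuclideanSpace.single a (1 : ℝ)) := fun a => by
    simp only [hYa]
    exact (EuclideanSpace.proj (𝕜 := ℝ) a).continuous.comp
      ((hY.continuous_fderiv (by simp)).clm_apply continuous_const)
  have hcs : ∀ a : Fin k, HasCompactSupport fun y => Y y a := fun a =>
    hYc.comp_left (g := fun v : E k => v a) rfl
  have hint : ∀ a : Fin k, Integrable fun z => fderiv ℝ (fun y => Y y a) z
      (EuclideanSpace.single a (1 : ℝ)) := fun a =>
    (hcont a).integrable_of_hasCompactSupport ((hcs a).fderiv_apply ℝ _)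
  have h1 : ∀ z, tr (E k) (fderiv ℝ Y z) =
      ∑ a, fderiv ℝ (fun y => Y y a) z (EuclideanSpace.single a 1) := by
    intro z
    rw [tr_euclidean]
    exact Finset.sum_congr rfl fun a _ => by rw [hYa]; rfl
  simp only [h1]
  rw [integral_finsetSum _ fun a _ => hint a]
  refine Finset.sum_eq_zero fun a _ => ?_
  have hd : Differentiable ℝ fun y => Y y a :=
    (EuclideanSpace.proj (𝕜 := ℝ) a).differentiable.comp hYd
  have hia : Integrable fun y => Y y a := hd.continuous.integrable_of_hasCompactSupport (hcs a)
  have h2 := integral_mul_fderiv_eq_neg_fderiv_mul_of_integrable (μ := volume)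
    (f := fun y => Y y a) (g := fun _ : E k => (1 : ℝ)) (v := EuclideanSpace.single a (1 : ℝ))
    (by simpa using hint a) (by simp)
    (by simpa using hia)
    (fun z _ => hd z) (fun z _ => differentiableAt_const _)
  simp only [fderiv_fun_const, mul_one] at h2
  simpa using h2

/-- The divergence theorem on a half space, for fields of compact support. -/
theorem integral_half_space {k : ℕ} {G : E k × ℝ → ℝ} {Y : E k × ℝ → E k}
    (hG : ContDiff ℝ ∞ G) (hGc : HasCompactSupport G) (hY : ContDiff ℝ ∞ Y)
    (hYc : HasCompactSupport Y) (t : ℝ) :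
    ∫ w in univ ×ˢ Iio t, (tD G w + zdiv Y w) = ∫ z, G (z, t) := by
  have htD : Continuous (tD G) := (hG.continuous_fderiv (by simp)).clm_apply continuous_const
  have hzd : Continuous (zdiv Y) := (tr (E k)).continuous.comp
    ((hY.continuous_fderiv (by simp)).clm_comp continuous_const)
  have hi1 : Integrable (tD G) := htD.integrable_of_hasCompactSupport (hGc.fderiv_apply ℝ _)
  have hi2 : Integrable (zdiv Y) := hzd.integrable_of_hasCompactSupport
    ((hYc.fderiv ℝ).comp_left (g := fun A => tr (E k) (A ∘L ContinuousLinearMap.inl ℝ (E k) ℝ))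
      (by simp))
  have hslice : ∀ s : ℝ, HasCompactSupport fun z => Y (z, s) := fun s =>
    HasCompactSupport.intro (hYc.isCompact.image continuous_fst) fun z hz =>
      image_eq_zero_of_notMem_tsupport (f := Y) fun hw => hz ⟨_, hw, rfl⟩
  have hslice2 : ∀ z : E k, HasCompactSupport fun s : ℝ => G (z, s) := fun z =>
    HasCompactSupport.intro (hGc.isCompact.image continuous_snd) fun s hs =>
      image_eq_zero_of_notMem_tsupport (f := G) fun hw => hs ⟨_, hw, rfl⟩
  rw [integral_add hi1.integrableOn hi2.integrableOn]
  -- The half space is a union of full time slices, and on each the divergence of a compactly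
  -- supported field integrates to zero. The boundary term comes only from the time derivative.
  have h1 : ∫ w in univ ×ˢ Iio t, zdiv Y w = 0 := by
    rw [Measure.volume_eq_prod, ← Measure.prod_restrict, integral_prod_symm]
    · refine integral_eq_zero_of_ae (Filter.Eventually.of_forall fun s => ?_)
      have h2 : ∀ z, zdiv Y (z, s) = tr (E k) (fderiv ℝ (fun y => Y (y, s)) z) := fun z => by
        rw [zdiv, (hasFDerivAt_slice (w := (z, s)) (hY.differentiable (by simp) _)).fderiv]
      simp only [h2, Measure.restrict_univ, Pi.zero_apply]
      exact integral_tr_fderiv_eq_zero (hY.comp (contDiff_id.prodMk contDiff_const)) (hslice s)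
    · rw [Measure.prod_restrict]; exact hi2.integrableOn
  have h2 : ∫ w in univ ×ˢ Iio t, tD G w = ∫ z, G (z, t) := by
    rw [Measure.volume_eq_prod, setIntegral_prod _ hi1.integrableOn, Measure.restrict_univ]
    refine integral_congr_ae (Filter.Eventually.of_forall fun z => ?_)
    have h3 : ∀ s, tD G (z, s) = deriv (fun τ => G (z, τ)) s := fun s => by
      have h4 : HasDerivAt (fun τ : ℝ => (z, τ)) ((0, 1) : E k × ℝ) s :=
        (hasDerivAt_const s z).prodMk (hasDerivAt_id s)
      exact (HasFDerivAt.comp_hasDerivAt (f := fun τ : ℝ => (z, τ)) s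
        (hG.differentiable (by simp) _).hasFDerivAt h4).deriv.symm
    simp only [h3]
    rw [← integral_Iic_eq_integral_Iio]
    exact HasCompactSupport.integral_Iic_deriv_eq
      ((hG.comp (contDiff_const.prodMk contDiff_id)).of_le (by simp)) (hslice2 z) t
  rw [h1, h2, add_zero]

/-- The change of variables formula for a normal flow. -/
theorem LocalFlow.integral_image {k n : ℕ} {O : Set (E k × ℝ)} {X N : E k × ℝ → E n}
    {φ : E k × ℝ → ℝ} (h : LocalFlow O X N φ) {s : Set (E k × ℝ)} (hs : MeasurableSet s)
    (hsO : s ⊆ O) (hinj : InjOn X s) (g : E n → ℝ) :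
    ∫ y in X '' s, g y = ∫ w in s, |φ w| * dens X w * g (X w) := by
  have hdim : Module.finrank ℝ (WithLp 2 (E k × ℝ)) = n := by
    rw [(WithLp.linearEquiv 2 ℝ (E k × ℝ)).finrank_eq]; simp [h.dim]
  -- The product `E k × ℝ` carries the sup norm, so an orthonormal identification through the
  -- Euclidean product norm is inserted. It makes the differential an endomorphism with a
  -- determinant and preserves volume.
  let ι : WithLp 2 (E k × ℝ) ≃ₗᵢ[ℝ] E n :=
    ((stdOrthonormalBasis ℝ (WithLp 2 (E k × ℝ))).reindex (finCongr hdim)).repr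
  let j : E n ≃L[ℝ] E k × ℝ :=
    ι.symm.toContinuousLinearEquiv.trans (WithLp.prodContinuousLinearEquiv 2 ℝ (E k) ℝ)
  have hj : MeasurePreserving j := by
    have h1 : MeasurePreserving ι.symm := ι.symm.measurePreserving
    have h2 : MeasurePreserving (@WithLp.ofLp 2 (E k × ℝ)) := WithLp.volume_preserving_ofLp _ _
    exact h2.comp h1
  have hjι : ∀ v, j (ι (WithLp.toLp 2 v)) = v := fun v => by
    change WithLp.ofLp (ι.symm (ι (WithLp.toLp 2 v))) = v
    rw [LinearIsometryEquiv.symm_apply_apply]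
  have hd : ∀ y ∈ j ⁻¹' s, HasFDerivAt (fun y => X (j y))
      (fderiv ℝ X (j y) ∘L (j : E n →L[ℝ] E k × ℝ)) y := fun y hy =>
    (diffAt h.isOpen h.smooth (hsO hy)).hasFDerivAt.comp y j.hasFDerivAt
  have himg : X '' s = (fun y => X (j y)) '' (j ⁻¹' s) := by
    rw [← image_image X j, image_preimage_eq s j.surjective]
  have hinj' : InjOn (fun y => X (j y)) (j ⁻¹' s) := fun y hy y' hy' hyy =>
    j.injective (hinj hy hy' hyy)
  rw [himg, integral_image_eq_integral_abs_det_fderiv_smul volume (j.continuous.measurable hs)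
    (fun y hy => (hd y hy).hasFDerivWithinAt) hinj',
    ← hj.setIntegral_preimage_emb j.toHomeomorph.measurableEmbedding _ s]
  refine setIntegral_congr_fun (j.continuous.measurable hs) fun y hy => ?_
  have hdet := (h.adapted (hsO hy)).abs_det_coprod (φ (j y)) ι
    (fderiv ℝ X (j y) ∘L (j : E n →L[ℝ] E k × ℝ)) (by
      intro η s
      rw [ContinuousLinearMap.comp_apply, ContinuousLinearEquiv.coe_coe, hjι, zD_apply,
        show ((η, s) : E k × ℝ) = (η, 0) + s • (0, 1) by simp, map_add, map_smul]
      congr 2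
      exact h.flow _ (hsO hy))
  simp only [hdet, smul_eq_mul]
  rfl

/-- The local form of the divergence theorem, in terms of a box that the flow maps to one side. -/
theorem LocalFlow.integral_box {k n : ℕ} {O : Set (E k × ℝ)} {X N : E k × ℝ → E n}
    {φ : E k × ℝ → ℝ} (h : LocalFlow O X N φ) (hφ : ∀ w ∈ O, 0 < φ w) {B : Set (E k × ℝ)}
    (hB : IsOpen B) (hBO : B ⊆ O) (hinj : InjOn X B) {t : ℝ} {V : E n → E n} (hV : ContDiff ℝ ∞ V)
    {K : Set (E k × ℝ)} (hK : IsCompact K) (hKB : K ⊆ B) (hVK : ∀ w ∈ B, w ∉ K → V (X w) = 0) :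
    ∫ y in X '' (B ∩ univ ×ˢ Iio t), tr (E n) (fderiv ℝ V y) =
      ∫ z, B.indicator (fun w => dens X w * inner ℝ (V (X w)) (N w)) (z, t) := by
  set G : E k × ℝ → ℝ := fun w => dens X w * inner ℝ (V (X w)) (N w) with hG
  set Y : E k × ℝ → E k := fun w => dens X w • proj X N w (φ w • V (X w)) with hY
  have hVX : ContDiffOn ℝ ∞ (fun w => V (X w)) O := hV.comp_contDiffOn h.smooth
  have hGs : ContDiffOn ℝ ∞ G O := h.smooth_dens.mul (hVX.inner ℝ h.smooth_normal)
  have hYs : ContDiffOn ℝ ∞ Y O :=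
    h.smooth_dens.smul (h.smooth_proj.clm_apply (h.smooth_speed.smul hVX))
  have hG0 : ∀ z ∈ B, z ∉ K → G z = 0 := fun z hz hzK => by simp [hG, hVK z hz hzK]
  have hY0 : ∀ z ∈ B, z ∉ K → Y z = 0 := fun z hz hzK => by simp [hY, hVK z hz hzK]
  have hm : MeasurableSet (univ ×ˢ Iio t : Set (E k × ℝ)) := MeasurableSet.univ.prod measurableSet_Iio
  rw [h.integral_image (hB.measurableSet.inter hm) (inter_subset_left.trans hBO)
    (hinj.mono inter_subset_left), ← integral_half_space
    (contDiff_indicator hB (hGs.mono hBO) hK.isClosed hKB hG0)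
    (hasCompactSupport_indicator hK hG0)
    (contDiff_indicator hB (hYs.mono hBO) hK.isClosed hKB hY0)
    (hasCompactSupport_indicator hK hY0) t, eq_comm]
  refine (setIntegral_eq_of_subset_of_forall_sdiff_eq_zero hm inter_subset_right ?_).trans
    (setIntegral_congr_fun (hB.measurableSet.inter hm) ?_)
  · intro w hw
    have hwB : w ∉ B := fun hwB => hw.2 ⟨hwB, hw.1⟩
    have hnhds := hK.isClosed.isOpen_compl.mem_nhds fun h => hwB (hKB h)
    have e1 : B.indicator G =ᶠ[nhds w] fun _ => 0 := by
      filter_upwards [hnhds] with y hy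
      by_cases hyB : y ∈ B
      · rw [indicator_of_mem hyB, hG0 y hyB hy]
      · exact indicator_of_notMem hyB _
    have e2 : B.indicator Y =ᶠ[nhds w] fun _ => 0 := by
      filter_upwards [hnhds] with y hy
      by_cases hyB : y ∈ B
      · rw [indicator_of_mem hyB, hY0 y hyB hy]
      · exact indicator_of_notMem hyB _
    rw [tD, zdiv, zD, e1.fderiv_eq, e2.fderiv_eq]
    simp
  · intro w hw
    have hnhds := hB.mem_nhds hw.1
    have e1 : B.indicator G =ᶠ[nhds w] G := by
      filter_upwards [hnhds] with y hy using indicator_of_mem hy G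
    have e2 : B.indicator Y =ᶠ[nhds w] Y := by
      filter_upwards [hnhds] with y hy using indicator_of_mem hy Y
    -- The flux evolution is precisely `div V` times the Jacobian `φ · dens` of the space-time map,
    -- so the volume integral becomes a half-space integral.
    have h1 := h.flux_evolution (hBO hw.1) (V := V) (hV.differentiable (by simp) _)
    simp only [tD, zdiv, zD, e1.fderiv_eq, e2.fderiv_eq]
    rw [abs_of_pos (hφ w (hBO hw.1))]
    exact h1

/-! ### Flux through the hypersurface as a volume integral. -/

section Enclosed

variable {n : ℕ} {S : Type*} [TopologicalSpace S] [ChartedSpace (E (n - 1)) S]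

/-- The open set `D` is bounded by the hypersurface `x`, with `ν` pointing out of `D`. -/
structure Encloses {n : ℕ} {S : Type*} (x ν : S → E n) (D : Set (E n)) : Prop where
  isOpen : IsOpen D
  frontier_eq : frontier D = range x
  outward : ∀ p, ∃ ε > 0, ∀ s ∈ Ioo (0 : ℝ) ε, x p - s • ν p ∈ D ∧ x p + s • ν p ∉ closure D

/-- The flow is a local diffeomorphism of space-time onto the ambient space. -/
theorem LocalFlow.exists_localInverse {k n : ℕ} {O : Set (E k × ℝ)} {X N : E k × ℝ → E n}
    {φ : E k × ℝ → ℝ} (h : LocalFlow O X N φ) {w : E k × ℝ} (hw : w ∈ O) (hφ : φ w ≠ 0) :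
    ∃ e : OpenPartialHomeomorph (E k × ℝ) (E n), (e : E k × ℝ → E n) = X ∧ w ∈ e.source ∧
      HasDerivAt (fun s : ℝ => (e.symm (X w + s • N w)).2) (φ w)⁻¹ 0 := by
  have hf := diffAt h.isOpen h.smooth hw
  have hform : ∀ η s, fderiv ℝ X w (η, s) = zD X w η + (s * φ w) • N w := by
    intro η s
    rw [show ((η, s) : E k × ℝ) = (η, 0) + s • (0, 1) by simp, map_add, map_smul, mul_smul,
      ← h.flow w hw]
    rfl
  have hinj : Function.Injective (fderiv ℝ X w) := by
    rw [injective_iff_map_eq_zero]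
    rintro ⟨η, s⟩ h0
    rw [hform] at h0
    have h1 := congrArg (fun y => (inner ℝ (N w) y : ℝ)) h0
    simp only [inner_add_right, h.orthogonal w hw, inner_smul_right, h.unit w hw, inner_zero_right,
      zero_add, mul_one] at h1
    have hs : s = 0 := (mul_eq_zero.mp h1).resolve_right hφ
    rw [hs, zero_mul, zero_smul, add_zero] at h0
    rw [(injective_iff_map_eq_zero _).mp (h.immersion w hw) η h0, hs]
    rfl
  have hdim : Module.finrank ℝ (E k × ℝ) = Module.finrank ℝ (E n) := by simp [h.dim]
  let f' : (E k × ℝ) ≃L[ℝ] E n := (LinearEquiv.ofInjectiveOfFinrankEq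
    (fderiv ℝ X w).toLinearMap hinj hdim).toContinuousLinearEquiv
  have hf' : HasFDerivAt X (f' : E k × ℝ →L[ℝ] E n) w := by
    refine hf.hasFDerivAt.congr_fderiv ?_
    exact ContinuousLinearMap.ext fun v => rfl
  have hc : ContDiffAt ℝ ∞ X w := h.smooth.contDiffAt (h.isOpen.mem_nhds hw)
  let e := hc.toOpenPartialHomeomorph X hf' (by simp)
  have hmem : w ∈ e.source := hc.mem_toOpenPartialHomeomorph_source hf' (by simp)
  refine ⟨e, rfl, hmem, ?_⟩
  have hsymm : e.symm (X w) = w := e.left_inv hmem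
  have h1 : HasFDerivAt e.symm (f'.symm : E n →L[ℝ] E k × ℝ) (X w) :=
    e.hasFDerivAt_symm (e.map_source hmem) (by rw [hsymm]; exact hf')
  have h2 : HasDerivAt (fun s : ℝ => X w + s • N w) (N w) 0 := by
    simpa using ((hasDerivAt_id (0 : ℝ)).smul_const (N w)).const_add (X w)
  have h3 : HasFDerivAt e.symm (f'.symm : E n →L[ℝ] E k × ℝ) (X w + (0 : ℝ) • N w) := by
    simpa using h1
  have h4 := (ContinuousLinearMap.snd ℝ (E k) ℝ).hasFDerivAt.comp_hasDerivAt 0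
    (h3.comp_hasDerivAt 0 h2)
  -- Moving along the normal raises the time coordinate at rate `1 / φ`; this later distinguishes
  -- the two sides of the hypersurface.
  have h5 : f'.symm (N w) = (0, (φ w)⁻¹) := by
    rw [ContinuousLinearEquiv.symm_apply_eq]
    have : f' (0, (φ w)⁻¹) = fderiv ℝ X w (0, (φ w)⁻¹) := rfl
    rw [this, hform, inv_mul_cancel₀ hφ]; simp
  simp only [ContinuousLinearEquiv.coe_coe, h5, ContinuousLinearMap.coe_snd'] at h4
  exact h4

theorem eventually_lt_of_deriv_pos {f : ℝ → ℝ} {c : ℝ} (hf : HasDerivAt f c 0) (hc : 0 < c) :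
    (∀ᶠ s in nhdsWithin (0 : ℝ) (Ioi 0), f 0 < f s) ∧
      ∀ᶠ s in nhdsWithin (0 : ℝ) (Ioi 0), f (-s) < f 0 := by
  have key : ∀ {g : ℝ → ℝ} {b : ℝ}, HasDerivAt g b 0 → 0 < b →
      ∀ᶠ s in nhdsWithin (0 : ℝ) (Ioi 0), g 0 < g s := by
    intro g b hg hb
    filter_upwards [hg.tendsto_slope_zero_right.eventually (lt_mem_nhds hb), self_mem_nhdsWithin]
      with s hs hs0
    rw [zero_add, smul_eq_mul] at hs
    have := (pos_iff_pos_of_mul_pos hs).mp (inv_pos.mpr hs0)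
    linarith
  refine ⟨key hf hc, ?_⟩
  have h1 : HasDerivAt (fun s => - f (-s)) c 0 := by
    have h2 : HasDerivAt f c (-0) := by simpa using hf
    have h3 := (h2.comp (0 : ℝ) (hasDerivAt_neg (0 : ℝ))).neg
    rw [mul_neg_one, neg_neg] at h3
    exact h3
  filter_upwards [key h1 hc] with s hs
  simp only [neg_zero] at hs
  linarith

variable [T2Space S] [CompactSpace S] [IsManifold (𝓡 (n - 1)) ∞ S]

/-- The Euclidean flux of a vector field through the hypersurface. -/
def flux (m : ℝ) (x ν : ℝ → S → E n) (t : ℝ) (V : E n → E n) : ℝ :=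
  chartIntegral fun (q : S) z => inner ℝ (V (x t ((chartAt (E (n - 1)) q).symm z)))
    (euclNormal m x ν t ((chartAt (E (n - 1)) q).symm z)) * surfDens (x t) q z

variable {m T : ℝ} {x ν : ℝ → S → E n} {Ω : ℝ → Set (E n)}

namespace IsSmoothIMCF

theorem continuous_euclNormal (h : IsSmoothIMCF m T x ν Ω) (hm : 0 < m) {t : ℝ}
    (ht : t ∈ Ioo 0 T) : Continuous (euclNormal m x ν t) :=
  continuous_of_charts (n := n) fun r =>
    (h.contDiffOn_normal hm r).continuousOn.comp (f := fun z => (z, t)) (by fun_prop)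
      fun z hz => ⟨hz, ht⟩

/-- The flow straightens a neighbourhood of the point to a space-time box in which `D` is exactly
the set of earlier times. The half-space divergence theorem then applies to fields supported there.
-/
theorem exists_local_flux (h : IsSmoothIMCF m T x ν Ω) (hn : 3 ≤ n) (hm : 0 < m) {t : ℝ}
    (ht : t ∈ Ioo 0 T) {D : Set (E n)} (hD : Encloses (x t) (ν t) D) (p₀ : S) :
    ∃ W : Set (E n), IsOpen W ∧ x t p₀ ∈ W ∧ ∀ V : E n → E n, ContDiff ℝ ∞ V →
      HasCompactSupport V → tsupport V ⊆ W →
        flux m x ν t V = ∫ y in D, tr (E n) (fderiv ℝ V y) := by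
  have ht' : t ∈ Ico 0 T := ⟨ht.1.le, ht.2⟩
  set e₀ := chartAt (E (n - 1)) p₀ with he₀
  set z₀ := e₀ p₀ with hz₀
  set O := chartDom n T p₀ with hO
  have hfl := h.localFlow hn hm p₀
  have hz₀t : z₀ ∈ e₀.target := mem_chart_target _ p₀
  have hw₀ : (z₀, t) ∈ O := ⟨hz₀t, ht⟩
  have hφ : ∀ w ∈ O, 0 < chartSpeed m x ν p₀ w := fun w hw => by
    obtain ⟨h1, h2⟩ := h.speed_mul_confMean hn hm p₀ hw
    exact pos_of_mul_pos_left (h2 ▸ one_pos) h1.le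
  have hsymm₀ : e₀.symm z₀ = p₀ := e₀.left_inv (mem_chart_source _ p₀)
  obtain ⟨e, heX, hws, hder⟩ := hfl.exists_localInverse hw₀ (hφ _ hw₀).ne'
  have hX₀ : chartFun x p₀ (z₀, t) = x t p₀ := congrArg (x t) hsymm₀
  have hN₀ : chartFun (euclNormal m x ν) p₀ (z₀, t) = euclNormal m x ν t p₀ :=
    congrArg (euclNormal m x ν t) hsymm₀
  rw [hX₀, hN₀] at hder
  -- a box on which the flow is injective
  obtain ⟨r₁, hr₁, hball₁⟩ := Metric.isOpen_iff.mp (e.open_source.inter hfl.isOpen) _ ⟨hws, hw₀⟩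
  have hxc : Continuous (x t) := (contMDiffAt_slice h.smooth ht).continuous
  have hemb : Topology.IsClosedEmbedding (x t) := hxc.isClosedEmbedding (h.injective t ht')
  have hA : e₀.source ∩ e₀ ⁻¹' ball z₀ r₁ ∈ nhds p₀ := by
    refine Filter.inter_mem (e₀.open_source.mem_nhds (mem_chart_source _ p₀)) ?_
    exact (e₀.continuousAt (mem_chart_source _ p₀)).preimage_mem_nhds (ball_mem_nhds _ hr₁)
  -- The embedding property excludes other sheets: points of `Σ_t` close to `x t p₀` have parameters
  -- close to `p₀`.
  rw [hemb.isInducing.nhds_eq_comap p₀, Filter.mem_comap] at hA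
  obtain ⟨W₀, hW₀, hW₀A⟩ := hA
  have hXc : ContinuousAt (chartFun x p₀) (z₀, t) := by
    rw [← heX]; exact e.continuousAt hws
  have hW₀' : chartFun x p₀ ⁻¹' W₀ ∈ nhds (z₀, t) :=
    hXc.preimage_mem_nhds (by rw [hX₀]; exact hW₀)
  obtain ⟨r, hr, hball⟩ := Metric.mem_nhds_iff.mp
    (Filter.inter_mem (ball_mem_nhds ((z₀, t) : E (n - 1) × ℝ) hr₁) hW₀')
  set B := ball ((z₀, t) : E (n - 1) × ℝ) r with hB
  have hBe : B ⊆ e.source := fun w hw => (hball₁ (hball hw).1).1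
  have hBO : B ⊆ O := fun w hw => (hball₁ (hball hw).1).2
  have hBX : chartFun x p₀ '' B = e '' B := by rw [heX]
  have hinj : InjOn (chartFun x p₀) B := by
    rw [← heX]; exact e.injOn.mono hBe
  have hkey : ∀ w ∈ B, ∀ p, chartFun x p₀ w = x t p → w.2 = t ∧ p ∈ e₀.source ∧ e₀ p = w.1 := by
    intro w hw p hp
    have h1 : p ∈ e₀.source ∩ e₀ ⁻¹' ball z₀ r₁ := hW₀A (by
      change x t p ∈ W₀
      rw [← hp]; exact (hball hw).2)
    have h2 : (e₀ p, t) ∈ ball ((z₀, t) : E (n - 1) × ℝ) r₁ := by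
      rw [← ball_prod_same]; exact ⟨h1.2, mem_ball_self hr₁⟩
    have h3 : chartFun x p₀ (e₀ p, t) = x t p := congrArg (x t) (e₀.left_inv h1.1)
    have h4 : w = (e₀ p, t) := by
      refine e.injOn (hBe hw) (hball₁ h2).1 ?_
      rw [heX, hp, h3]
    exact ⟨by rw [h4], h1.1, by rw [h4]⟩
  set W := chartFun x p₀ '' B with hW
  have hWo : IsOpen W := by
    rw [hBX]; exact e.isOpen_image_of_subset_source isOpen_ball hBe
  have hpW : x t p₀ ∈ W := ⟨(z₀, t), mem_ball_self hr, hX₀⟩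
  -- the two sides of the hypersurface
  have hside : ∀ I : Set ℝ, Convex ℝ I → t ∉ I →
      (chartFun x p₀ '' (B ∩ univ ×ˢ I) ∩ D).Nonempty → chartFun x p₀ '' (B ∩ univ ×ˢ I) ⊆ D := by
    intro I hI htI hne
    have hpre : IsPreconnected (chartFun x p₀ '' (B ∩ univ ×ˢ I)) :=
      ((convex_ball _ _).inter (convex_univ.prod hI)).isPreconnected.image _
        (hfl.smooth.continuousOn.mono (inter_subset_left.trans hBO))
    refine hpre.subset_of_closure_inter_subset hD.isOpen hne ?_
    rintro _ ⟨hyc, w, hw, rfl⟩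
    by_contra hyD
    have : chartFun x p₀ w ∈ frontier D := by
      rw [frontier, hD.isOpen.interior_eq]; exact ⟨hyc, hyD⟩
    rw [hD.frontier_eq] at this
    obtain ⟨p, hp⟩ := this
    have h1 := (hkey w hw.1 p hp.symm).1
    exact htI (h1 ▸ hw.2.2)
  have hc₀ : 0 < conf m (x t p₀) := conf_pos hm
  have hνN : ∀ s : ℝ, s • ν t p₀ = (s * (conf m (x t p₀))⁻¹) • euclNormal m x ν t p₀ := by
    intro s; rw [euclNormal, smul_smul, mul_assoc, inv_mul_cancel₀ hc₀.ne', mul_one]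
  have hder' : HasDerivAt (fun s : ℝ => (e.symm (x t p₀ + s • ν t p₀)).2)
      ((chartSpeed m x ν p₀ (z₀, t))⁻¹ * (conf m (x t p₀))⁻¹) 0 := by
    simp only [hνN]
    have h1 : HasDerivAt (fun s : ℝ => s * (conf m (x t p₀))⁻¹) (conf m (x t p₀))⁻¹ 0 := by
      simpa using (hasDerivAt_id (0 : ℝ)).mul_const (conf m (x t p₀))⁻¹
    have h2 : HasDerivAt (fun s : ℝ => (e.symm (x t p₀ + s • euclNormal m x ν t p₀)).2)
      (chartSpeed m x ν p₀ (z₀, t))⁻¹ (0 * (conf m (x t p₀))⁻¹) := by simpa using hder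
    exact h2.comp (0 : ℝ) h1
  have hsymm : e.symm (x t p₀) = (z₀, t) := by
    rw [← hX₀, ← heX]; exact e.left_inv hws
  obtain ⟨hgt, hlt⟩ := eventually_lt_of_deriv_pos hder'
    (mul_pos (inv_pos.mpr (hφ _ hw₀)) (inv_pos.mpr hc₀))
  simp only [zero_smul, add_zero, hsymm] at hgt hlt
  obtain ⟨ε, hε, hout⟩ := hD.outward p₀
  have hWnear : ∀ c : ℝ, ∀ᶠ s in nhdsWithin (0 : ℝ) (Ioi 0), x t p₀ + (c * s) • ν t p₀ ∈ W := by
    intro c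
    have h1 : Filter.Tendsto (fun s : ℝ => x t p₀ + (c * s) • ν t p₀)
        (nhdsWithin (0 : ℝ) (Ioi 0)) (nhds (x t p₀)) := by
      have : Continuous fun s : ℝ => x t p₀ + (c * s) • ν t p₀ := by fun_prop
      have h2 := this.tendsto 0
      simp only [mul_zero, zero_smul, add_zero] at h2
      exact h2.mono_left nhdsWithin_le_nhds
    exact h1.eventually (hWo.mem_nhds hpW)
  have hpull : ∀ y ∈ W, e.symm y ∈ B ∧ chartFun x p₀ (e.symm y) = y := by
    rintro _ ⟨w, hw, rfl⟩
    have : e.symm (chartFun x p₀ w) = w := by rw [← heX]; exact e.left_inv (hBe hw)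
    rw [this]; exact ⟨hw, rfl⟩
  -- A short step along `-ν` lands in `D` at an earlier time, which decides the side. The outer side
  -- is excluded in the same way with `+ν`.
  have hminus : chartFun x p₀ '' (B ∩ univ ×ˢ Iio t) ⊆ D := by
    refine hside _ (convex_Iio t) (lt_irrefl t) ?_
    obtain ⟨s, hs1, hs2, hs3⟩ := (hlt.and ((hWnear (-1)).and (Ioo_mem_nhdsGT hε))).exists
    rw [neg_one_mul] at hs2
    obtain ⟨h1, h2⟩ := hpull _ hs2
    refine ⟨_, ⟨_, ⟨h1, mem_univ _, hs1⟩, h2⟩, ?_⟩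
    have := (hout s hs3).1
    rwa [neg_smul, ← sub_eq_add_neg]
  have hplus : ∀ w ∈ B, t < w.2 → chartFun x p₀ w ∉ D := by
    intro w hw hwt hwD
    have h1 := hside _ (convex_Ioi t) (lt_irrefl t) ⟨_, ⟨w, ⟨hw, mem_univ _, hwt⟩, rfl⟩, hwD⟩
    obtain ⟨s, hs1, hs2, hs3⟩ := (hgt.and ((hWnear 1).and (Ioo_mem_nhdsGT hε))).exists
    rw [one_mul] at hs2
    obtain ⟨h3, h2⟩ := hpull _ hs2
    exact (hout s hs3).2 (subset_closure (h1 ⟨_, ⟨h3, mem_univ _, hs1⟩, h2⟩))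
  refine ⟨W, hWo, hpW, fun V hV hVc hVW => ?_⟩
  -- the volume integral
  set K := e.symm '' tsupport V with hK
  have hKc : IsCompact K := hVc.isCompact.image_of_continuousOn
    (e.symm.continuousOn.mono fun y hy => by
      obtain ⟨w, hw, rfl⟩ := hVW hy
      rw [← heX]; exact e.map_source (hBe hw))
  have hKB : K ⊆ B := by
    rintro _ ⟨y, hy, rfl⟩; exact (hpull y (hVW hy)).1
  have hVK : ∀ w ∈ B, w ∉ K → V (chartFun x p₀ w) = 0 := by
    intro w hw hwK
    by_contra h0
    refine hwK ⟨_, subset_tsupport _ h0, ?_⟩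
    rw [← heX]; exact e.left_inv (hBe hw)
  have hvol : ∫ y in D, tr (E n) (fderiv ℝ V y) =
      ∫ y in chartFun x p₀ '' (B ∩ univ ×ˢ Iio t), tr (E n) (fderiv ℝ V y) := by
    refine setIntegral_eq_of_subset_of_forall_sdiff_eq_zero hD.isOpen.measurableSet hminus ?_
    intro y hy
    have : y ∉ tsupport V := by
      intro hyV
      obtain ⟨w, hw, rfl⟩ := hVW hyV
      rcases lt_trichotomy w.2 t with h1 | h1 | h1
      · exact hy.2 ⟨w, ⟨hw, mem_univ _, h1⟩, rfl⟩
      · have h2 : chartFun x p₀ w ∈ frontier D := by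
          rw [hD.frontier_eq, chartFun, h1]; exact mem_range_self _
        rw [frontier, hD.isOpen.interior_eq] at h2
        exact h2.2 hy.1
      · exact hplus w hw h1 hy.1
    have : fderiv ℝ V y = 0 := by
      by_contra h'
      exact this (support_fderiv_subset ℝ h')
    rw [this, map_zero]
  rw [hvol, hfl.integral_box hφ isOpen_ball hBO hinj hV hKc hKB hVK]
  -- the surface integral
  have hXd : MDifferentiable (𝓡 (n - 1)) 𝓘(ℝ, E n) (x t) :=
    (contMDiffAt_slice h.smooth ht).mdifferentiable (by simp)
  have hloc : ∀ p, V (x t p) ≠ 0 → p ∈ e₀.source ∧ (e₀ p, t) ∈ B := by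
    intro p hp
    obtain ⟨w, hw, hwp⟩ := hVW (subset_tsupport _ hp)
    obtain ⟨h1, h2, h3⟩ := hkey w hw p hwp
    refine ⟨h2, ?_⟩
    rw [h3, ← h1]; exact hw
  have hsupp : tsupport (fun p => inner ℝ (V (x t p)) (euclNormal m x ν t p)) ⊆ e₀.source := by
    refine (closure_minimal (fun p hp => ?_) ((isClosed_tsupport V).preimage hxc)).trans
      (fun p hp => ?_)
    · have : V (x t p) ≠ 0 := fun h0 => hp (by simp [h0])
      exact subset_tsupport _ this
    · obtain ⟨w, hw, hwp⟩ := hVW hp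
      exact (hkey w hw p hwp).2.1
  rw [flux, ← setIntegral_chart_eq_chartIntegral hXd (h.continuousOn_surfDens hn hm ht) p₀
    (B := fun p => inner ℝ (V (x t p)) (euclNormal m x ν t p))
    ((hV.continuous.comp hxc).inner (h.continuous_euclNormal hm ht)) hsupp,
    ← integral_indicator e₀.open_target.measurableSet]
  refine integral_congr_ae (Filter.Eventually.of_forall fun z => ?_)
  by_cases hz : z ∈ e₀.target
  · simp only [indicator_of_mem hz]
    by_cases hzB : (z, t) ∈ B
    · rw [indicator_of_mem hzB, h.dens_eq p₀ (w := (z, t)) (hBO hzB), mul_comm]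
      rfl
    · rw [indicator_of_notMem hzB]
      have : V (x t (e₀.symm z)) = 0 := by
        by_contra h0
        have := (hloc _ h0).2
        rw [e₀.right_inv hz] at this
        exact hzB this
      rw [this, inner_zero_left, zero_mul]
  · have hzB : (z, t) ∉ B := fun hzB => hz (hBO hzB).1
    rw [indicator_of_notMem hz]
    exact (indicator_of_notMem hzB _).symm

theorem _root_.Schwarzschild.tr_fderiv_eq_zero_of_notMem_tsupport {V : E n → E n} {y : E n}
    (hy : y ∉ tsupport V) : tr (E n) (fderiv ℝ V y) = 0 := by
  have : fderiv ℝ V y = 0 := by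
    by_contra h'
    exact hy (support_fderiv_subset ℝ h')
  rw [this, map_zero]

theorem flux_eq_zero {t : ℝ} {D : Set (E n)} (hD : Encloses (x t) (ν t) D) {V : E n → E n}
    (hVs : tsupport V ⊆ (frontier D)ᶜ) : flux m x ν t V = 0 := by
  have hV0 : ∀ p, V (x t p) = 0 := fun p => by
    by_contra h0
    refine hVs (subset_tsupport _ h0) ?_
    rw [hD.frontier_eq]; exact mem_range_self p
  simp only [flux, hV0, inner_zero_left, zero_mul]
  simp [chartIntegral]

/-- Away from the frontier both sides vanish: inside `D` a compactly supported field has total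
divergence zero, and outside the closure there is nothing to integrate. -/
theorem exists_ambient_local_flux (h : IsSmoothIMCF m T x ν Ω) (hn : 3 ≤ n) (hm : 0 < m) {t : ℝ}
    (ht : t ∈ Ioo 0 T) {D : Set (E n)} (hD : Encloses (x t) (ν t) D) (y : E n) :
    ∃ W : Set (E n), IsOpen W ∧ y ∈ W ∧ ∀ V : E n → E n, ContDiff ℝ ∞ V →
      HasCompactSupport V → tsupport V ⊆ W →
        flux m x ν t V = ∫ y in D, tr (E n) (fderiv ℝ V y) := by
  by_cases hyf : y ∈ frontier D
  · rw [hD.frontier_eq] at hyf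
    obtain ⟨p, rfl⟩ := hyf
    exact h.exists_local_flux hn hm ht hD p
  by_cases hyD : y ∈ D
  · refine ⟨D, hD.isOpen, hyD, fun V hV hVc hVs => ?_⟩
    rw [flux_eq_zero hD (hVs.trans fun z hz hzf => by
      rw [frontier, hD.isOpen.interior_eq] at hzf; exact hzf.2 hz),
      setIntegral_eq_integral_of_forall_compl_eq_zero fun z hz =>
        tr_fderiv_eq_zero_of_notMem_tsupport fun h => hz (hVs h),
      integral_tr_fderiv_eq_zero hV hVc]
  · refine ⟨(closure D)ᶜ, isClosed_closure.isOpen_compl, fun hyc => hyf ?_,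
      fun V hV hVc hVs => ?_⟩
    · rw [frontier, hD.isOpen.interior_eq]; exact ⟨hyc, hyD⟩
    · rw [flux_eq_zero hD (hVs.trans fun z hz hzf => hz (frontier_subset_closure hzf)), eq_comm]
      refine setIntegral_eq_zero_of_forall_eq_zero fun z hz =>
        tr_fderiv_eq_zero_of_notMem_tsupport fun h => ?_
      exact hVs h (subset_closure hz)

theorem flux_sum (h : IsSmoothIMCF m T x ν Ω) (hn : 3 ≤ n) (hm : 0 < m) {t : ℝ}
    (ht : t ∈ Ioo 0 T) {ι : Type*} (F : Finset ι) {Y : ι → E n → E n}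
    (hY : ∀ y ∈ F, Continuous (Y y)) :
    flux m x ν t (fun z => ∑ y ∈ F, Y y z) = ∑ y ∈ F, flux m x ν t (Y y) := by
  have hxc : Continuous (x t) := (contMDiffAt_slice h.smooth ht).continuous
  have hNc := h.continuous_euclNormal hm ht
  simp only [flux, chartIntegral_eq_sum]
  rw [Finset.sum_comm]
  refine Finset.sum_congr rfl fun q _ => ?_
  rw [← integral_finsetSum]
  · refine integral_congr_ae (Filter.Eventually.of_forall fun z => ?_)
    simp only
    rw [sum_inner, Finset.sum_mul, Finset.mul_sum]
  · intro y hy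
    refine integrable_chartWeight_mul q (ContinuousOn.mul ?_ (h.continuousOn_surfDens hn hm ht q))
    have : Continuous fun p => (inner ℝ (Y y (x t p)) (euclNormal m x ν t p) : ℝ) :=
      ((hY y hy).comp hxc).inner hNc
    exact this.comp_continuousOn (chartAt (E (n - 1)) q).symm.continuousOn

theorem _root_.Schwarzschild.integral_tr_fderiv_sum {ι : Type*} (F : Finset ι) {Y : ι → E n → E n}
    (D : Set (E n)) (hY : ∀ y ∈ F, ContDiff ℝ ∞ (Y y)) (hYc : ∀ y ∈ F, HasCompactSupport (Y y)) :
    ∫ z in D, tr (E n) (fderiv ℝ (fun z => ∑ y ∈ F, Y y z) z) =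
      ∑ y ∈ F, ∫ z in D, tr (E n) (fderiv ℝ (Y y) z) := by
  rw [← integral_finsetSum]
  · refine integral_congr_ae (Filter.Eventually.of_forall fun z => ?_)
    simp only
    rw [(HasFDerivAt.fun_sum fun y hy =>
      ((hY y hy).differentiable (by simp) z).hasFDerivAt).fderiv, map_sum]
  · intro y hy
    have h1 : Continuous fun z => tr (E n) (fderiv ℝ (Y y) z) :=
      (tr (E n)).continuous.comp ((hY y hy).continuous_fderiv (by simp))
    have h2 : HasCompactSupport fun z => tr (E n) (fderiv ℝ (Y y) z) :=
      ((hYc y hy).fderiv (𝕜 := ℝ)).comp_left (map_zero (tr (E n)))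
    exact (h1.integrable_of_hasCompactSupport h2).integrableOn

/-- A partition of unity over a finite subcover of the compact support; it globalises the local
divergence theorem. -/
theorem _root_.Schwarzschild.exists_sum_subordinate {V : E n → E n} (hV : ContDiff ℝ ∞ V)
    (hVc : HasCompactSupport V) {W : E n → Set (E n)} (hWo : ∀ y, IsOpen (W y))
    (hyW : ∀ y, y ∈ W y) :
    ∃ (F : Finset (E n)) (Y : F → E n → E n), (V = fun z => ∑ y, Y y z) ∧
      ∀ y, ContDiff ℝ ∞ (Y y) ∧ HasCompactSupport (Y y) ∧ tsupport (Y y) ⊆ W y := by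
  obtain ⟨F, hF⟩ := hVc.isCompact.elim_finite_subcover W hWo fun y _ => mem_iUnion.mpr ⟨y, hyW y⟩
  have hF' : tsupport V ⊆ ⋃ y : F, W y := by simpa [iUnion_subtype] using hF
  obtain ⟨ψ, hψ⟩ := SmoothPartitionOfUnity.exists_isSubordinate 𝓘(ℝ, E n) (isClosed_tsupport V)
    (fun y : F => W y) (fun y => hWo y) hF'
  refine ⟨F, fun y z => ψ y z • V z, ?_, fun y => ⟨?_, hVc.mono fun z hz h0 => hz ?_, ?_⟩⟩
  · funext z
    rw [← Finset.sum_smul]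
    by_cases hz : z ∈ tsupport V
    · have := ψ.sum_eq_one hz
      rw [finsum_eq_sum_of_fintype] at this
      rw [this, one_smul]
    · rw [image_eq_zero_of_notMem_tsupport hz, smul_zero]
  · have : ContDiff ℝ ∞ (ψ y) := (ψ y).contMDiff.contDiff
    exact this.smul hV
  · simp only [h0, smul_zero]
  · exact (tsupport_smul_subset_left _ _).trans (hψ y)

/-- The divergence theorem for the domain enclosed by the hypersurface. -/
theorem flux_eq_integral (h : IsSmoothIMCF m T x ν Ω) (hn : 3 ≤ n) (hm : 0 < m) {t : ℝ}
    (ht : t ∈ Ioo 0 T) {D : Set (E n)} (hD : Encloses (x t) (ν t) D) {V : E n → E n}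
    (hV : ContDiff ℝ ∞ V) (hVc : HasCompactSupport V) :
    flux m x ν t V = ∫ y in D, tr (E n) (fderiv ℝ V y) := by
  choose W hWo hyW hWV using h.exists_ambient_local_flux hn hm ht hD
  obtain ⟨F, Y, hVY, hY⟩ := exists_sum_subordinate hV hVc hWo hyW
  rw [hVY, h.flux_sum hn hm ht _ fun y _ => (hY y).1.continuous,
    integral_tr_fderiv_sum _ D (fun y _ => (hY y).1) fun y _ => (hY y).2.1]
  exact Finset.sum_congr rfl fun y _ => hWV y _ (hY y).1 (hY y).2.1 (hY y).2.2

end IsSmoothIMCF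

end Enclosed

/-! ### The flux of the gradient of the harmonic function -/

section Radial

variable {n : ℕ} {m r : ℝ}

/-- A smooth function on the line that increases from zero to one on `[r / 3, 2 r / 3]`. -/
def cutoff (r s : ℝ) : ℝ := Real.smoothTransition (3 / r * s - 1)

theorem contDiff_cutoff : ContDiff ℝ ∞ (cutoff r) :=
  Real.smoothTransition.contDiff.comp (by fun_prop)

theorem cutoff_eq_zero (hr : 0 < r) {s : ℝ} (hs : s ≤ r / 3) : cutoff r s = 0 := by
  refine Real.smoothTransition.zero_of_nonpos ?_
  have : 3 / r * s ≤ 3 / r * (r / 3) := by gcongr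
  have h1 : 3 / r * (r / 3) = 1 := by field_simp
  linarith

theorem cutoff_eq_one (hr : 0 < r) {s : ℝ} (hs : 2 * r / 3 ≤ s) : cutoff r s = 1 := by
  refine Real.smoothTransition.one_of_one_le ?_
  have : 3 / r * (2 * r / 3) ≤ 3 / r * s := by gcongr
  have h1 : 3 / r * (2 * r / 3) = 2 := by field_simp
  linarith

theorem monotone_cutoff (hr : 0 < r) : Monotone (cutoff r) := fun a b hab =>
  Real.smoothTransition.monotone (by gcongr)

theorem deriv_cutoff_eq_zero (hr : 0 < r) {s : ℝ} (hs : s < r / 3) : deriv (cutoff r) s = 0 := by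
  have : cutoff r =ᶠ[nhds s] fun _ => 0 := by
    filter_upwards [Iio_mem_nhds hs] with a ha using cutoff_eq_zero hr (le_of_lt ha)
  rw [this.deriv_eq, deriv_const]

theorem deriv_cutoff_eq_zero' (hr : 0 < r) {s : ℝ} (hs : r ≤ s) : deriv (cutoff r) s = 0 := by
  have : cutoff r =ᶠ[nhds s] fun _ => 1 := by
    filter_upwards [Ioi_mem_nhds (show 2 * r / 3 < s by linarith)] with a ha
      using cutoff_eq_one hr (le_of_lt ha)
  rw [this.deriv_eq, deriv_const]

theorem integral_deriv_cutoff (hr : 0 < r) : ∫ s in Ioi (0 : ℝ), deriv (cutoff r) s = 1 := by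
  have h := integral_Ioi_of_hasDerivAt_of_nonneg' (a := 0) (l := 1)
    (fun s _ => (contDiff_cutoff.differentiable (by simp) s).hasDerivAt)
    (fun s _ => (monotone_cutoff hr).deriv_nonneg)
    (tendsto_const_nhds.congr' (f₁ := fun _ => (1 : ℝ)) (by
      filter_upwards [Filter.eventually_ge_atTop (2 * r / 3)] with s hs
        using (cutoff_eq_one hr hs).symm))
  rw [h, cutoff_eq_zero hr (by positivity), sub_zero]

/-- The gradient of the harmonic function, cut off near the origin. -/
def coreField (r m : ℝ) (y : E n) : E n := cutoff r ‖y‖ • gradU m y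

theorem coreField_eventuallyEq_zero (hr : 0 < r) {y : E n} (hy : ‖y‖ < r / 3) :
    coreField r m =ᶠ[nhds y] fun _ : E n => (0 : E n) := by
  filter_upwards [continuous_norm.continuousAt.preimage_mem_nhds (Iio_mem_nhds hy)] with z hz
  rw [coreField, cutoff_eq_zero hr (le_of_lt hz), zero_smul]

theorem contDiff_coreField (hr : 0 < r) : ContDiff ℝ ∞ (coreField (n := n) r m) := by
  rw [contDiff_iff_contDiffAt]
  intro y
  by_cases hy : ‖y‖ < r / 3
  · exact contDiffAt_const.congr_of_eventuallyEq (coreField_eventuallyEq_zero hr hy)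
  · have hy0 : y ≠ 0 := by
      rintro rfl; rw [norm_zero] at hy; exact hy (by positivity)
    have h1 : ContDiffAt ℝ ∞ (fun y : E n => ‖y‖) y := contDiffAt_norm ℝ hy0
    have h2 : ContDiffAt ℝ ∞ (fun y : E n => ‖y‖ ^ (-(n : ℝ))) y :=
      h1.rpow_const_of_ne (norm_ne_zero_iff.mpr hy0)
    exact (contDiff_cutoff.contDiffAt.comp y h1).smul ((contDiffAt_const.mul h2).smul contDiffAt_id)

/-- Since `u` is harmonic, only the derivative of the cutoff along the radial field `∇u` remains. -/
theorem tr_fderiv_coreField (hr : 0 < r) (y : E n) :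
    tr (E n) (fderiv ℝ (coreField r m) y) =
      m / 2 * (2 - (n : ℝ)) * (deriv (cutoff r) ‖y‖ * ‖y‖ ^ (1 - (n : ℝ))) := by
  by_cases hy : ‖y‖ < r / 3
  · rw [(coreField_eventuallyEq_zero hr hy).fderiv_eq, deriv_cutoff_eq_zero hr hy]
    simp
  · have hy0 : y ≠ 0 := by
      rintro rfl; rw [norm_zero] at hy; exact hy (by positivity)
    have hpos : 0 < ‖y‖ := norm_pos_iff.mpr hy0
    have h1 := hasFDerivAt_norm_rpow_of_ne_zero hy0 1
    simp only [Real.rpow_one] at h1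
    have h2 := (contDiff_cutoff (r := r).differentiable (by simp) ‖y‖).hasDerivAt.comp_hasFDerivAt y h1
    have h3 := h2.smul (hasFDerivAt_gradU (m := m) hy0)
    have h4 : fderiv ℝ (coreField r m) y = _ := h3.fderiv
    rw [h4, ← (hasFDerivAt_gradU (m := m) hy0).fderiv, map_add, map_smul, tr_fderiv_gradU hy0,
      tr_smulRight, smul_zero, zero_add]
    simp only [_root_.smul_apply, innerSL_apply_apply, smul_eq_mul, gradU, inner_smul_right,
      real_inner_self_eq_norm_sq]
    rw [show (1 : ℝ) - 2 = -1 by norm_num, Real.rpow_neg_one,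
      show (1 - (n : ℝ)) = 1 + -(n : ℝ) by ring, Real.rpow_add hpos, Real.rpow_one]
    field_simp

/-- In polar coordinates the factors `s ^ (n - 1)` and `s ^ (1 - n)` cancel, and the total increase
of the cutoff is `1`; the answer does not depend on `r`. -/
theorem integral_tr_fderiv_coreField (hn : 3 ≤ n) (hr : 0 < r) :
    ∫ y : E n, tr (E n) (fderiv ℝ (coreField r m) y) = m / 2 * (2 - (n : ℝ)) * sphereArea n := by
  have : Nontrivial (E n) := by
    have : Nonempty (Fin n) := ⟨⟨0, by omega⟩⟩
    infer_instance
  simp only [tr_fderiv_coreField hr]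
  rw [integral_const_mul, integral_fun_norm_addHaar volume
    (fun s : ℝ => deriv (cutoff r) s * s ^ (1 - (n : ℝ)))]
  have h1 : ∫ s in Ioi (0 : ℝ), s ^ (Module.finrank ℝ (E n) - 1) •
      (deriv (cutoff r) s * s ^ (1 - (n : ℝ))) = 1 := by
    refine Eq.trans ?_ (integral_deriv_cutoff hr)
    refine setIntegral_congr_fun measurableSet_Ioi fun s hs => ?_
    have hs0 : (0 : ℝ) < s := hs
    have h2 : s ^ (n - 1) * s ^ (1 - (n : ℝ)) = 1 := by
      rw [← Real.rpow_natCast, ← Real.rpow_add hs0, Nat.cast_sub (by omega)]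
      simp
    simp only [finrank_euclideanSpace_fin, smul_eq_mul]
    linear_combination deriv (cutoff r) s * h2
  rw [h1, sphereArea, Measure.toSphere_real_apply_univ]
  simp

end Radial

/-! ### Filling in the horizon to obtain an enclosed open set. -/

section Domain

variable {n : ℕ} {S : Type*} {m : ℝ}

/-- Without boundary, `D` would be clopen in a connected unbounded space. Nonemptiness of `S` is
what makes the area positive. -/
theorem Encloses.nonempty {x ν : S → E n} {D : Set (E n)} (hn : 3 ≤ n) (h : Encloses x ν D)
    (hne : D.Nonempty) (hb : Bornology.IsBounded D) : Nonempty S := by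
  by_contra hS
  rw [not_nonempty_iff] at hS
  have : Nonempty (Fin n) := ⟨⟨0, by omega⟩⟩
  have h1 : frontier D = ∅ := by rw [h.frontier_eq, range_eq_empty]
  rcases isClopen_iff.mp (isClopen_iff_frontier_eq_empty.mpr h1) with h2 | h2
  · exact hne.ne_empty h2
  · rw [h2] at hb
    exact NormedSpace.unbounded_univ ℝ (E n) hb

theorem NullHomologous.encloses {x ν : S → E n} {Ω : Set (E n)}
    (h : NullHomologous m (range x) Ω)
    (hout : ∀ p, ∃ ε > 0, ∀ s ∈ Ioo (0 : ℝ) ε, x p - s • ν p ∈ Ω ∧ x p + s • ν p ∉ closure Ω) :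
    Encloses x ν Ω :=
  ⟨h.isOpen, h.frontier_eq, hout⟩

/-- Polar coordinates present it as a continuous image of an interval times a connected sphere. -/
theorem isPreconnected_annulus (hn : 3 ≤ n) {a b : ℝ} (ha : 0 ≤ a) :
    IsPreconnected {y : E n | a < ‖y‖ ∧ ‖y‖ < b} := by
  have hrank : 1 < Module.rank ℝ (E n) := by
    rw [← Module.finrank_eq_rank, finrank_euclideanSpace_fin]
    exact_mod_cast (by omega : 1 < n)
  have h1 : {y : E n | a < ‖y‖ ∧ ‖y‖ < b} =
      (fun q : ℝ × E n => q.1 • q.2) '' (Ioo a b ×ˢ sphere (0 : E n) 1) := by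
    ext y
    constructor
    · rintro ⟨h1, h2⟩
      have h0 : ‖y‖ ≠ 0 := (ha.trans_lt h1).ne'
      refine ⟨(‖y‖, ‖y‖⁻¹ • y), ⟨⟨h1, h2⟩, ?_⟩, ?_⟩
      · rw [mem_sphere_zero_iff_norm, norm_smul, norm_inv, norm_norm, inv_mul_cancel₀ h0]
      · simp only [smul_smul, mul_inv_cancel₀ h0, one_smul]
    · rintro ⟨⟨s, v⟩, ⟨hs, hv⟩, rfl⟩
      have : ‖s • v‖ = s := by
        rw [norm_smul, mem_sphere_zero_iff_norm.mp hv, mul_one, Real.norm_of_nonneg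
          (ha.trans hs.1.le)]
      simp only [mem_ofPred_eq, this]
      exact hs
  rw [h1]
  exact (isPreconnected_Ioo.prod (isPreconnected_sphere hrank 0 1)).image _
    (by fun_prop : Continuous fun q : ℝ × E n => q.1 • q.2).continuousOn

/-- Compactness keeps the hypersurface away from the horizon. A thin annulus outside the horizon
therefore misses the frontier of `Ω`, yet meets `Ω` because the horizon lies in its closure;
connectedness does the rest. -/
theorem HomologousToHorizon.exists_collar {Sig Ω : Set (E n)} (hn : 3 ≤ n) (hm : 0 < m)
    (h : HomologousToHorizon m Sig Ω) (hSig : IsCompact Sig) :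
    ∃ b > horizonRadius n m, {y : E n | horizonRadius n m < ‖y‖ ∧ ‖y‖ < b} ⊆ Ω := by
  have hr : 0 < horizonRadius n m := horizonRadius_pos hm
  obtain ⟨b, hb, hbSig⟩ : ∃ b > horizonRadius n m, ∀ y ∈ Sig, b ≤ ‖y‖ := by
    rcases Sig.eq_empty_or_nonempty with h0 | h0
    · exact ⟨_, lt_add_one _, by simp [h0]⟩
    · obtain ⟨y, hy, hmin⟩ := hSig.exists_isMinOn h0 continuous_norm.continuousOn
      exact ⟨‖y‖, h.boundary_subset hy, fun z hz => hmin hz⟩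
  refine ⟨b, hb, (isPreconnected_annulus hn hr.le).subset_of_closure_inter_subset h.isOpen ?_ ?_⟩
  · let p : E n := EuclideanSpace.single ⟨0, by omega⟩ (horizonRadius n m)
    have hp : ‖p‖ = horizonRadius n m := by
      simp only [p, PiLp.norm_single, Real.norm_of_nonneg hr.le]
    have h1 : p ∈ closure Ω := by
      refine frontier_subset_closure ?_
      rw [h.frontier_eq]
      exact Or.inr (mem_sphere_zero_iff_norm.mpr hp)
    obtain ⟨y, hy, hyΩ⟩ := mem_closure_iff.mp h1 {y | ‖y‖ < b}
      (isOpen_lt continuous_norm continuous_const) (by rw [mem_ofPred_eq, hp]; exact hb)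
    exact ⟨y, ⟨h.subset hyΩ, hy⟩, hyΩ⟩
  · rintro y ⟨hyc, hy1, hy2⟩
    by_contra hyΩ
    have : y ∈ frontier Ω := by
      rw [frontier, h.isOpen.interior_eq]; exact ⟨hyc, hyΩ⟩
    rw [h.frontier_eq] at this
    rcases this with h1 | h1
    · exact absurd (hbSig y h1) (not_le.mpr hy2)
    · exact hy1.ne' (mem_sphere_zero_iff_norm.mp h1)

/-- The collar makes the union with the closed horizon ball open, so the horizon disappears from the
frontier and only the hypersurface is left. -/
theorem HomologousToHorizon.encloses {x ν : S → E n} {Ω : Set (E n)} (hn : 3 ≤ n) (hm : 0 < m)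
    (h : HomologousToHorizon m (range x) Ω) (hc : IsCompact (range x))
    (hout : ∀ p, ∃ ε > 0, ∀ s ∈ Ioo (0 : ℝ) ε, x p - s • ν p ∈ Ω ∧ x p + s • ν p ∉ closure Ω) :
    Encloses x ν (Ω ∪ closedBall 0 (horizonRadius n m)) := by
  have hr : 0 < horizonRadius n m := horizonRadius_pos hm
  obtain ⟨b, hb, hcollar⟩ := h.exists_collar hn hm hc
  have hopen : IsOpen (Ω ∪ closedBall (0 : E n) (horizonRadius n m)) := by
    have : Ω ∪ closedBall (0 : E n) (horizonRadius n m) = Ω ∪ ball 0 b := by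
      ext y
      constructor
      · rintro (hy | hy)
        · exact Or.inl hy
        · exact Or.inr (closedBall_subset_ball hb hy)
      · rintro (hy | hy)
        · exact Or.inl hy
        · rcases le_or_gt ‖y‖ (horizonRadius n m) with h1 | h1
          · exact Or.inr (mem_closedBall_zero_iff.mpr h1)
          · exact Or.inl (hcollar ⟨h1, mem_ball_zero_iff.mp hy⟩)
    rw [this]
    exact h.isOpen.union isOpen_ball
  have hclosure : closure (Ω ∪ closedBall (0 : E n) (horizonRadius n m)) =
      closure Ω ∪ closedBall 0 (horizonRadius n m) := by
    rw [closure_union, isClosed_closedBall.closure_eq]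
  have hext : ∀ p, x p ∉ closedBall (0 : E n) (horizonRadius n m) := fun p hp =>
    not_lt.mpr (mem_closedBall_zero_iff.mp hp) (h.boundary_subset (mem_range_self p))
  refine ⟨hopen, ?_, fun p => ?_⟩
  · rw [frontier, hopen.interior_eq, hclosure]
    ext y
    constructor
    · rintro ⟨hy, hyD⟩
      have hyb : y ∉ closedBall (0 : E n) (horizonRadius n m) := fun h1 => hyD (Or.inr h1)
      have : y ∈ frontier Ω := by
        rw [frontier, h.isOpen.interior_eq]
        exact ⟨hy.resolve_right hyb, fun h1 => hyD (Or.inl h1)⟩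
      rw [h.frontier_eq] at this
      exact this.resolve_right fun h1 => hyb (sphere_subset_closedBall h1)
    · rintro ⟨p, rfl⟩
      have : x p ∈ frontier Ω := by rw [h.frontier_eq]; exact Or.inl (mem_range_self p)
      rw [frontier, h.isOpen.interior_eq] at this
      exact ⟨Or.inl this.1, fun h1 => h1.elim this.2 (hext p)⟩
  · obtain ⟨ε, hε, hs⟩ := hout p
    have h1 : ∀ᶠ s : ℝ in nhds 0, x p + s • ν p ∉ closedBall (0 : E n) (horizonRadius n m) := by
      have hcont : Continuous fun s : ℝ => x p + s • ν p := by fun_prop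
      refine hcont.continuousAt.eventually (isClosed_closedBall.isOpen_compl.mem_nhds ?_)
      simpa using hext p
    obtain ⟨δ, hδ, hball⟩ := Metric.eventually_nhds_iff.mp h1
    refine ⟨min ε δ, lt_min hε hδ, fun s hs' => ?_⟩
    have h2 := hs s ⟨hs'.1, hs'.2.trans_le (min_le_left _ _)⟩
    refine ⟨Or.inl h2.1, ?_⟩
    rw [hclosure]
    rintro (h3 | h3)
    · exact h2.2 h3
    · refine hball ?_ h3
      rw [Real.dist_eq, sub_zero, abs_of_pos hs'.1]
      exact hs'.2.trans_le (min_le_right _ _)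

end Domain

/-! ### The two topological values of the flux of the harmonic gradient. -/

section FluxValue

variable {n : ℕ} {S : Type*} [TopologicalSpace S] [ChartedSpace (E (n - 1)) S]
variable [T2Space S] [CompactSpace S] [IsManifold (𝓡 (n - 1)) ∞ S]
variable {m T : ℝ} {x ν : ℝ → S → E n} {Ω : ℝ → Set (E n)}

namespace IsSmoothIMCF

/-- The singularity of `∇u` at the origin is removed strictly inside the horizon, away from the
hypersurface. A bump equal to one near the closure of `D` supplies compact support without changing
either side. -/
theorem flux_gradU_eq_integral (h : IsSmoothIMCF m T x ν Ω) (hn : 3 ≤ n) (hm : 0 < m) {t : ℝ}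
    (ht : t ∈ Ioo 0 T) {D : Set (E n)} (hD : Encloses (x t) (ν t) D)
    (hDb : Bornology.IsBounded D) :
    flux m x ν t (gradU m) =
      ∫ y in D, tr (E n) (fderiv ℝ (coreField (horizonRadius n m) m) y) := by
  have hr : 0 < horizonRadius n m := horizonRadius_pos hm
  obtain ⟨R, hR, hDR⟩ := hDb.closure.subset_ball_lt 0 0
  let χ : ContDiffBump (0 : E n) := ⟨R, R + 1, hR, lt_add_one R⟩
  have hχ : ∀ y ∈ ball (0 : E n) R, χ y = 1 := fun y hy =>
    χ.one_of_mem_closedBall (ball_subset_closedBall hy)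
  set V : E n → E n := fun y => χ y • coreField (horizonRadius n m) m y with hV
  have hVs : ContDiff ℝ ∞ V := χ.contDiff.smul (contDiff_coreField hr)
  have hVc : HasCompactSupport V := χ.hasCompactSupport.mono fun y hy h0 => hy (by
    simp only [hV]; rw [h0, zero_smul])
  have h1 : flux m x ν t (gradU m) = flux m x ν t V := by
    refine chartIntegral_congr fun q z hz => ?_
    set p := (chartAt (E (n - 1)) q).symm z
    have hp : x t p ∈ frontier D := by rw [hD.frontier_eq]; exact mem_range_self p
    have hp' : horizonRadius n m < ‖x t p‖ := h.mem_interior ⟨ht.1.le, ht.2⟩ p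
    simp only [hV]
    rw [hχ _ (hDR (frontier_subset_closure hp)), one_smul, coreField,
      cutoff_eq_one hr (by linarith), one_smul]
  rw [h1, h.flux_eq_integral hn hm ht hD hVs hVc]
  refine setIntegral_congr_fun hD.isOpen.measurableSet fun y hy => ?_
  have h2 : V =ᶠ[nhds y] coreField (horizonRadius n m) m := by
    filter_upwards [isOpen_ball.mem_nhds (hDR (subset_closure hy))] with z hz
    simp only [hV]
    rw [hχ z hz, one_smul]
  simp only [h2.fderiv_eq]

theorem isCompact_range (h : IsSmoothIMCF m T x ν Ω) {t : ℝ} (ht : t ∈ Ioo 0 T) :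
    IsCompact (range (x t)) :=
  _root_.isCompact_range (contMDiffAt_slice h.smooth ht).continuous

/-- The domain stays outside the horizon, where the cut-off field is still divergence free. -/
theorem flux_gradU_of_nullHomologous (h : IsSmoothIMCF m T x ν Ω) (hn : 3 ≤ n) (hm : 0 < m)
    {t : ℝ} (ht : t ∈ Ioo 0 T) (hΩ : NullHomologous m (range (x t)) (Ω t)) :
    flux m x ν t (gradU m) = 0 := by
  have hr : 0 < horizonRadius n m := horizonRadius_pos hm
  rw [h.flux_gradU_eq_integral hn hm ht (hΩ.encloses (h.normal_outward t ⟨ht.1.le, ht.2⟩))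
    hΩ.isBounded]
  refine setIntegral_eq_zero_of_forall_eq_zero fun y hy => ?_
  have : horizonRadius n m < ‖y‖ := hΩ.closure_subset (subset_closure hy)
  rw [tr_fderiv_coreField hr, deriv_cutoff_eq_zero' hr this.le]
  ring

/-- The filled domain contains the whole ball in which the divergence of the cut-off field is
concentrated, so the integral over it is the full one. -/
theorem flux_gradU_of_homologousToHorizon (h : IsSmoothIMCF m T x ν Ω) (hn : 3 ≤ n) (hm : 0 < m)
    {t : ℝ} (ht : t ∈ Ioo 0 T) (hΩ : HomologousToHorizon m (range (x t)) (Ω t)) :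
    flux m x ν t (gradU m) = m / 2 * (2 - (n : ℝ)) * sphereArea n := by
  have hr : 0 < horizonRadius n m := horizonRadius_pos hm
  rw [h.flux_gradU_eq_integral hn hm ht (hΩ.encloses hn hm (h.isCompact_range ht)
    (h.normal_outward t ⟨ht.1.le, ht.2⟩)) (hΩ.isBounded.union isBounded_closedBall),
    setIntegral_eq_integral_of_forall_compl_eq_zero, integral_tr_fderiv_coreField hn hr]
  intro y hy
  have : horizonRadius n m ≤ ‖y‖ := by
    by_contra! h1
    exact hy (Or.inr (mem_closedBall_zero_iff.mpr h1.le))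
  rw [tr_fderiv_coreField hr, deriv_cutoff_eq_zero' hr this]
  ring

theorem nonempty (h : IsSmoothIMCF m T x ν Ω) (hn : 3 ≤ n) (hm : 0 < m) {t : ℝ}
    (ht : t ∈ Ioo 0 T) : Nonempty S := by
  have hout := h.normal_outward t ⟨ht.1.le, ht.2⟩
  rcases h.bounds t ⟨ht.1.le, ht.2⟩ with hΩ | hΩ
  · exact (hΩ.encloses hout).nonempty hn hΩ.isConnected.nonempty hΩ.isBounded
  · exact (hΩ.encloses hn hm (h.isCompact_range ht) hout).nonempty hn
      (hΩ.isConnected.nonempty.mono subset_union_left) (hΩ.isBounded.union isBounded_closedBall)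

end IsSmoothIMCF

end FluxValue

/-! ### Smoothness of the densities -/

section Smoothness

variable {n : ℕ} {m : ℝ} {x : E n}

theorem contDiffAt_norm_rpow (hx : x ≠ 0) (a : ℝ) : ContDiffAt ℝ ∞ (fun y : E n => ‖y‖ ^ a) x :=
  (contDiffAt_norm ℝ hx).rpow_const_of_ne (norm_ne_zero_iff.mpr hx)

theorem contDiffAt_potentialU (hx : x ≠ 0) : ContDiffAt ℝ ∞ (potentialU m) x :=
  contDiffAt_const.add (contDiffAt_const.mul (contDiffAt_norm_rpow hx _))

theorem contDiffAt_conf (hm : 0 < m) (hx : x ≠ 0) : ContDiffAt ℝ ∞ (conf m) x :=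
  (contDiffAt_potentialU hx).rpow_const_of_ne (potentialU_pos hm).ne'

theorem contDiffAt_gradU (hx : x ≠ 0) : ContDiffAt ℝ ∞ (gradU m) x :=
  (contDiffAt_const.mul (contDiffAt_norm_rpow hx _)).smul contDiffAt_id

namespace LocalFlow

variable {k : ℕ} {O : Set (E k × ℝ)} {X N : E k × ℝ → E n} {φ : E k × ℝ → ℝ}

theorem smooth_comp {F : Type*} [NormedAddCommGroup F] [NormedSpace ℝ F]
    (h : LocalFlow O X N φ) {f : E n → F} (hf : ∀ w ∈ O, ContDiffAt ℝ ∞ f (X w)) :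
    ContDiffOn ℝ ∞ (fun w => f (X w)) O := fun w hw =>
  (hf w hw).comp_contDiffWithinAt w (h.smooth w hw)

theorem smooth_areaDens (h : LocalFlow O X N φ) (hm : 0 < m) (hX : ∀ x ∈ O, X x ≠ 0) :
    ContDiffOn ℝ ∞ (areaDens m X) O :=
  ((h.smooth_comp fun w hw => contDiffAt_conf hm (hX w hw)).pow k).mul h.smooth_dens

theorem smooth_confMean (h : LocalFlow O X N φ) (hm : 0 < m) (hX : ∀ x ∈ O, X x ≠ 0) :
    ContDiffOn ℝ ∞ (confMean m X N) O := by
  have h1 := h.smooth_comp (f := potentialU m) fun w hw => contDiffAt_potentialU (hX w hw)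
  have h2 := h.smooth_comp (f := gradU m) fun w hw => contDiffAt_gradU (hX w hw)
  exact h.smooth_mean.add (contDiffOn_const.mul
    ((contDiffOn_const.mul (h2.inner ℝ h.smooth_normal)).div h1
      fun w _ => (potentialU_pos hm).ne'))

theorem smooth_weight (h : LocalFlow O X N φ) (hX : ∀ x ∈ O, X x ≠ 0) :
    ContDiffOn ℝ ∞ (fun w => (2 - potentialU m (X w)) * potentialU m (X w)) O := by
  have h1 := h.smooth_comp (f := potentialU m) fun w hw => contDiffAt_potentialU (hX w hw)
  exact (contDiffOn_const.sub h1).mul h1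

theorem smooth_weightDens (h : LocalFlow O X N φ) (hm : 0 < m) (hX : ∀ x ∈ O, X x ≠ 0) :
    ContDiffOn ℝ ∞ (weightDens m X N) O :=
  ((h.smooth_weight hX).mul (h.smooth_confMean hm hX)).mul h.smooth_dens

theorem smooth_umbilicDefect (h : LocalFlow O X N φ) (hm : 0 < m) (hX : ∀ x ∈ O, X x ≠ 0) :
    ContDiffOn ℝ ∞ (umbilicDefect m X N) O := by
  have h1 := h.smooth_comp (f := potentialU m) fun w hw => contDiffAt_potentialU (hX w hw)
  have h2 := h.smooth_comp (f := gradU m) fun w hw => contDiffAt_gradU (hX w hw)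
  have h3 : ContDiffOn ℝ ∞ (fun w => confSlope m (X w) (N w)) O :=
    (contDiffOn_const.mul (h2.inner ℝ h.smooth_normal)).div h1 fun w _ => (potentialU_pos hm).ne'
  have h4 : ContDiffOn ℝ ∞ (fun w => shape X N w +
      confSlope m (X w) (N w) • ContinuousLinearMap.id ℝ (E k)) O :=
    h.smooth_shape.add (h3.smul contDiffOn_const)
  exact ((tr (E k)).contDiff.comp_contDiffOn (h4.clm_comp h4)).sub
    ((((tr (E k)).contDiff.comp_contDiffOn h4).pow 2).div_const _)

theorem smooth_defectDens (h : LocalFlow O X N φ) (hm : 0 < m) (hX : ∀ x ∈ O, X x ≠ 0)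
    (hH : ∀ x ∈ O, confMean m X N x ≠ 0) : ContDiffOn ℝ ∞ (defectDens m X N) O :=
  (((h.smooth_weight hX).mul ((h.smooth_confMean hm hX).inv hH)).mul
    (h.smooth_umbilicDefect hm hX)).mul h.smooth_dens

theorem smooth_weightFlux (h : LocalFlow O X N φ) (hX : ∀ x ∈ O, X x ≠ 0) :
    ContDiffOn ℝ ∞ (weightFlux m X N φ) O := by
  have h1 := h.smooth_comp (f := potentialU m) fun w hw => contDiffAt_potentialU (hX w hw)
  have h2 := h.smooth_comp (f := gradU m) fun w hw => contDiffAt_gradU (hX w hw)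
  exact (((h.smooth_weight hX).smul (ContDiffOn.tD h.isOpen h.smooth_normal)).add
    (h.smooth_speed.smul ((contDiffOn_const.sub (contDiffOn_const.mul h1)).smul h2))).sub
    ((h.smooth_speed.smul ((contDiffOn_const.sub h1).smul h2)).const_smul (2 * (k : ℝ) / ((n : ℝ) - 2)))

theorem smooth_zdiv_flux (h : LocalFlow O X N φ) (hX : ∀ x ∈ O, X x ≠ 0) :
    ContDiffOn ℝ ∞ (zdiv fun x => dens X x • proj X N x (weightFlux m X N φ x)) O :=
  (tr (E k)).contDiff.comp_contDiffOn (ContDiffOn.zD h.isOpen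
    (h.smooth_dens.smul (h.smooth_proj.clm_apply (h.smooth_weightFlux hX))))

end LocalFlow

end Smoothness

/-! ### Evolution of the area and of the total weighted mean curvature -/

section Evolution

variable {n : ℕ} {S : Type*} [TopologicalSpace S] [ChartedSpace (E (n - 1)) S]

theorem ContinuousOn.chart_slice {T t : ℝ} {q : S} {F : Type*} [TopologicalSpace F]
    {g : E (n - 1) × ℝ → F} (hg : ContinuousOn g (chartDom n T q)) (ht : t ∈ Ioo 0 T) :
    ContinuousOn (fun z => g (z, t)) (chartAt (E (n - 1)) q).target :=
  hg.comp (by fun_prop) fun _ hz => ⟨hz, ht⟩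

variable [T2Space S] [CompactSpace S] [IsManifold (𝓡 (n - 1)) ∞ S]

theorem chartIntegral_linear {F G D Z : S → E (n - 1) → ℝ} (a b : ℝ)
    (hF : ∀ q, ContinuousOn (F q) (chartAt (E (n - 1)) q).target)
    (hG : ∀ q, ContinuousOn (G q) (chartAt (E (n - 1)) q).target)
    (hD : ∀ q, ContinuousOn (D q) (chartAt (E (n - 1)) q).target)
    (hZ : ∀ q, ContinuousOn (Z q) (chartAt (E (n - 1)) q).target) :
    chartIntegral (fun q z => a * F q z + b * G q z - D q z + Z q z) =
      a * chartIntegral F + b * chartIntegral G - chartIntegral D + chartIntegral Z := by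
  have h1 : (fun q z => a * F q z + b * G q z - D q z + Z q z) =
      fun q z => (a * F q z + b * G q z) + (-1 * D q z + Z q z) := by
    funext q z; ring
  rw [h1, chartIntegral_add, chartIntegral_add, chartIntegral_add, chartIntegral_const_mul,
    chartIntegral_const_mul, chartIntegral_const_mul]
  · ring
  all_goals intro q
  · exact continuousOn_const.mul (hD q)
  · exact hZ q
  · exact continuousOn_const.mul (hF q)
  · exact continuousOn_const.mul (hG q)
  · exact (continuousOn_const.mul (hF q)).add (continuousOn_const.mul (hG q))
  · exact (continuousOn_const.mul (hD q)).add (hZ q)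

/-- The rate at which the total weighted mean curvature is dissipated. -/
def dissipation (m : ℝ) (x ν : ℝ → S → E n) (t : ℝ) : ℝ :=
  chartIntegral fun (q : S) (z : E (n - 1)) =>
    defectDens m (chartFun x q) (chartFun (euclNormal m x ν) q) (z, t)

variable {m T : ℝ} {x ν : ℝ → S → E n} {Ω : ℝ → Set (E n)}

namespace IsSmoothIMCF

theorem chartFun_ne_zero (h : IsSmoothIMCF m T x ν Ω) (hm : 0 < m) (q : S) :
    ∀ w ∈ chartDom n T q, chartFun x q w ≠ 0 := fun _ hw => h.ne_zero hm ⟨hw.2.1.le, hw.2.2⟩ _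

theorem area_eq (h : IsSmoothIMCF m T x ν Ω) (hn : 3 ≤ n) (hm : 0 < m) {t : ℝ}
    (ht : t ∈ Ioo 0 T) :
    area m (x t) = chartIntegral fun (q : S) (z : E (n - 1)) => areaDens m (chartFun x q) (z, t) := by
  rw [area, surfaceIntegral_eq]
  refine chartIntegral_congr fun q z hz => ?_
  rw [one_mul]
  exact (h.chart_densities hn hm q (w := (z, t)) ⟨hz, ht⟩).1

theorem weightedMeanCurvature_eq (h : IsSmoothIMCF m T x ν Ω) (hn : 3 ≤ n) (hm : 0 < m) {t : ℝ}
    (ht : t ∈ Ioo 0 T) :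
    weightedMeanCurvature m (x t) (ν t) = chartIntegral fun (q : S) (z : E (n - 1)) =>
      weightDens m (chartFun x q) (chartFun (euclNormal m x ν) q) (z, t) := by
  rw [weightedMeanCurvature, surfaceIntegral_eq]
  exact chartIntegral_congr fun q z hz => (h.chart_densities hn hm q (w := (z, t)) ⟨hz, ht⟩).2

theorem area_pos (h : IsSmoothIMCF m T x ν Ω) (hn : 3 ≤ n) (hm : 0 < m) {t : ℝ}
    (ht : t ∈ Ioo 0 T) : 0 < area m (x t) := by
  have := h.nonempty hn hm ht
  rw [h.area_eq hn hm ht]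
  refine chartIntegral_pos (fun q => ?_) fun q z hz => ?_
  · exact ContinuousOn.chart_slice
      ((h.localFlow hn hm q).smooth_areaDens hm (h.chartFun_ne_zero hm q)).continuousOn ht
  · exact mul_pos (pow_pos (conf_pos hm) _)
      ((h.localFlow hn hm q).dens_pos (w := (z, t)) ⟨hz, ht⟩)

theorem hasDerivAt_area (h : IsSmoothIMCF m T x ν Ω) (hn : 3 ≤ n) (hm : 0 < m) {t : ℝ}
    (ht : t ∈ Ioo 0 T) : HasDerivAt (fun s => area m (x s)) (area m (x t)) t := by
  have h1 := hasDerivAt_chartIntegral (g := fun (q : S) => areaDens m (chartFun x q)) (T := T)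
    (fun q => (h.localFlow hn hm q).smooth_areaDens hm (h.chartFun_ne_zero hm q)) ht
  have h2 : (fun s => area m (x s)) =ᶠ[nhds t]
      fun s => chartIntegral fun (q : S) (z : E (n - 1)) => areaDens m (chartFun x q) (z, s) := by
    filter_upwards [isOpen_Ioo.mem_nhds ht] with s hs using h.area_eq hn hm hs
  refine (h1.congr_of_eventuallyEq h2).congr_deriv ?_
  rw [h.area_eq hn hm ht]
  refine chartIntegral_congr fun q z hz => ?_
  have hw : (z, t) ∈ chartDom n T q := ⟨hz, ht⟩
  exact (h.localFlow hn hm q).tD_areaDens hm hw (h.chartFun_ne_zero hm q _ hw)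
    (h.speed_mul_confMean hn hm q hw).2

/-- The flux field is intrinsic: its speed is `1 / (c H)`, and `∂_t N` is taken at a fixed point of
`S`. It therefore comes from one field on `S`, as the divergence theorem requires. -/
theorem chartIntegral_zdiv_weightFlux (h : IsSmoothIMCF m T x ν Ω) (hn : 3 ≤ n) (hm : 0 < m)
    {t : ℝ} (ht : t ∈ Ioo 0 T) :
    chartIntegral (fun (q : S) (z : E (n - 1)) => zdiv (fun w => dens (chartFun x q) w •
      proj (chartFun x q) (chartFun (euclNormal m x ν) q) w
        (weightFlux m (chartFun x q) (chartFun (euclNormal m x ν) q) (chartSpeed m x ν q) w))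
          (z, t)) = 0 := by
  let φ : S → ℝ := fun p => (meanCurvature m (x t) (ν t) p * conf m (x t p))⁻¹
  refine h.chartIntegral_zdiv_eq_zero hn hm ht (V := fun p =>
    ((2 - potentialU m (x t p)) * potentialU m (x t p)) •
      deriv (fun τ => euclNormal m x ν τ p) t +
    φ p • (2 - 2 * potentialU m (x t p)) • gradU m (x t p) -
    (2 * (n - 1 : ℕ) / ((n : ℝ) - 2)) • φ p • (2 - potentialU m (x t p)) • gradU m (x t p))
    (fun q => (h.localFlow hn hm q).smooth_weightFlux (h.chartFun_ne_zero hm q))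
    fun q z hz => ?_
  have hw : (z, t) ∈ chartDom n T q := ⟨hz, ht⟩
  have h1 : tD (chartFun (euclNormal m x ν) q) (z, t) =
      deriv (fun τ => euclNormal m x ν τ ((chartAt (E (n - 1)) q).symm z)) t := by
    have h2 := (diffAt (isOpen_chartDom T q) (h.contDiffOn_normal hm q) hw).hasFDerivAt
    have h3 : HasDerivAt (fun τ : ℝ => (z, τ)) ((0, 1) : E (n - 1) × ℝ) t :=
      (hasDerivAt_const t z).prodMk (hasDerivAt_id t)
    exact (HasFDerivAt.comp_hasDerivAt (f := fun τ : ℝ => (z, τ)) t h2 h3).deriv.symm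
  have h4 : chartSpeed m x ν q (z, t) = φ ((chartAt (E (n - 1)) q).symm z) := by
    rw [eq_inv_of_mul_eq_one_left (h.speed_mul_confMean hn hm q hw).2,
      ← (h.chart_geometry hn hm q hw).1]
    rfl
  rw [weightFlux, h1, h4]
  rfl

theorem hasDerivAt_weightedMeanCurvature (h : IsSmoothIMCF m T x ν Ω) (hn : 3 ≤ n) (hm : 0 < m)
    {t : ℝ} (ht : t ∈ Ioo 0 T) :
    HasDerivAt (fun s => weightedMeanCurvature m (x s) (ν s))
      (-4 * flux m x ν t (gradU m) + (((n : ℝ) - 2) / ((n : ℝ) - 1)) *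
        weightedMeanCurvature m (x t) (ν t) - dissipation m x ν t) t := by
  have hne := h.chartFun_ne_zero hm
  have h1 := hasDerivAt_chartIntegral
    (g := fun (q : S) => weightDens m (chartFun x q) (chartFun (euclNormal m x ν) q)) (T := T)
    (fun q => (h.localFlow hn hm q).smooth_weightDens hm (hne q)) ht
  have h2 : (fun s => weightedMeanCurvature m (x s) (ν s)) =ᶠ[nhds t]
      fun s => chartIntegral fun (q : S) (z : E (n - 1)) =>
        weightDens m (chartFun x q) (chartFun (euclNormal m x ν) q) (z, s) := by
    filter_upwards [isOpen_Ioo.mem_nhds ht] with s hs using h.weightedMeanCurvature_eq hn hm hs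
  refine (h1.congr_of_eventuallyEq h2).congr_deriv ?_
  have hcF : ∀ q : S, ContinuousOn (fun z => inner ℝ (gradU m (x t ((chartAt (E (n - 1)) q).symm z)))
      (euclNormal m x ν t ((chartAt (E (n - 1)) q).symm z)) * surfDens (x t) q z)
      (chartAt (E (n - 1)) q).target := fun q => by
    have h3 : ContinuousOn (fun w => inner ℝ (gradU m (chartFun x q w))
        (chartFun (euclNormal m x ν) q w)) (chartDom n T q) :=
      (((h.localFlow hn hm q).smooth_comp (f := gradU m) fun w hw =>
        contDiffAt_gradU (hne q w hw)).inner ℝ (h.contDiffOn_normal hm q)).continuousOn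
    exact (ContinuousOn.chart_slice h3 ht).mul (h.continuousOn_surfDens hn hm ht q)
  have hcW : ∀ q : S, ContinuousOn (fun z => weightDens m (chartFun x q)
      (chartFun (euclNormal m x ν) q) (z, t)) (chartAt (E (n - 1)) q).target := fun q =>
    ContinuousOn.chart_slice ((h.localFlow hn hm q).smooth_weightDens hm (hne q)).continuousOn ht
  have hcD : ∀ q : S, ContinuousOn (fun z => defectDens m (chartFun x q)
      (chartFun (euclNormal m x ν) q) (z, t)) (chartAt (E (n - 1)) q).target := fun q =>
    ContinuousOn.chart_slice ((h.localFlow hn hm q).smooth_defectDens hm (hne q)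
      fun w hw => (h.speed_mul_confMean hn hm q hw).1.ne').continuousOn ht
  have hcZ : ∀ q : S, ContinuousOn (fun z => zdiv (fun w => dens (chartFun x q) w •
      proj (chartFun x q) (chartFun (euclNormal m x ν) q) w
        (weightFlux m (chartFun x q) (chartFun (euclNormal m x ν) q) (chartSpeed m x ν q) w))
          (z, t)) (chartAt (E (n - 1)) q).target := fun q =>
    ContinuousOn.chart_slice ((h.localFlow hn hm q).smooth_zdiv_flux (hne q)).continuousOn ht
  have h3 := chartIntegral_linear (-4) (((n : ℝ) - 2) / ((n : ℝ) - 1)) hcF hcW hcD hcZ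
  rw [h.chartIntegral_zdiv_weightFlux hn hm ht, add_zero] at h3
  rw [h.weightedMeanCurvature_eq hn hm ht, flux, dissipation, ← h3]
  refine chartIntegral_congr fun q z hz => ?_
  have hw : (z, t) ∈ chartDom n T q := ⟨hz, ht⟩
  rw [(h.localFlow hn hm q).tD_weightDens hn hm hw (hne q) (h.speed_mul_confMean hn hm q hw).2,
    h.dens_eq q hw, real_inner_comm, mul_assoc]
  rfl

/-- The coefficient of the umbilic defect is strictly positive because `u < 2` and `c H > 0`.
Continuity then turns a vanishing integral into vanishing at every point. -/
theorem dissipation_nonneg_and (h : IsSmoothIMCF m T x ν Ω) (hn : 3 ≤ n) (hm : 0 < m)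
    {t : ℝ} (ht : t ∈ Ioo 0 T) : 0 ≤ dissipation m x ν t ∧
      (dissipation m x ν t = 0 ↔ TotallyUmbilic m (x t) (ν t)) := by
  have hne := h.chartFun_ne_zero hm
  have hcoef : ∀ (q : S) (w : E (n - 1) × ℝ), w ∈ chartDom n T q →
      0 < (2 - potentialU m (chartFun x q w)) * potentialU m (chartFun x q w) *
        (confMean m (chartFun x q) (chartFun (euclNormal m x ν) q) w)⁻¹ := fun q w hw =>
    mul_pos (mul_pos (sub_pos.mpr (potentialU_lt_two hn hm (h.mem_interior ⟨hw.2.1.le, hw.2.2⟩ _)))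
      (potentialU_pos hm)) (inv_pos.mpr (h.speed_mul_confMean hn hm q hw).1)
  have hdef : ∀ (q : S) (w : E (n - 1) × ℝ), w ∈ chartDom n T q → _ := fun q w hw =>
    (h.localFlow hn hm q).umbilicDefect_nonneg (m := m) hw (by omega)
  have hnn : ∀ (q : S) (z : E (n - 1)), z ∈ (chartAt (E (n - 1)) q).target →
      0 ≤ defectDens m (chartFun x q) (chartFun (euclNormal m x ν) q) (z, t) := fun q z hz =>
    mul_nonneg (mul_nonneg (hcoef q (z, t) ⟨hz, ht⟩).le (hdef q (z, t) ⟨hz, ht⟩).1)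
      ((h.localFlow hn hm q).dens_pos (w := (z, t)) ⟨hz, ht⟩).le
  have hzero : ∀ (q : S) (z : E (n - 1)), z ∈ (chartAt (E (n - 1)) q).target →
      (defectDens m (chartFun x q) (chartFun (euclNormal m x ν) q) (z, t) = 0 ↔
        ∃ c : ℝ, ∀ v v' : E (n - 1),
          secondFundamentalForm m (x t) (ν t) ((chartAt (E (n - 1)) q).symm z) v v' =
            c * inducedMetric m (x t) ((chartAt (E (n - 1)) q).symm z) v v') := fun q z hz => by
    have hw : (z, t) ∈ chartDom n T q := ⟨hz, ht⟩
    rw [(h.chart_geometry hn hm q hw).2, ← (hdef q (z, t) hw).2, defectDens, mul_eq_zero,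
      mul_eq_zero]
    have h1 := ((h.localFlow hn hm q).dens_pos hw).ne'
    have h2 := (hcoef q _ hw).ne'
    tauto
  refine ⟨chartIntegral_nonneg hnn, fun h0 p => ?_, fun hu => ?_⟩
  · obtain ⟨q, hs, hq⟩ := exists_chartWeight_ne_zero (n := n) p
    have h1 := eq_zero_of_chartIntegral_eq_zero (fun q => ContinuousOn.chart_slice
      ((h.localFlow hn hm q).smooth_defectDens hm (hne q)
        fun w hw => (h.speed_mul_confMean hn hm q hw).1.ne').continuousOn ht) hnn h0 q hq
    rw [hzero q _ ((chartAt (E (n - 1)) q).map_source hs), (chartAt (E (n - 1)) q).left_inv hs] at h1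
    exact h1
  · rw [dissipation, chartIntegral_congr (g' := fun _ _ => 0) fun q z hz =>
      (hzero q z hz).mpr (hu _)]
    simp [chartIntegral]

/-- The evolution of the scale invariant quantities. -/
theorem hasDerivAt_scaled (h : IsSmoothIMCF m T x ν Ω) (hn : 3 ≤ n) (hm : 0 < m)
    {t : ℝ} (ht : t ∈ Ioo 0 T) (c : ℝ) :
    HasDerivAt (fun s => area m (x s) ^ (-(((n : ℝ) - 2) / ((n : ℝ) - 1))) *
        (weightedMeanCurvature m (x s) (ν s) + c))
      (area m (x t) ^ (-(((n : ℝ) - 2) / ((n : ℝ) - 1))) *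
        (-4 * flux m x ν t (gradU m) - ((n : ℝ) - 2) / ((n : ℝ) - 1) * c - dissipation m x ν t))
      t := by
  have hA := h.area_pos hn hm ht
  -- As `|Σ|' = |Σ|`, the power contributes the factor `-(n-2)/(n-1)`, which cancels the growth term
  -- of the weighted mean curvature and leaves only its effect on `c`.
  have h1 := ((h.hasDerivAt_area hn hm ht).rpow_const
    (p := -(((n : ℝ) - 2) / ((n : ℝ) - 1))) (Or.inl hA.ne')).mul
      ((h.hasDerivAt_weightedMeanCurvature hn hm ht).add_const c)
  refine h1.congr_deriv ?_
  rw [Real.rpow_sub hA, Real.rpow_one]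
  field_simp
  ring

/-- Here `-4` times the flux is `2(n-2)mω`, exactly `(n-2)/(n-1)` times the additive constant of
`Q`, so only dissipation survives. -/
theorem hasDerivAt_Q (h : IsSmoothIMCF m T x ν Ω) (hn : 3 ≤ n) (hm : 0 < m)
    {t : ℝ} (ht : t ∈ Ioo 0 T) (hΩ : HomologousToHorizon m (range (x t)) (Ω t)) :
    HasDerivAt (fun s => Q m (x s) (ν s))
      (-(area m (x t) ^ (-(((n : ℝ) - 2) / ((n : ℝ) - 1))) * dissipation m x ν t)) t := by
  refine (h.hasDerivAt_scaled hn hm ht _).congr_deriv ?_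
  have h1 : (n : ℝ) - 1 ≠ 0 := by
    have : (3 : ℝ) ≤ n := by exact_mod_cast hn
    linarith
  rw [h.flux_gradU_of_homologousToHorizon hn hm ht hΩ]
  field_simp
  ring

theorem hasDerivAt_Qtilde (h : IsSmoothIMCF m T x ν Ω) (hn : 3 ≤ n) (hm : 0 < m)
    {t : ℝ} (ht : t ∈ Ioo 0 T) (hΩ : NullHomologous m (range (x t)) (Ω t)) :
    HasDerivAt (fun s => Qtilde m (x s) (ν s))
      (-(area m (x t) ^ (-(((n : ℝ) - 2) / ((n : ℝ) - 1))) * dissipation m x ν t)) t := by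
  have h1 := h.hasDerivAt_scaled hn hm ht 0
  simp only [add_zero, h.flux_gradU_of_nullHomologous hn hm ht hΩ] at h1
  refine h1.congr_deriv ?_
  ring

end IsSmoothIMCF

end Evolution

/-! ### Monotonicity and rigidity on a closed time interval. -/

section Comparison

variable {f A D : ℝ → ℝ} {a b : ℝ}

/-- A function whose derivative is `-A D` with `A > 0` and `D ≥ 0` decreases, strictly unless `D`
vanishes. -/
theorem le_and_eq_iff_of_hasDerivAt (hab : a < b)
    (hf : ∀ t ∈ Icc a b, HasDerivAt f (-(A t * D t)) t) (hA : ∀ t ∈ Icc a b, 0 < A t)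
    (hD : ∀ t ∈ Icc a b, 0 ≤ D t) : f b ≤ f a ∧ (f b = f a ↔ ∀ t ∈ Icc a b, D t = 0) := by
  have hc : ContinuousOn f (Icc a b) := fun t ht => (hf t ht).continuousAt.continuousWithinAt
  have hanti : AntitoneOn f (Icc a b) := by
    refine antitoneOn_of_deriv_nonpos (convex_Icc a b) hc (fun t ht => ?_) fun t ht => ?_
    · exact (hf t (interior_subset ht)).differentiableAt.differentiableWithinAt
    · rw [(hf t (interior_subset ht)).deriv]
      exact neg_nonpos.mpr (mul_nonneg (hA t (interior_subset ht)).le (hD t (interior_subset ht)))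
  have ha : a ∈ Icc a b := left_mem_Icc.mpr hab.le
  have hb : b ∈ Icc a b := right_mem_Icc.mpr hab.le
  refine ⟨hanti ha hb hab.le, fun h t ht => ?_, fun h => ?_⟩
  · have hconst : ∀ s ∈ Icc a b, f s = f a := fun s hs =>
      le_antisymm (hanti ha hs hs.1) (h ▸ hanti hs hb hs.2)
    have h1 : HasDerivWithinAt f 0 (Icc a b) t :=
      (hasDerivWithinAt_const t (Icc a b) (f a)).congr hconst (hconst t ht)
    -- Equal end values force `f` to be constant; uniqueness of derivatives within the closed
    -- interval yields `D = 0` at the endpoints too.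
    have h2 := (uniqueDiffOn_Icc hab t ht).eq_deriv _ (hf t ht).hasDerivWithinAt h1
    exact (mul_eq_zero.mp (neg_eq_zero.mp h2)).resolve_left (hA t ht).ne'
  · refine constant_of_has_deriv_right_zero hc (fun t ht => ?_) b hb
    have h1 := (hf t (Ico_subset_Icc_self ht)).hasDerivWithinAt (s := Ici t)
    rwa [h t (Ico_subset_Icc_self ht), mul_zero, neg_zero] at h1

end Comparison

theorem sphereArea_pos {n : ℕ} (hn : 3 ≤ n) : 0 < sphereArea n := by
  rw [sphereArea, Measure.toSphere_real_apply_univ, finrank_euclideanSpace_fin]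
  have : (0 : ℝ) < n := by exact_mod_cast (by omega : 0 < n)
  have h1 : 0 < (volume : Measure (E n)).real (ball 0 1) :=
    ENNReal.toReal_pos (measure_ball_pos volume 0 one_pos).ne' measure_ball_lt_top.ne
  positivity

end Schwarzschild

end

theorem mainTheorem5 {n : ℕ} (hn : 3 ≤ n) {m : ℝ} (hm : 0 < m)
    {S : Type*} [TopologicalSpace S] [T2Space S] [CompactSpace S]
    [ChartedSpace (Schwarzschild.E (n - 1)) S] [IsManifold (𝓡 (n - 1)) ∞ S]
    {T : ℝ} (x ν : ℝ → S → Schwarzschild.E n) (Ω : ℝ → Set (Schwarzschild.E n))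
    (hflow : Schwarzschild.IsSmoothIMCF m T x ν Ω)
    {t₁ t₂ : ℝ} (ht₁ : 0 < t₁) (ht₁₂ : t₁ < t₂) (ht₂ : t₂ < T) :
    ((∀ t ∈ Icc t₁ t₂, Schwarzschild.HomologousToHorizon m (range (x t)) (Ω t)) →
      Schwarzschild.Q m (x t₂) (ν t₂) ≤ Schwarzschild.Q m (x t₁) (ν t₁) ∧
      (Schwarzschild.Q m (x t₂) (ν t₂) = Schwarzschild.Q m (x t₁) (ν t₁) ↔
        ∀ t ∈ Icc t₁ t₂, Schwarzschild.TotallyUmbilic m (x t) (ν t))) ∧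
    ((∀ t ∈ Icc t₁ t₂, Schwarzschild.NullHomologous m (range (x t)) (Ω t)) →
      Schwarzschild.Qtilde m (x t₂) (ν t₂) ≤ Schwarzschild.Qtilde m (x t₁) (ν t₁) ∧
      (Schwarzschild.Qtilde m (x t₂) (ν t₂) = Schwarzschild.Qtilde m (x t₁) (ν t₁) ↔
        ∀ t ∈ Icc t₁ t₂, Schwarzschild.TotallyUmbilic m (x t) (ν t)) ∧
      StrictAntiOn (fun t => Schwarzschild.Q m (x t) (ν t)) (Icc t₁ t₂)) := by
  have hI : ∀ t ∈ Icc t₁ t₂, t ∈ Ioo 0 T := fun t ht => ⟨ht₁.trans_le ht.1, ht.2.trans_lt ht₂⟩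
  have hA : ∀ t ∈ Icc t₁ t₂, 0 < Schwarzschild.area m (x t) ^
      (-(((n : ℝ) - 2) / ((n : ℝ) - 1))) := fun t ht =>
    Real.rpow_pos_of_pos (hflow.area_pos hn hm (hI t ht)) _
  have hD := fun t ht => hflow.dissipation_nonneg_and hn hm (hI t ht)
  have hiff : (∀ t ∈ Icc t₁ t₂, Schwarzschild.dissipation m x ν t = 0) ↔
      ∀ t ∈ Icc t₁ t₂, Schwarzschild.TotallyUmbilic m (x t) (ν t) :=
    forall₂_congr fun t ht => (hD t ht).2
  refine ⟨fun hΩ => ?_, fun hΩ => ?_⟩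
  · have h1 := Schwarzschild.le_and_eq_iff_of_hasDerivAt ht₁₂
      (fun t ht => hflow.hasDerivAt_Q hn hm (hI t ht) (hΩ t ht)) hA fun t ht => (hD t ht).1
    exact ⟨h1.1, h1.2.trans hiff⟩
  · have h1 := Schwarzschild.le_and_eq_iff_of_hasDerivAt ht₁₂
      (fun t ht => hflow.hasDerivAt_Qtilde hn hm (hI t ht) (hΩ t ht)) hA fun t ht => (hD t ht).1
    refine ⟨h1.1, h1.2.trans hiff, ?_⟩
    -- With zero flux nothing compensates the positive additive constant of `Q`, so its contribution
    -- makes the derivative strictly negative even when the dissipation vanishes.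
    have h2 := fun t ht => hflow.hasDerivAt_scaled hn hm (hI t ht)
      (2 * ((n : ℝ) - 1) * m * Schwarzschild.sphereArea n)
    refine strictAntiOn_of_deriv_neg (convex_Icc t₁ t₂)
      (fun t ht => (h2 t ht).continuousAt.continuousWithinAt) fun t ht => ?_
    have ht' := interior_subset ht
    refine lt_of_eq_of_lt (h2 t ht').deriv (mul_neg_of_pos_of_neg (hA t ht') ?_)
    have hn' : (3 : ℝ) ≤ n := by exact_mod_cast hn
    have h3 : 0 < ((n : ℝ) - 2) / ((n : ℝ) - 1) *
        (2 * ((n : ℝ) - 1) * m * Schwarzschild.sphereArea n) :=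
      mul_pos (div_pos (by linarith) (by linarith))
        (mul_pos (mul_pos (by linarith) hm) (Schwarzschild.sphereArea_pos hn))
    rw [hflow.flux_gradU_of_nullHomologous hn hm (hI t ht') (hΩ t ht')]
    linarith [(hD t ht').1]
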